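/- **Setting.** Let $\beta:\mathbb R^2\to\mathbb R$ be integrable, with Fourier transform $\widehat\beta(\xi)=\int_{\mathbb R^2}e^{-iz\cdot\xi}\beta(z)\,dz$ satisfying $0\le\widehat\beta(\xi)\le C(1+|\xi|^2)^{-r/2}$ for all $\xi\in\mathbb R^2$ and some constant $C>0$. Let $s,r$ be real numbers with either $s>2$ and $r\ge 2$, or $s\ge 1$ and $r>3$. Let $F\in C^{[s]+1}(\mathbb R)$ be real-valued with $F(0)=0$. Let $X^s=\{w\in H^s(\mathbb R^2)\text{ real-valued}:\ w_x,w_y\in L^\infty(\mathbb R^2)\}$ with the norm $\|w\|_{X^s}=\|w\|_{H^s}+\|w_x\|_{L^\infty}+\|w_y\|_{L^\infty}$, and let $\varphi,\psi\in X^s$. Consider the Cauchy problem $$w_{tt}=\Big(\beta*\frac{\partial F}{\partial w_x}\Big)_x+\Big(\beta*\frac{\partial F}{\partial w_y}\Big)_y\quad(t>0),\qquad w(0)=\varphi,\quad w_t(0)=\psi, \tag{1}$$ where $F=F(|\nabla w|^2)$, so that $\frac{\partial F}{\partial w_x}=2w_xF'(|\nabla w|^2)$ and $\frac{\partial F}{\partial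 w_y}=2w_yF'(|\nabla w|^2)$, and the outer space derivatives are taken in the sense of distributions. Let $R$ be the (unbounded) operator $Ru=\mathcal F^{-1}\big(\widehat\beta^{\,-1/2}\,\widehat u\big)$ on $L^2(\mathbb R^2)$ (where $\widehat\beta$ vanishes, $\widehat\beta^{\,-1/2}\widehat u$ is read as $0$ if $\widehat u=0$ and as $\infty$ otherwise), and let $\|\cdot\|$ be the $L^2(\mathbb R^2)$ norm. **Theorem 5.2.** Let $w\in C^2([0,T_{\max}),X^s)$, $0<T_{\max}\le\infty$, be a solution of (1) on its maximal interval of existence, that is, one that does not extend to a solution in $C^2([0,T'),X^s)$ with $T'>T_{\max}$. Suppose that $R\varphi,R\psi\in L^2(\mathbb R^2)$ and $F(|\nabla\varphi|^2)\in L^1(\mathbb R^2)$. If there is a number $\nu>0$ such that $$uF'(u)\le(1+2\nu)F(u)\qquad\text{for all }u\ge 0,$$ and $$E(0)=\tfrac12\|R\psi\|^2+\int_{\mathbb R^2}F(|\nabla\varphi|^2)\,dx\,dy<0,$$ then $w$ blows up in finite time: $T_{\max}<\infty$ and $$\limsup_{t\to T_{\max}^-}\big(\|w(t)\|_{X^s}+\|w_t(t)\|_{X^s}\big)=\infty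 .$$ -/

import Mathlib

open MeasureTheory Filter Topology
open scoped ENNReal ContDiff FourierTransform

namespace AntiPlane

noncomputable section

/-- The plane `ℝ²` with its Euclidean norm. -/
abbrev Plane : Type := EuclideanSpace ℝ (Fin 2)

/-- Real-valued `L²(ℝ²)`. -/
abbrev L2 : Type := Lp ℝ 2 (volume : Measure Plane)

/-- Real-valued `L^∞(ℝ²)`. -/
abbrev Linfty : Type := Lp ℝ ∞ (volume : Measure Plane)

/-! ### Fourier transforms, with the normalisation `û(ξ) = ∫ e^{-i z·ξ} u(z) dz` -/

/-- The Fourier transform `β̂(ξ) = ∫ e^{-i z·ξ} β(z) dz` of an integrable function. -/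
def kernelHat (β : Plane → ℝ) (ξ : Plane) : ℂ :=
  ∫ z : Plane, Complex.exp (-(Complex.I * ((inner ℝ z ξ : ℝ) : ℂ))) * (β z : ℂ)

/-- The inclusion of real-valued into complex-valued `L²`. -/
def toComplex : L2 →L[ℝ] Lp ℂ 2 (volume : Measure Plane) :=
  Complex.ofRealCLM.compLpL 2 volume

/-- The (Plancherel) Fourier transform of `u ∈ L²`. Mathlib's transform has the phase
`e^{-2πi z·η}`, so `û(ξ)` is its value at `η = ξ / (2π)`. -/
def l2Hat (u : L2) (ξ : Plane) : ℂ :=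
  (𝓕 (toComplex u) : Lp ℂ 2 (volume : Measure Plane)) ((2 * Real.pi)⁻¹ • ξ)

/-- The Sobolev norm `‖u‖_s = (∫ (1 + |ξ|²)^s |û(ξ)|² dξ)^{1/2}`, possibly infinite. -/
def sobolevNorm (s : ℝ) (u : L2) : ℝ≥0∞ :=
  eLpNorm (fun ξ : Plane => (((1 + ‖ξ‖ ^ 2) ^ (s / 2) : ℝ) : ℂ) * l2Hat u ξ) 2 volume

/-! ### Weak derivatives -/

/-- The `i`-th classical partial derivative. -/
def pderiv (i : Fin 2) (θ : Plane → ℝ) (z : Plane) : ℝ :=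
  fderiv ℝ θ z (EuclideanSpace.single i 1)

/-- Test functions: `C_c^∞(ℝ²)`. -/
def IsTest (θ : Plane → ℝ) : Prop :=
  ContDiff ℝ ∞ θ ∧ HasCompactSupport θ

/-- `g` is the `i`-th distributional partial derivative of `u`. -/
def IsWeakPartial (i : Fin 2) (u g : Plane → ℝ) : Prop :=
  ∀ θ : Plane → ℝ, IsTest θ → ∫ z, u z * pderiv i θ z = -∫ z, g z * θ z

/-! ### The Banach space `X^s` -/

theorem quasi_scale :
    Measure.QuasiMeasurePreserving (fun ξ : Plane => (2 * Real.pi)⁻¹ • ξ) volume volume := by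
  have hne : (2 * Real.pi)⁻¹ ≠ 0 := inv_ne_zero (by positivity)
  refine ⟨measurable_const_smul _, ?_⟩
  rw [Measure.map_addHaar_smul _ hne]
  exact Measure.smul_absolutelyContinuous

theorem l2Hat_add (u v : L2) : l2Hat (u + v) =ᵐ[volume] fun ξ => l2Hat u ξ + l2Hat v ξ := by
  have h : (𝓕 (toComplex (u + v)) : Lp ℂ 2 (volume : Measure Plane))
      = 𝓕 (toComplex u) + 𝓕 (toComplex v) := by
    rw [map_add, FourierTransform.fourier_add]
  have h2 := quasi_scale.ae (Lp.coeFn_add (𝓕 (toComplex u)) (𝓕 (toComplex v)))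
  filter_upwards [h2] with ξ hξ
  simpa [l2Hat, h] using hξ

theorem l2Hat_smul (c : ℝ) (u : L2) :
    l2Hat (c • u) =ᵐ[volume] fun ξ => (c : ℂ) * l2Hat u ξ := by
  have h1 : toComplex (c • u) = (c : ℂ) • toComplex u := by
    rw [map_smul]
    ext1
    filter_upwards [Lp.coeFn_smul c (toComplex u), Lp.coeFn_smul (c : ℂ) (toComplex u)]
      with z h1 h2
    rw [h1, h2]
    simp
  have h : (𝓕 (toComplex (c • u)) : Lp ℂ 2 (volume : Measure Plane))
      = (c : ℂ) • 𝓕 (toComplex u) := by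
    rw [h1, FourierTransform.fourier_smul]
  have h2 := quasi_scale.ae (Lp.coeFn_smul (c : ℂ) (𝓕 (toComplex u)))
  filter_upwards [h2] with ξ hξ
  unfold l2Hat
  rw [h, hξ, Pi.smul_apply, smul_eq_mul]

theorem aesm_weighted (s : ℝ) (u : L2) :
    AEStronglyMeasurable
      (fun ξ : Plane => (((1 + ‖ξ‖ ^ 2) ^ (s / 2) : ℝ) : ℂ) * l2Hat u ξ) volume := by
  refine AEStronglyMeasurable.mul ?_ ?_
  · exact (by fun_prop : Measurable
      (fun ξ : Plane => (((1 + ‖ξ‖ ^ 2) ^ (s / 2) : ℝ) : ℂ))).aestronglyMeasurable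
  · exact (Lp.aestronglyMeasurable (𝓕 (toComplex u))).comp_quasiMeasurePreserving quasi_scale

theorem sobolevNorm_add_le (s : ℝ) (u v : L2) :
    sobolevNorm s (u + v) ≤ sobolevNorm s u + sobolevNorm s v := by
  refine le_trans (le_of_eq ?_)
    (eLpNorm_add_le (aesm_weighted s u) (aesm_weighted s v) (by norm_num))
  refine eLpNorm_congr_ae ?_
  filter_upwards [l2Hat_add u v] with ξ hξ
  simp [hξ, mul_add]

theorem sobolevNorm_smul (s : ℝ) (c : ℝ) (u : L2) :
    sobolevNorm s (c • u) = ‖c‖ₑ * sobolevNorm s u := by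
  have h : sobolevNorm s (c • u) = eLpNorm ((c : ℂ) •
      fun ξ : Plane => (((1 + ‖ξ‖ ^ 2) ^ (s / 2) : ℝ) : ℂ) * l2Hat u ξ) 2 volume := by
    refine eLpNorm_congr_ae ?_
    filter_upwards [l2Hat_smul c u] with ξ hξ
    simp only [hξ, Pi.smul_apply, smul_eq_mul]
    ring
  rw [h, eLpNorm_const_smul]
  congr 1
  simp [enorm]

theorem sobolevNorm_eq_zero {s : ℝ} {u : L2} (h : sobolevNorm s u = 0) : u = 0 := by
  have h1 := (eLpNorm_eq_zero_iff (aesm_weighted s u) (by norm_num)).1 h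
  have h2 : ∀ᵐ ξ : Plane, l2Hat u ξ = 0 := by
    filter_upwards [h1] with ξ hξ
    have : (0 : ℝ) < (1 + ‖ξ‖ ^ 2) ^ (s / 2) := by positivity
    have h' : (((1 + ‖ξ‖ ^ 2) ^ (s / 2) : ℝ) : ℂ) ≠ 0 := by exact_mod_cast this.ne'
    exact (mul_eq_zero.1 hξ).resolve_left h'
  have hq : Measure.QuasiMeasurePreserving (fun ξ : Plane => (2 * Real.pi) • ξ)
      volume volume := by
    refine ⟨measurable_const_smul _, ?_⟩
    rw [Measure.map_addHaar_smul _ (by positivity)]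
    exact Measure.smul_absolutelyContinuous
  have h3 : (𝓕 (toComplex u) : Lp ℂ 2 (volume : Measure Plane)) = 0 := by
    ext1
    filter_upwards [hq.ae h2, Lp.coeFn_zero ℂ 2 (volume : Measure Plane)] with ξ hξ h0
    rw [h0]
    have hc : (2 * Real.pi)⁻¹ * (2 * Real.pi) = 1 := inv_mul_cancel₀ (by positivity)
    unfold l2Hat at hξ
    rwa [smul_smul, hc, one_smul] at hξ
  have h4 : toComplex u = 0 := by
    rw [← norm_eq_zero, ← Lp.norm_fourier_eq, h3, norm_zero]
  ext1
  have h5 : (toComplex u : Plane → ℂ) =ᵐ[volume] fun z => ((u z : ℝ) : ℂ) :=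
    Complex.ofRealCLM.coeFn_compLpL u
  rw [h4] at h5
  filter_upwards [h5, Lp.coeFn_zero ℂ 2 (volume : Measure Plane),
    Lp.coeFn_zero ℝ 2 (volume : Measure Plane)] with z a b c
  rw [b] at a
  rw [c]
  exact Complex.ofReal_eq_zero.1 a.symm

theorem IsTest.continuous_pderiv {θ : Plane → ℝ} (h : IsTest θ) (i : Fin 2) :
    Continuous (pderiv i θ) :=
  (h.1.continuous_fderiv (by simp)).clm_apply continuous_const

theorem IsTest.compact_pderiv {θ : Plane → ℝ} (h : IsTest θ) (i : Fin 2) :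
    HasCompactSupport (pderiv i θ) :=
  h.2.fderiv_apply (𝕜 := ℝ) (EuclideanSpace.single i 1)

theorem integrable_mul_cc {p : ℝ≥0∞} (hp : 1 ≤ p) (u : Lp ℝ p (volume : Measure Plane))
    {θ : Plane → ℝ} (hc : Continuous θ) (hs : HasCompactSupport θ) :
    Integrable (fun z => u z * θ z) volume := by
  have h := ((Lp.memLp u).locallyIntegrable hp).integrable_smul_right_of_hasCompactSupport hc hs
  simpa [smul_eq_mul] using h

theorem IsWeakPartial.add {i : Fin 2} {u v : L2} {g h : Linfty}
    (hg : IsWeakPartial i u g) (hh : IsWeakPartial i v h) :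
    IsWeakPartial i (u + v : L2) (g + h : Linfty) := by
  intro θ hθ
  have e1 : ∫ z, (u + v : L2) z * pderiv i θ z
      = ∫ z, (u z * pderiv i θ z + v z * pderiv i θ z) := by
    refine integral_congr_ae ?_
    filter_upwards [Lp.coeFn_add u v] with z hz
    rw [hz, Pi.add_apply, add_mul]
  have e2 : ∫ z, (g + h : Linfty) z * θ z = ∫ z, (g z * θ z + h z * θ z) := by
    refine integral_congr_ae ?_
    filter_upwards [Lp.coeFn_add g h] with z hz
    rw [hz, Pi.add_apply, add_mul]
  have c := hθ.continuous_pderiv i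
  have k := hθ.compact_pderiv i
  rw [e1, e2,
    integral_add (integrable_mul_cc (by norm_num) u c k) (integrable_mul_cc (by norm_num) v c k),
    integral_add (integrable_mul_cc (by simp) g hθ.1.continuous hθ.2)
      (integrable_mul_cc (by simp) h hθ.1.continuous hθ.2), hg θ hθ, hh θ hθ]
  ring

theorem IsWeakPartial.smul {i : Fin 2} {u : L2} {g : Linfty} (c : ℝ)
    (hg : IsWeakPartial i u g) : IsWeakPartial i (c • u : L2) (c • g : Linfty) := by
  intro θ hθ
  have e1 : ∫ z, (c • u : L2) z * pderiv i θ z = ∫ z, c * (u z * pderiv i θ z) := by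
    refine integral_congr_ae ?_
    filter_upwards [Lp.coeFn_smul c u] with z hz
    rw [hz, Pi.smul_apply, smul_eq_mul, mul_assoc]
  have e2 : ∫ z, (c • g : Linfty) z * θ z = ∫ z, c * (g z * θ z) := by
    refine integral_congr_ae ?_
    filter_upwards [Lp.coeFn_smul c g] with z hz
    rw [hz, Pi.smul_apply, smul_eq_mul, mul_assoc]
  rw [e1, e2, integral_const_mul, integral_const_mul, hg θ hθ]
  ring

/-- Weak derivatives are unique. -/
theorem IsWeakPartial.unique {i : Fin 2} {u : L2} {g h : Linfty}
    (hg : IsWeakPartial i u g) (hh : IsWeakPartial i u h) : g = h := by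
  ext1
  refine ae_eq_of_integral_contDiff_smul_eq ((Lp.memLp g).locallyIntegrable (by simp))
    ((Lp.memLp h).locallyIntegrable (by simp)) ?_
  intro θ h1 h2
  have h3 := (hg θ ⟨h1, h2⟩).symm.trans (hh θ ⟨h1, h2⟩)
  simpa [smul_eq_mul, mul_comm] using h3

/-- The set `X^s = {w ∈ H^s(ℝ²) : w_x, w_y ∈ L^∞(ℝ²)}`. -/
def xSubmodule (s : ℝ) : Submodule ℝ L2 where
  carrier := {u | sobolevNorm s u < ⊤ ∧ ∀ i : Fin 2, ∃ g : Linfty, IsWeakPartial i u g}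
  zero_mem' := by
    refine ⟨?_, fun i => ⟨0, ?_⟩⟩
    · have h := sobolevNorm_smul s 0 0
      rw [zero_smul] at h
      rw [h]
      simp
    · intro θ _
      have e1 : ∫ z, (0 : L2) z * pderiv i θ z = 0 := by
        refine integral_eq_zero_of_ae ?_
        filter_upwards [Lp.coeFn_zero ℝ 2 (volume : Measure Plane)] with z hz
        rw [hz]
        simp
      have e2 : ∫ z, (0 : Linfty) z * θ z = 0 := by
        refine integral_eq_zero_of_ae ?_
        filter_upwards [Lp.coeFn_zero ℝ ∞ (volume : Measure Plane)] with z hz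
        rw [hz]
        simp
      rw [e1, e2, neg_zero]
  add_mem' := by
    rintro u v ⟨hu, hu'⟩ ⟨hv, hv'⟩
    refine ⟨(sobolevNorm_add_le s u v).trans_lt (ENNReal.add_lt_top.2 ⟨hu, hv⟩), fun i => ?_⟩
    obtain ⟨g, hg⟩ := hu' i
    obtain ⟨h, hh⟩ := hv' i
    exact ⟨g + h, hg.add hh⟩
  smul_mem' := by
    rintro c u ⟨hu, hu'⟩
    refine ⟨?_, fun i => ?_⟩
    · rw [sobolevNorm_smul]
      exact ENNReal.mul_lt_top (by simp) hu
    · obtain ⟨g, hg⟩ := hu' i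
      exact ⟨c • g, hg.smul c⟩

/-- `X^s` as a type of its own; its norm is the one below and not the norm of `L²`. -/
def XSpace (s : ℝ) : Type := xSubmodule s

instance (s : ℝ) : AddCommGroup (XSpace s) := inferInstanceAs (AddCommGroup (xSubmodule s))

instance (s : ℝ) : Module ℝ (XSpace s) := inferInstanceAs (Module ℝ (xSubmodule s))

/-- The inclusion `X^s ⊆ L²`. -/
def XSpace.toL2 {s : ℝ} : XSpace s →ₗ[ℝ] L2 := (xSubmodule s).subtype

/-- The weak partial derivative `∂_i w ∈ L^∞` of `w ∈ X^s`. -/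
def XSpace.wpartial {s : ℝ} (i : Fin 2) (w : XSpace s) : Linfty :=
  Classical.choose (w.2.2 i)

theorem XSpace.isWeakPartial {s : ℝ} (i : Fin 2) (w : XSpace s) :
    IsWeakPartial i w.toL2 (w.wpartial i) :=
  Classical.choose_spec (w.2.2 i)

theorem XSpace.wpartial_add {s : ℝ} (i : Fin 2) (v w : XSpace s) :
    (v + w).wpartial i = v.wpartial i + w.wpartial i := by
  have h := (v.isWeakPartial i).add (w.isWeakPartial i)
  rw [← map_add] at h
  exact ((v + w).isWeakPartial i).unique h

theorem XSpace.wpartial_smul {s : ℝ} (i : Fin 2) (c : ℝ) (w : XSpace s) :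
    (c • w).wpartial i = c • w.wpartial i := by
  have h := (w.isWeakPartial i).smul c
  rw [← map_smul] at h
  exact ((c • w).isWeakPartial i).unique h

/-- The norm `‖w‖_{X^s} = ‖w‖_s + ‖w_x‖_{L^∞} + ‖w_y‖_{L^∞}`. -/
instance (s : ℝ) : Norm (XSpace s) where
  norm w := (sobolevNorm s w.toL2).toReal + ‖w.wpartial 0‖ + ‖w.wpartial 1‖

theorem XSpace.norm_def {s : ℝ} (w : XSpace s) :
    ‖w‖ = (sobolevNorm s w.toL2).toReal + ‖w.wpartial 0‖ + ‖w.wpartial 1‖ := rfl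

theorem XSpace.sobolevNorm_ne_top {s : ℝ} (w : XSpace s) : sobolevNorm s w.toL2 ≠ ⊤ :=
  w.2.1.ne

theorem XSpace.norm_smul_eq {s : ℝ} (c : ℝ) (w : XSpace s) : ‖c • w‖ = ‖c‖ * ‖w‖ := by
  rw [XSpace.norm_def, XSpace.norm_def, XSpace.wpartial_smul, XSpace.wpartial_smul, map_smul,
    sobolevNorm_smul, norm_smul, norm_smul, ENNReal.toReal_mul, toReal_enorm]
  ring

instance (s : ℝ) : NormedAddCommGroup (XSpace s) :=
  AddGroupNorm.toNormedAddCommGroup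
    { toFun := fun w => ‖w‖
      map_zero' := by
        have h := XSpace.norm_smul_eq (0 : ℝ) (0 : XSpace s)
        rwa [zero_smul, norm_zero, zero_mul] at h
      add_le' := by
        intro v w
        have h1 := ENNReal.toReal_mono
          (ENNReal.add_ne_top.2 ⟨v.sobolevNorm_ne_top, w.sobolevNorm_ne_top⟩)
          (sobolevNorm_add_le s v.toL2 w.toL2)
        rw [ENNReal.toReal_add v.sobolevNorm_ne_top w.sobolevNorm_ne_top] at h1
        have h2 := norm_add_le (v.wpartial 0) (w.wpartial 0)
        have h3 := norm_add_le (v.wpartial 1) (w.wpartial 1)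
        rw [XSpace.norm_def, XSpace.norm_def, XSpace.norm_def, XSpace.wpartial_add,
          XSpace.wpartial_add, map_add]
        linarith
      neg' := by
        intro w
        have h := XSpace.norm_smul_eq (-1 : ℝ) w
        simpa using h
      eq_zero_of_map_eq_zero' := by
        intro w hw
        rw [XSpace.norm_def] at hw
        have h0 : 0 ≤ (sobolevNorm s w.toL2).toReal := ENNReal.toReal_nonneg
        have h1 := norm_nonneg (w.wpartial 0)
        have h2 := norm_nonneg (w.wpartial 1)
        have h3 : (sobolevNorm s w.toL2).toReal = 0 := by linarith
        have h4 : sobolevNorm s w.toL2 = 0 :=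
          ((ENNReal.toReal_eq_zero_iff _).1 h3).resolve_right w.sobolevNorm_ne_top
        exact Subtype.ext (sobolevNorm_eq_zero h4) }

instance (s : ℝ) : NormedSpace ℝ (XSpace s) where
  norm_smul_le c w := (XSpace.norm_smul_eq c w).le

/-! ### The equation -/

/-- `|∇w|² = w_x² + w_y²`. -/
def gradSq {s : ℝ} (w : XSpace s) (z : Plane) : ℝ :=
  w.wpartial 0 z ^ 2 + w.wpartial 1 z ^ 2

/-- `∂F/∂w_x` (for `i = 0`) and `∂F/∂w_y` (for `i = 1`), where `F = F(|∇w|²)`; explicitly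
`2 w_{x_i} F'(|∇w|²)`. -/
def stress {s : ℝ} (F : ℝ → ℝ) (w : XSpace s) (i : Fin 2) (z : Plane) : ℝ :=
  2 * w.wpartial i z * deriv F (gradSq w z)

/-- The convolution `(β * u)(z) = ∫ β(z - z') u(z') dz'`. -/
def convol (β u : Plane → ℝ) (z : Plane) : ℝ :=
  ∫ z' : Plane, β (z - z') * u z'

/-- `a = (β * ∂F/∂w_x)_x + (β * ∂F/∂w_y)_y` in the sense of distributions. -/
def EqForce {s : ℝ} (β : Plane → ℝ) (F : ℝ → ℝ) (w : XSpace s) (a : L2) : Prop :=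
  ∀ θ : Plane → ℝ, IsTest θ →
    ∫ z, a z * θ z = -∑ i : Fin 2, ∫ z, convol β (stress F w i) z * pderiv i θ z

/-- The kernel is integrable and `0 ≤ β̂(ξ) ≤ C (1 + |ξ|²)^{-r/2}` for all `ξ`, with some
constant `C > 0`. -/
structure IsKernel (β : Plane → ℝ) (r : ℝ) : Prop where
  integrable : Integrable β volume
  im_eq_zero : ∀ ξ, (kernelHat β ξ).im = 0
  nonneg : ∀ ξ, 0 ≤ (kernelHat β ξ).re
  decay : ∃ C : ℝ, 0 < C ∧ ∀ ξ, (kernelHat β ξ).re ≤ C * (1 + ‖ξ‖ ^ 2) ^ (-(r / 2))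

/-- The time interval `[0, T)`, where `T` may be `∞`. -/
def timeInterval (T : EReal) : Set ℝ := {t | 0 ≤ t ∧ (t : EReal) < T}

/-- `w ∈ C²([0, T), X^s)` solves `w_tt = (β * ∂F/∂w_x)_x + (β * ∂F/∂w_y)_y` for `0 < t < T`
with `w(0) = φ` and `w_t(0) = ψ`. Derivatives in time are those of `X^s`-valued curves, one-sided
at `t = 0`. The values of `w` outside `[0, T)` play no role. -/
structure IsSolution {s : ℝ} (β : Plane → ℝ) (F : ℝ → ℝ) (φ ψ : XSpace s) (T : EReal)
    (w : ℝ → XSpace s) : Prop where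
  pos : 0 < T
  contDiffOn : ContDiffOn ℝ 2 w (timeInterval T)
  init : w 0 = φ
  init_deriv : derivWithin w (timeInterval T) 0 = ψ
  eqn : ∀ t ∈ timeInterval T, 0 < t →
    EqForce β F (w t)
      (derivWithin (derivWithin w (timeInterval T)) (timeInterval T) t).toL2

/-- A solution on `[0, T)` that cannot be extended to a solution on a longer interval, so that
`T = T_max`; a global solution (`T = ∞`) is maximal. -/
structure IsMaximalSolution {s : ℝ} (β : Plane → ℝ) (F : ℝ → ℝ) (φ ψ : XSpace s) (T : EReal)
    (w : ℝ → XSpace s) : Prop where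
  isSolution : IsSolution β F φ ψ T w
  maximal : ∀ (T' : EReal) (w' : ℝ → XSpace s), T < T' → IsSolution β F φ ψ T' w' →
    ¬ Set.EqOn w' w (timeInterval T)

/-- Blow-up in finite time of a solution on its maximal interval `[0, T)`: `T` is finite and
`limsup_{t → T⁻} (‖w(t)‖_{X^s} + ‖w_t(t)‖_{X^s}) = ∞`. -/
def BlowsUpInFiniteTime {s : ℝ} (T : EReal) (w : ℝ → XSpace s) : Prop :=
  ∃ T₀ : ℝ, T = (T₀ : EReal) ∧
    limsup (fun t : ℝ => ‖w t‖ₑ + ‖derivWithin w (timeInterval T) t‖ₑ) (𝓝[<] T₀) = ⊤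

/-- The unbounded operator `R u = 𝓕⁻¹ (β̂^{-1/2} û)` on `L²`, as a relation: `R u` exists in `L²`
and equals `v`. Where `β̂` vanishes, `β̂^{-1/2} û` is understood as `0` if `û` vanishes there and as
infinite otherwise; so `û = 0` almost everywhere on `{β̂ = 0}` for `u` in the domain of `R`. -/
def HasR (β : Plane → ℝ) (u v : L2) : Prop :=
  ∀ᵐ ξ : Plane, (0 < (kernelHat β ξ).re →
      l2Hat v ξ = (((kernelHat β ξ).re ^ (-(1 / 2) : ℝ) : ℝ) : ℂ) * l2Hat u ξ) ∧
    (kernelHat β ξ = 0 → l2Hat u ξ = 0 ∧ l2Hat v ξ = 0)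

end

end AntiPlane

open AntiPlane

open scoped SchwartzMap ComplexConjugate

namespace AntiPlane

noncomputable section

/-! Two facts are combined: no solution of negative energy is global, and a solution whose norm
stays bounded up to a finite time `T₀` extends beyond `T₀`. A maximal solution therefore lives for a
finite time and cannot stay bounded near its end.

Global existence is excluded by Levine's concavity method (`not_isSolution_top`, `false_of_virial`,
`not_forall_concavity`). Formally `z = R w` solves `z'' = q`, where `q` is the sum over `i` of the
multipliers `i ξ_i β̂^{1/2}` applied to the stresses `2 w_i F'(|∇w|²)`. The energy `‖z'‖²/2 + ∫
F(|∇w|²)` is conserved, and integration by parts gives `⟨z, q⟩ = -2 ∫ |∇w|² F'(|∇w|²) ≥ -2(1 + 2ν) ∫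
F(|∇w|²)`. Hence `f = ‖z‖² + b (t + τ)²` with `b = -2 E(0)` satisfies `f f'' ≥ (1 + ν) f'²`, so
`f^{-ν}` is concave; for large `τ` it starts with negative slope and would have to reach zero. That
`w(t)` stays in the domain of `R` is not shown in advance: `z` is built by integrating `q` twice
from `Rφ` and `Rψ`, and `β̂^{1/2} ẑ = ŵ` follows because both sides have the same second derivative
and the same data.

For the continuation, the force is written as `(1 - Δ)^{-ρ/2} G(w)` with `ρ > 2` and `ρ ≥ s`, so
that `H^ρ ⊆ X^s` (`IsForceMap`, `exists_isForceMap`). If `s > 2`, one takes `ρ = s`: the stress lies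
in `H^{s-1}` and the symbol `i ξ β̂` gains a derivative because `r ≥ 2`. If `s ≤ 2`, then `r > 3`,
`ρ = r - 1`, and it is enough that the stress is in `L²`. In the strong norm `G` is only shown to be
continuous and bounded on bounded sets. It is Lipschitz in the weaker norm of `H¹`, since gradients
are bounded in `L^∞`. Picard iterates are therefore kept bounded in the strong norm and converge in
the weak one, and the limit stays in the strong space because strong balls are closed in the weak
topology (`exists_local_solution`, `exists_of_tendsto_bes`). `exists_continuation` glues such a
local solution to the given one.

The case `s > 2` needs superposition operators on `H^σ` with `σ = s - 1 > 1` for nonlinearities of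
class `C^k`, `k > σ` (`hasComp`). For `1 < σ < 2` this is real interpolation: cutting the argument
at frequency `λ` gives an error that is Lipschitz in `L²` and a main part bounded in `H²`, and
integrating over `λ` recovers the `H^σ` norm together with uniform control of its tails, hence
continuity. Larger `σ` follow by induction from the chain rule and product estimates. -/

/-! ### Fourier analysis on `L²` in the normalisation of `l2Hat` -/

/-- The transform `∫ e^{i z·ξ} θ(z) dz`. -/
def chk (θ : Plane → ℂ) (ξ : Plane) : ℂ :=
  ∫ z : Plane, Complex.exp (Complex.I * ((inner ℝ z ξ : ℝ) : ℂ)) * θ z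

theorem chk_eq (θ : Plane → ℂ) (ξ : Plane) : chk θ ξ = 𝓕⁻ θ ((2 * Real.pi)⁻¹ • ξ) := by
  rw [Real.fourierInv_eq', chk]
  congr 1
  ext z
  rw [smul_eq_mul, inner_smul_right]
  congr 2
  have : (Real.pi : ℂ) ≠ 0 := by exact_mod_cast Real.pi_ne_zero
  push_cast
  field_simp

/-- The Jacobian of `ξ ↦ ξ / (2π)` in the plane is the source of the factors `(2π)²` in the formulas
for this normalisation. -/
theorem integral_scale (f : Plane → ℂ) :
    ∫ ξ, f ((2 * Real.pi)⁻¹ • ξ) = ((2 * Real.pi) ^ 2 : ℝ) * ∫ ξ, f ξ := by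
  rw [Measure.integral_comp_smul]
  have : Module.finrank ℝ Plane = 2 := by simp
  rw [this, Complex.real_smul]
  congr 2
  rw [inv_pow, inv_inv, abs_of_pos (by positivity)]

theorem toComplex_coe (u : L2) : (toComplex u : Plane → ℂ) =ᵐ[volume] fun z => ((u z : ℝ) : ℂ) :=
  Complex.ofRealCLM.coeFn_compLpL u

theorem two_pi_ne : (2 * Real.pi) ≠ 0 := by positivity

/-- Parseval's formula against Schwartz functions. -/
theorem l2Hat_pairing (u : L2) (θ : 𝓢(Plane, ℂ)) :
    ∫ z, (u z : ℂ) * θ z = (((2 * Real.pi) ^ 2)⁻¹ : ℝ) * ∫ ξ, l2Hat u ξ * chk θ ξ := by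
  have h := Lp.fourier_toTemperedDistribution_eq (toComplex u)
  have h1 := congrArg (fun d => d (𝓕⁻ θ)) h
  simp only [TemperedDistribution.fourier_apply, FourierTransform.fourier_fourierInv_eq,
    Lp.toTemperedDistribution_apply, smul_eq_mul] at h1
  have e1 : ∫ z, (u z : ℂ) * θ z = ∫ z, θ z * toComplex u z := by
    refine integral_congr_ae ?_
    filter_upwards [toComplex_coe u] with z hz
    rw [hz, mul_comm]
  have e2 : ∫ ξ, l2Hat u ξ * chk θ ξ
      = ∫ ξ, (fun η => (𝓕⁻ θ) η * (𝓕 (toComplex u) : Lp ℂ 2 (volume : Measure Plane)) η)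
        ((2 * Real.pi)⁻¹ • ξ) := by
    congr 1
    ext ξ
    simp only [l2Hat, chk_eq, SchwartzMap.fourierInv_coe]
    rw [mul_comm]
  have e3 := integral_scale
    (fun η => (𝓕⁻ θ) η * (𝓕 (toComplex u) : Lp ℂ 2 (volume : Measure Plane)) η)
  rw [e1, h1, e2, e3, ← mul_assoc, ← Complex.ofReal_mul, inv_mul_cancel₀ (by positivity)]
  simp

theorem l2Hat_aesm (u : L2) : AEStronglyMeasurable (l2Hat u) volume :=
  (Lp.aestronglyMeasurable (𝓕 (toComplex u))).comp_quasiMeasurePreserving quasi_scale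

theorem eLpNorm_scale {f : Plane → ℂ} (hf : AEStronglyMeasurable f volume) :
    eLpNorm (fun ξ : Plane => f ((2 * Real.pi)⁻¹ • ξ)) 2 volume
      = ENNReal.ofReal (2 * Real.pi) * eLpNorm f 2 volume := by
  have hm : Measure.map (fun ξ : Plane => (2 * Real.pi)⁻¹ • ξ) volume
      = ENNReal.ofReal ((2 * Real.pi) ^ 2) • (volume : Measure Plane) := by
    rw [Measure.map_addHaar_smul _ (inv_ne_zero two_pi_ne)]
    have : Module.finrank ℝ Plane = 2 := by simp
    rw [this, inv_pow, inv_inv, abs_of_pos (by positivity)]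
  have hf' : AEStronglyMeasurable f
      (Measure.map (fun ξ : Plane => (2 * Real.pi)⁻¹ • ξ) volume) := by
    rw [hm]; exact hf.smul_measure _
  have h := eLpNorm_map_measure (p := 2) hf' (measurable_const_smul _).aemeasurable
  rw [hm, eLpNorm_smul_measure_of_ne_top (by simp)] at h
  rw [Function.comp_def] at h
  rw [← h, smul_eq_mul]
  congr 1
  rw [ENNReal.ofReal_pow (by positivity), ← ENNReal.rpow_natCast, ← ENNReal.rpow_mul]
  simp

theorem enorm_toComplex (u : L2) : ‖toComplex u‖ₑ = ‖u‖ₑ := by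
  rw [Lp.enorm_def, Lp.enorm_def]
  rw [eLpNorm_congr_ae (toComplex_coe u)]
  exact eLpNorm_congr_norm_ae (by simp)

theorem eLpNorm_l2Hat (u : L2) :
    eLpNorm (l2Hat u) 2 volume = ENNReal.ofReal (2 * Real.pi) * ‖u‖ₑ := by
  have := eLpNorm_scale (Lp.aestronglyMeasurable (𝓕 (toComplex u)))
  unfold l2Hat
  rw [this, ← Lp.enorm_def, ← enorm_toComplex]
  congr 1
  rw [← ofReal_norm, ← ofReal_norm, Lp.norm_fourier_eq]

theorem memLp_l2Hat (u : L2) : MemLp (l2Hat u) 2 volume := by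
  refine ⟨l2Hat_aesm u, ?_⟩
  rw [eLpNorm_l2Hat]
  exact ENNReal.mul_lt_top ENNReal.ofReal_lt_top (by simp)

theorem l2Hat_sub (u v : L2) : l2Hat (u - v) =ᵐ[volume] fun ξ => l2Hat u ξ - l2Hat v ξ := by
  have h := l2Hat_add u ((-1 : ℝ) • v)
  rw [neg_one_smul, ← sub_eq_add_neg] at h
  filter_upwards [h, l2Hat_smul (-1) v] with ξ h1 h2
  rw [neg_one_smul] at h2
  rw [h1, h2]
  push_cast
  ring

theorem l2Hat_inj {u v : L2} (h : l2Hat u =ᵐ[volume] l2Hat v) : u = v := by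
  have h1 : eLpNorm (l2Hat (u - v)) 2 volume = 0 := by
    rw [eLpNorm_congr_ae (g := 0), eLpNorm_zero]
    filter_upwards [l2Hat_sub u v, h] with ξ a b
    simp [a, b]
  rw [eLpNorm_l2Hat] at h1
  rcases mul_eq_zero.1 h1 with h2 | h2
  · exact absurd (ENNReal.ofReal_eq_zero.1 h2) (not_le.2 (by positivity))
  · rw [enorm_eq_zero] at h2
    exact sub_eq_zero.1 h2

theorem isTest_complex {θ : Plane → ℝ} (h : IsTest θ) :
    ∃ χ : 𝓢(Plane, ℂ), ∀ z, χ z = (θ z : ℂ) := by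
  have h1 : HasCompactSupport (Complex.ofRealCLM ∘ θ) := h.2.comp_left rfl
  have h2 : ContDiff ℝ ∞ (Complex.ofRealCLM ∘ θ) := Complex.ofRealCLM.contDiff.comp h.1
  exact ⟨h1.toSchwartzMap h2, fun z => rfl⟩

/-- Lets identities between transforms be tested against any `g ∈ C_c^∞` in frequency, by means of
`l2Hat_pairing`. -/
theorem exists_schwartz_chk {g : Plane → ℝ} (hg : IsTest g) :
    ∃ θ : 𝓢(Plane, ℂ), ∀ ξ, chk θ ξ = (g ξ : ℂ) := by
  have h : IsTest (fun η => g ((2 * Real.pi) • η)) := by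
    refine ⟨hg.1.comp (contDiff_const_smul _), ?_⟩
    exact hg.2.comp_homeomorph (Homeomorph.smulOfNeZero (2 * Real.pi) two_pi_ne)
  obtain ⟨χ, hχ⟩ := isTest_complex h
  refine ⟨𝓕 χ, fun ξ => ?_⟩
  rw [chk_eq, ← SchwartzMap.fourierInv_coe, FourierTransform.fourierInv_fourier_eq, hχ, smul_smul,
    mul_inv_cancel₀ two_pi_ne, one_smul]

theorem ae_eq_of_test {f g : Plane → ℂ} (hf : LocallyIntegrable f volume)
    (hg : LocallyIntegrable g volume)
    (h : ∀ θ : Plane → ℝ, IsTest θ → ∫ z, f z * θ z = ∫ z, g z * θ z) : f =ᵐ[volume] g := by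
  refine ae_eq_of_integral_contDiff_smul_eq hf hg fun θ h1 h2 => ?_
  simpa [Complex.real_smul, mul_comm] using h θ ⟨h1, h2⟩

theorem locallyIntegrable_l2Hat (u : L2) : LocallyIntegrable (l2Hat u) volume :=
  (memLp_l2Hat u).locallyIntegrable (by norm_num)

/-- The transform of a real function is conjugate symmetric. -/
theorem l2Hat_neg (u : L2) : ∀ᵐ ξ, l2Hat u (-ξ) = conj (l2Hat u ξ) := by
  have hm : MeasurePreserving (fun ξ : Plane => -ξ) volume volume :=
    Measure.measurePreserving_neg volume
  have h1 : MemLp (fun ξ => l2Hat u (-ξ)) 2 volume := (memLp_l2Hat u).comp_measurePreserving hm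
  have h2 : MemLp (fun ξ => conj (l2Hat u ξ)) 2 volume := (memLp_l2Hat u).star
  refine ae_eq_of_test (h1.locallyIntegrable (by norm_num)) (h2.locallyIntegrable (by norm_num)) ?_
  intro g hg
  obtain ⟨θ, hθ⟩ := exists_schwartz_chk hg
  -- Since `g` is real, conjugating `θ` reflects its transform; since `u` is real, its pairings with
  -- `θ` and with its conjugate are conjugate numbers.
  have hc : ∀ ξ, chk (fun z => conj (θ z)) ξ = (g (-ξ) : ℂ) := by
    intro ξ
    rw [← Complex.conj_ofReal, ← hθ, chk, chk, ← integral_conj]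
    congr 1
    ext z
    rw [map_mul, ← Complex.exp_conj]
    simp
  have hS : ∃ χ : 𝓢(Plane, ℂ), ∀ z, χ z = conj (θ z) :=
    ⟨SchwartzMap.postcompCLM (Complex.conjCLE : ℂ →L[ℝ] ℂ) θ, fun z => rfl⟩
  obtain ⟨χ, hχ⟩ := hS
  have hχ' : (χ : Plane → ℂ) = fun z => conj (θ z) := funext hχ
  have p1 := l2Hat_pairing u χ
  have p2 := congrArg conj (l2Hat_pairing u θ)
  have e : ∫ z, (u z : ℂ) * χ z = conj (∫ z, (u z : ℂ) * θ z) := by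
    rw [← integral_conj]
    simp [hχ]
  rw [← e, p1, map_mul, Complex.conj_ofReal] at p2
  have hne : (((2 * Real.pi) ^ 2)⁻¹ : ℝ) ≠ 0 := by positivity
  have p3 := mul_left_cancel₀ (Complex.ofReal_ne_zero.2 hne) p2
  rw [← integral_conj] at p3
  simp only [hχ', hc, hθ, map_mul, Complex.conj_ofReal] at p3
  rw [← p3, ← integral_neg_eq_self]
  simp

theorem exists_l2Hat_eq_add (f : Lp ℂ 2 (volume : Measure Plane)) :
    ∃ u v : L2, f = toComplex u + Complex.I • toComplex v := by
  refine ⟨Complex.reCLM.compLpL 2 volume f, Complex.imCLM.compLpL 2 volume f, ?_⟩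
  ext1
  filter_upwards [Lp.coeFn_add (toComplex (Complex.reCLM.compLpL 2 volume f))
      (Complex.I • toComplex (Complex.imCLM.compLpL 2 volume f)),
    Lp.coeFn_smul Complex.I (toComplex (Complex.imCLM.compLpL 2 volume f)),
    toComplex_coe (Complex.reCLM.compLpL 2 volume f),
    toComplex_coe (Complex.imCLM.compLpL 2 volume f),
    Complex.reCLM.coeFn_compLpL f, Complex.imCLM.coeFn_compLpL f] with z h1 h2 h3 h4 h5 h6
  rw [h1, Pi.add_apply, h2, Pi.smul_apply, h3, h4, h5, h6, smul_eq_mul, mul_comm]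
  simp [Complex.re_add_im]

/-- Every conjugate symmetric square integrable function is the transform of a real function. -/
theorem exists_l2Hat_eq {U : Plane → ℂ} (hU : MemLp U 2 volume)
    (hs : ∀ᵐ ξ, U (-ξ) = conj (U ξ)) : ∃ u : L2, l2Hat u =ᵐ[volume] U := by
  have hq : Measure.QuasiMeasurePreserving (fun ξ : Plane => (2 * Real.pi) • ξ)
      volume volume := by
    refine ⟨measurable_const_smul _, ?_⟩
    rw [Measure.map_addHaar_smul _ (by positivity)]
    exact Measure.smul_absolutelyContinuous
  have hW : MemLp (fun η => U ((2 * Real.pi) • η)) 2 volume := by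
    have ha : AEStronglyMeasurable (fun η => U ((2 * Real.pi) • η)) volume :=
      hU.1.comp_quasiMeasurePreserving hq
    refine ⟨ha, ?_⟩
    have h := eLpNorm_scale ha
    simp only [smul_smul, mul_inv_cancel₀ two_pi_ne, one_smul] at h
    by_contra hc
    rw [not_lt, top_le_iff] at hc
    rw [hc, ENNReal.mul_top (by simpa using Real.pi_pos)] at h
    exact hU.2.ne h
  obtain ⟨u, v, huv⟩ := exists_l2Hat_eq_add (𝓕⁻ hW.toLp)
  have h1 : hW.toLp = 𝓕 (toComplex u) + Complex.I • 𝓕 (toComplex v) := by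
    rw [← FourierTransform.fourier_smul, ← FourierTransform.fourier_add, ← huv,
      FourierTransform.fourier_fourierInv_eq]
  have h2 : U =ᵐ[volume] fun ξ => l2Hat u ξ + Complex.I * l2Hat v ξ := by
    filter_upwards [quasi_scale.ae hW.coeFn_toLp, quasi_scale.ae (Lp.coeFn_add (𝓕 (toComplex u))
      (Complex.I • 𝓕 (toComplex v))), quasi_scale.ae (Lp.coeFn_smul Complex.I (𝓕 (toComplex v)))]
      with ξ a b c
    rw [smul_smul, mul_inv_cancel₀ two_pi_ne, one_smul] at a
    rw [← a, h1, b, Pi.add_apply, c]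
    rfl
  have hm : Measure.QuasiMeasurePreserving (fun ξ : Plane => -ξ) volume volume :=
    (Measure.measurePreserving_neg volume).quasiMeasurePreserving
  -- The symmetry of `U = û + i v̂` says `conj û + i conj v̂ = conj û - i conj v̂`, so the imaginary
  -- part `v` of the inverse transform vanishes.
  have h3 : ∀ᵐ ξ, l2Hat v ξ = 0 := by
    filter_upwards [h2, hm.ae h2, hs, l2Hat_neg u, l2Hat_neg v] with ξ a b c d e
    rw [b, a, d, e, map_add, map_mul, Complex.conj_I] at c
    have : Complex.I * conj (l2Hat v ξ) = 0 := by linear_combination c / 2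
    simpa using this
  refine ⟨u, ?_⟩
  filter_upwards [h2, h3] with ξ a b
  simp [a, b]

theorem integral_mul_eq (u v : L2) :
    ((∫ z, u z * v z : ℝ) : ℂ)
      = (((2 * Real.pi) ^ 2)⁻¹ : ℝ) * ∫ ξ, conj (l2Hat u ξ) * l2Hat v ξ := by
  have h := Lp.inner_fourier_eq (toComplex u) (toComplex v)
  rw [L2.inner_def, L2.inner_def] at h
  have e1 : ∫ z, inner ℂ (toComplex u z) (toComplex v z) = ((∫ z, u z * v z : ℝ) : ℂ) := by
    rw [← integral_complex_ofReal]
    refine integral_congr_ae ?_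
    filter_upwards [toComplex_coe u, toComplex_coe v] with z a b
    rw [a, b, RCLike.inner_apply]
    simp [mul_comm]
  rw [e1] at h
  rw [← h]
  have e2 := integral_scale (fun η => inner ℂ
    ((𝓕 (toComplex u) : Lp ℂ 2 (volume : Measure Plane)) η)
    ((𝓕 (toComplex v) : Lp ℂ 2 (volume : Measure Plane)) η))
  have e3 : ∫ ξ, conj (l2Hat u ξ) * l2Hat v ξ = ∫ ξ : Plane, (fun η => inner ℂ
    ((𝓕 (toComplex u) : Lp ℂ 2 (volume : Measure Plane)) η)
    ((𝓕 (toComplex v) : Lp ℂ 2 (volume : Measure Plane)) η)) ((2 * Real.pi)⁻¹ • ξ) := by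
    refine integral_congr_ae (Filter.Eventually.of_forall fun ξ => ?_)
    exact mul_comm _ _
  rw [e3, e2, ← mul_assoc, ← Complex.ofReal_mul, inv_mul_cancel₀ (by positivity)]
  simp

/-- The inversion formula when the transform is integrable. -/
theorem l2Hat_inversion {u : L2} (hu : Integrable (l2Hat u) volume) :
    ∀ᵐ z, (u z : ℂ) = (((2 * Real.pi) ^ 2)⁻¹ : ℝ) * chk (l2Hat u) z := by
  have hc : Continuous (chk (l2Hat u)) := by
    have : chk (l2Hat u) = fun ξ => 𝓕⁻ (l2Hat u) ((2 * Real.pi)⁻¹ • ξ) := funext (chk_eq _)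
    rw [this]
    have h1 : Continuous (𝓕⁻ (l2Hat u)) := by
      rw [Real.fourierInv_eq_fourier_comp_neg]
      exact VectorFourier.fourierIntegral_continuous Real.continuous_fourierChar
        (by exact continuous_inner) hu.comp_neg
    exact h1.comp (continuous_const_smul _)
  refine ae_eq_of_test ?_ ?_ ?_
  · have h : MemLp (fun z => ((u z : ℝ) : ℂ)) 2 volume := (Lp.memLp u).ofReal
    exact h.locallyIntegrable (by norm_num)
  · exact (continuous_const.mul hc).locallyIntegrable
  intro θ hθ
  obtain ⟨χ, hχ⟩ := isTest_complex hθ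
  have p := l2Hat_pairing u χ
  simp only [hχ] at p
  rw [p]
  simp only [mul_assoc, integral_const_mul]
  congr 1
  have hθi : Integrable (fun z => (θ z : ℂ)) volume :=
    (hθ.1.continuous.integrable_of_hasCompactSupport hθ.2).ofReal
  have hint : Integrable (Function.uncurry fun (ξ z : Plane) => l2Hat u ξ *
      (Complex.exp (Complex.I * ((inner ℝ z ξ : ℝ) : ℂ)) * θ z)) (volume.prod volume) := by
    have h1 : Integrable (fun p : Plane × Plane => l2Hat u p.1 * (θ p.2 : ℂ))
      (volume.prod volume) := hu.mul_prod hθi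
    have h2 := h1.bdd_mul (c := 1)
      (f := fun p : Plane × Plane => Complex.exp (Complex.I * ((inner ℝ p.2 p.1 : ℝ) : ℂ)))
      (by fun_prop) (by
        refine Filter.Eventually.of_forall fun p => ?_
        rw [mul_comm, Complex.norm_exp_ofReal_mul_I])
    refine h2.congr (Filter.Eventually.of_forall fun p => ?_)
    simp only [Function.uncurry]
    ring
  have hs := integral_integral_swap hint
  calc ∫ ξ, l2Hat u ξ * chk χ ξ
      = ∫ ξ, ∫ z, l2Hat u ξ * (Complex.exp (Complex.I * ((inner ℝ z ξ : ℝ) : ℂ)) * θ z) := by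
        congr 1; ext ξ; rw [integral_const_mul, chk]; simp only [hχ]
    _ = _ := hs
    _ = _ := by
        congr 1; ext z
        rw [chk, ← integral_mul_const]
        congr 1; ext ξ
        rw [real_inner_comm]
        ring

/-! ### Fourier multipliers on real `L²` -/

/-- Bounded measurable symbols of operators that preserve real functions. -/
structure IsSymb (m : Plane → ℂ) : Prop where
  meas : Measurable m
  bdd : ∃ C : ℝ, ∀ ξ, ‖m ξ‖ ≤ C
  symm : ∀ ξ, m (-ξ) = conj (m ξ)

theorem IsSymb.mul {m n : Plane → ℂ} (hm : IsSymb m) (hn : IsSymb n) :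
    IsSymb (fun ξ => m ξ * n ξ) := by
  obtain ⟨C, hC⟩ := hm.bdd
  obtain ⟨D, hD⟩ := hn.bdd
  refine ⟨hm.meas.mul hn.meas, ⟨C * D, fun ξ => ?_⟩, fun ξ => ?_⟩
  · rw [norm_mul]
    exact mul_le_mul (hC ξ) (hD ξ) (norm_nonneg _) ((norm_nonneg _).trans (hC ξ))
  · rw [hm.symm, hn.symm, map_mul]

theorem exists_l2Hat_symbol {m : Plane → ℂ} (u : L2) (hs : ∀ ξ, m (-ξ) = conj (m ξ))
    (h : MemLp (fun ξ => m ξ * l2Hat u ξ) 2 volume) :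
    ∃ v : L2, l2Hat v =ᵐ[volume] fun ξ => m ξ * l2Hat u ξ := by
  refine exists_l2Hat_eq h ?_
  filter_upwards [l2Hat_neg u] with ξ hξ
  rw [hs, hξ, map_mul]

theorem IsSymb.memLp {m : Plane → ℂ} (hm : IsSymb m) (u : L2) :
    MemLp (fun ξ => m ξ * l2Hat u ξ) 2 volume := by
  obtain ⟨C, hC⟩ := hm.bdd
  refine (memLp_l2Hat u).of_le_mul (c := C)
    (hm.meas.aestronglyMeasurable.mul (l2Hat_aesm u)) (Eventually.of_forall fun ξ => ?_)
  rw [norm_mul]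
  exact mul_le_mul_of_nonneg_right (hC ξ) (norm_nonneg _)

theorem norm_le_of_l2Hat {u v : L2} {C : ℝ} (hC : 0 ≤ C)
    (h : ∀ᵐ ξ, ‖l2Hat u ξ‖ ≤ C * ‖l2Hat v ξ‖) : ‖u‖ ≤ C * ‖v‖ := by
  have h1 : eLpNorm (l2Hat u) 2 volume ≤ ENNReal.ofReal C * eLpNorm (l2Hat v) 2 volume :=
    eLpNorm_le_mul_eLpNorm_of_ae_le_mul h 2
  rw [eLpNorm_l2Hat, eLpNorm_l2Hat, ← mul_assoc, mul_comm (ENNReal.ofReal C), mul_assoc,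
    ENNReal.mul_le_mul_iff_right (by simpa using Real.pi_pos) ENNReal.ofReal_ne_top] at h1
  rw [← ofReal_norm, ← ofReal_norm, ← ENNReal.ofReal_mul hC] at h1
  exact (ENNReal.ofReal_le_ofReal_iff (by positivity)).1 h1

open Classical in
/-- The operator on `L²` with symbol `m`, and `0` if `m` is not an admissible symbol. -/
def op (m : Plane → ℂ) : L2 →L[ℝ] L2 :=
  if hm : IsSymb m then
    LinearMap.mkContinuousOfExistsBound
      { toFun := fun u => (exists_l2Hat_symbol u hm.symm (hm.memLp u)).choose
        map_add' := fun u v => by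
          apply l2Hat_inj
          have h1 := (exists_l2Hat_symbol u hm.symm (hm.memLp u)).choose_spec
          have h2 := (exists_l2Hat_symbol v hm.symm (hm.memLp v)).choose_spec
          have h3 := (exists_l2Hat_symbol (u + v) hm.symm (hm.memLp (u + v))).choose_spec
          filter_upwards [h1, h2, h3, l2Hat_add u v,
            l2Hat_add (exists_l2Hat_symbol u hm.symm (hm.memLp u)).choose
              (exists_l2Hat_symbol v hm.symm (hm.memLp v)).choose] with ξ a b c d e
          rw [c, d, e, a, b, mul_add]
        map_smul' := fun c u => by
          apply l2Hat_inj
          have h1 := (exists_l2Hat_symbol u hm.symm (hm.memLp u)).choose_spec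
          have h3 := (exists_l2Hat_symbol (c • u) hm.symm (hm.memLp (c • u))).choose_spec
          filter_upwards [h1, h3, l2Hat_smul c u,
            l2Hat_smul c (exists_l2Hat_symbol u hm.symm (hm.memLp u)).choose] with ξ a b d e
          rw [b, d, RingHom.id_apply, e, a]
          ring }
      (by
        obtain ⟨C, hC⟩ := hm.bdd
        refine ⟨C, fun u => norm_le_of_l2Hat ((norm_nonneg _).trans (hC 0)) ?_⟩
        have h1 := (exists_l2Hat_symbol u hm.symm (hm.memLp u)).choose_spec
        filter_upwards [h1] with ξ a
        refine (congrArg norm a).trans_le ?_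
        rw [norm_mul]
        exact mul_le_mul_of_nonneg_right (hC ξ) (norm_nonneg _))
  else 0

theorem l2Hat_op {m : Plane → ℂ} (hm : IsSymb m) (u : L2) :
    l2Hat (op m u) =ᵐ[volume] fun ξ => m ξ * l2Hat u ξ := by
  have h1 := (exists_l2Hat_symbol u hm.symm (hm.memLp u)).choose_spec
  rw [op, dif_pos hm]
  exact h1

theorem norm_op_le {m : Plane → ℂ} (hm : IsSymb m) {C : ℝ} (hC : ∀ ξ, ‖m ξ‖ ≤ C) (u : L2) :
    ‖op m u‖ ≤ C * ‖u‖ := by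
  refine norm_le_of_l2Hat ((norm_nonneg _).trans (hC 0)) ?_
  filter_upwards [l2Hat_op hm u] with ξ a
  rw [a, norm_mul]
  exact mul_le_mul_of_nonneg_right (hC ξ) (norm_nonneg _)

theorem op_op {m n k : Plane → ℂ} (hm : IsSymb m) (hn : IsSymb n) (hk : IsSymb k)
    (h : ∀ ξ, m ξ * n ξ = k ξ) (u : L2) : op m (op n u) = op k u := by
  apply l2Hat_inj
  filter_upwards [l2Hat_op hm (op n u), l2Hat_op hn u, l2Hat_op hk u] with ξ a b c
  rw [a, b, c, ← mul_assoc, h]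

theorem op_inj {m : Plane → ℂ} (hm : IsSymb m) (h0 : ∀ ξ, m ξ ≠ 0) {u v : L2}
    (h : op m u = op m v) : u = v := by
  apply l2Hat_inj
  filter_upwards [l2Hat_op hm u, l2Hat_op hm v] with ξ a b
  rw [← h, a] at b
  exact mul_left_cancel₀ (h0 ξ) b

theorem IsSymb.conj {m : Plane → ℂ} (hm : IsSymb m) : IsSymb (fun ξ => conj (m ξ)) := by
  obtain ⟨C, hC⟩ := hm.bdd
  exact ⟨Complex.continuous_conj.measurable.comp hm.meas, ⟨C, fun ξ => by simpa using hC ξ⟩,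
    fun ξ => by rw [hm.symm]⟩

theorem integral_op_mul {m : Plane → ℂ} (hm : IsSymb m) (u v : L2) :
    ∫ z, op m u z * v z = ∫ z, u z * op (fun ξ => conj (m ξ)) v z := by
  have h : ((∫ z, op m u z * v z : ℝ) : ℂ) = ((∫ z, u z * op (fun ξ => conj (m ξ)) v z : ℝ) : ℂ) := by
    rw [integral_mul_eq, integral_mul_eq]
    congr 1
    refine integral_congr_ae ?_
    filter_upwards [l2Hat_op hm u, l2Hat_op hm.conj v] with ξ a b
    rw [a, b, map_mul]
    ring
  exact_mod_cast h

/-! ### The weights `(1 + |ξ|²)^{a/2}` -/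

/-- `(1 + |ξ|²)^{a/2}`. -/
def jw (a : ℝ) (ξ : Plane) : ℝ := (1 + ‖ξ‖ ^ 2) ^ (a / 2)

theorem jw_pos (a : ℝ) (ξ : Plane) : 0 < jw a ξ := by unfold jw; positivity

theorem jw_zero (ξ : Plane) : jw 0 ξ = 1 := by simp [jw]

theorem jw_add (a b : ℝ) (ξ : Plane) : jw (a + b) ξ = jw a ξ * jw b ξ := by
  unfold jw
  rw [← Real.rpow_add (by positivity)]
  ring_nf

theorem jw_mono {a b : ℝ} (h : a ≤ b) (ξ : Plane) : jw a ξ ≤ jw b ξ :=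
  Real.rpow_le_rpow_of_exponent_le (by nlinarith [sq_nonneg ‖ξ‖]) (by linarith)

theorem jw_le_one {a : ℝ} (h : a ≤ 0) (ξ : Plane) : jw a ξ ≤ 1 := by
  simpa [jw_zero] using jw_mono h ξ

theorem one_le_jw {a : ℝ} (h : 0 ≤ a) (ξ : Plane) : 1 ≤ jw a ξ := by
  simpa [jw_zero] using jw_mono h ξ

theorem jw_two (ξ : Plane) : jw 2 ξ = 1 + ‖ξ‖ ^ 2 := by simp [jw]

theorem jw_neg (a : ℝ) (ξ : Plane) : jw a (-ξ) = jw a ξ := by simp [jw]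

theorem jw_measurable (a : ℝ) : Measurable (jw a) := by unfold jw; fun_prop

theorem norm_le_jw_one (ξ : Plane) : ‖ξ‖ ≤ jw 1 ξ := by
  have h : jw 1 ξ = √(1 + ‖ξ‖ ^ 2) := by rw [jw, Real.sqrt_eq_rpow]
  rw [h]
  exact Real.le_sqrt_of_sq_le (by linarith)

theorem abs_coord_le (ξ : Plane) (i : Fin 2) : |ξ i| ≤ jw 1 ξ :=
  (by simpa using PiLp.norm_apply_le ξ i : |ξ i| ≤ ‖ξ‖).trans (norm_le_jw_one ξ)

theorem jw_mul_neg (a : ℝ) (ξ : Plane) : jw (-a) ξ * jw a ξ = 1 := by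
  rw [← jw_add, neg_add_cancel, jw_zero]

theorem isSymb_jw {a : ℝ} (ha : a ≤ 0) : IsSymb (fun ξ => (jw a ξ : ℂ)) := by
  refine ⟨Complex.measurable_ofReal.comp (jw_measurable a), ⟨1, fun ξ => ?_⟩, fun ξ => ?_⟩
  · rw [Complex.norm_real, Real.norm_of_nonneg (jw_pos a ξ).le]
    exact jw_le_one ha ξ
  · rw [jw_neg, Complex.conj_ofReal]

/-- The symbol `i ξ_i (1 + |ξ|²)^{a/2}`. -/
def dsymb (i : Fin 2) (a : ℝ) (ξ : Plane) : ℂ := Complex.I * (ξ i : ℂ) * (jw a ξ : ℂ)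

theorem dsymb_symm (i : Fin 2) (a : ℝ) (ξ : Plane) : dsymb i a (-ξ) = conj (dsymb i a ξ) := by
  simp [dsymb, jw_neg]

theorem dsymb_measurable (i : Fin 2) (a : ℝ) : Measurable (dsymb i a) := by
  unfold dsymb
  have := jw_measurable a
  fun_prop

theorem norm_dsymb_le (i : Fin 2) (a : ℝ) (ξ : Plane) : ‖dsymb i a ξ‖ ≤ jw (a + 1) ξ := by
  rw [dsymb, norm_mul, norm_mul, Complex.norm_I, one_mul, Complex.norm_real, Complex.norm_real,
    Real.norm_of_nonneg (jw_pos a ξ).le, jw_add, mul_comm]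
  exact mul_le_mul_of_nonneg_left (abs_coord_le ξ i) (jw_pos a ξ).le

theorem isSymb_dsymb (i : Fin 2) {a : ℝ} (ha : a ≤ -1) : IsSymb (dsymb i a) :=
  ⟨dsymb_measurable i a, ⟨1, fun ξ => (norm_dsymb_le i a ξ).trans (jw_le_one (by linarith) ξ)⟩,
    dsymb_symm i a⟩

/-- The Bessel potential `(1 - Δ)^{-a/2}`. -/
def bes (a : ℝ) : L2 →L[ℝ] L2 := op fun ξ => (jw (-a) ξ : ℂ)

theorem l2Hat_bes {a : ℝ} (ha : 0 ≤ a) (u : L2) :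
    l2Hat (bes a u) =ᵐ[volume] fun ξ => (jw (-a) ξ : ℂ) * l2Hat u ξ :=
  l2Hat_op (isSymb_jw (by linarith)) u

theorem bes_bes {a b : ℝ} (ha : 0 ≤ a) (hb : 0 ≤ b) (u : L2) :
    bes a (bes b u) = bes (a + b) u := by
  refine op_op (isSymb_jw (by linarith)) (isSymb_jw (by linarith)) (isSymb_jw (by linarith)) ?_ u
  intro ξ
  rw [← Complex.ofReal_mul, ← jw_add]
  congr 2
  ring

theorem bes_inj {a : ℝ} (ha : 0 ≤ a) {u v : L2} (h : bes a u = bes a v) : u = v :=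
  op_inj (isSymb_jw (by linarith)) (fun ξ => by exact_mod_cast (jw_pos _ ξ).ne') h

theorem norm_bes_le {a : ℝ} (ha : 0 ≤ a) (u : L2) : ‖bes a u‖ ≤ ‖u‖ := by
  have := norm_op_le (isSymb_jw (a := -a) (by linarith)) (C := 1) (fun ξ => by
    rw [Complex.norm_real, Real.norm_of_nonneg (jw_pos _ ξ).le]
    exact jw_le_one (by linarith) ξ) u
  rwa [one_mul] at this

theorem bes_zero (u : L2) : bes 0 u = u := by
  apply l2Hat_inj
  filter_upwards [l2Hat_bes le_rfl u] with ξ h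
  simp [h, jw_zero]

theorem sobolevNorm_eq (s : ℝ) (u : L2) :
    sobolevNorm s u = eLpNorm (fun ξ => (jw s ξ : ℂ) * l2Hat u ξ) 2 volume := rfl

theorem sobolevNorm_bes {a : ℝ} (ha : 0 ≤ a) (u : L2) :
    sobolevNorm a (bes a u) = ENNReal.ofReal (2 * Real.pi) * ‖u‖ₑ := by
  rw [sobolevNorm_eq, ← eLpNorm_l2Hat]
  refine eLpNorm_congr_ae ?_
  filter_upwards [l2Hat_bes ha u] with ξ h
  have := jw_mul_neg a ξ
  rw [h, ← mul_assoc, ← Complex.ofReal_mul, mul_comm (jw a ξ), this, Complex.ofReal_one, one_mul]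

theorem exists_bes_eq {a : ℝ} (ha : 0 ≤ a) {u : L2} (h : sobolevNorm a u < ⊤) :
    ∃ v : L2, bes a v = u := by
  obtain ⟨v, hv⟩ := exists_l2Hat_symbol (m := fun ξ => (jw a ξ : ℂ)) u
    (fun ξ => by rw [jw_neg, Complex.conj_ofReal]) ⟨aesm_weighted a u, h⟩
  refine ⟨v, l2Hat_inj ?_⟩
  filter_upwards [l2Hat_bes ha v, hv] with ξ h1 h2
  rw [h1, h2, ← mul_assoc, ← Complex.ofReal_mul, jw_mul_neg, Complex.ofReal_one, one_mul]

theorem memLp_jw {a : ℝ} (ha : 1 < a) : MemLp (fun ξ => jw (-a) ξ) 2 (volume : Measure Plane) := by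
  rw [memLp_two_iff_integrable_sq (jw_measurable _).aestronglyMeasurable]
  have h := integrable_rpow_neg_one_add_norm_sq (E := Plane) (μ := volume) (r := 2 * a)
    (by simpa using by linarith)
  refine h.congr (Eventually.of_forall fun ξ => ?_)
  simp only [jw]
  rw [← Real.rpow_mul_natCast (by positivity)]
  congr 1
  push_cast
  ring

/-- `H^a(ℝ²)` functions have integrable transforms for `a > 1`. -/
theorem integrable_l2Hat_bes {a : ℝ} (ha : 1 < a) :
    ∃ C : ℝ, 0 ≤ C ∧ ∀ u : L2, Integrable (l2Hat (bes a u)) volume ∧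
      ∫ ξ, ‖l2Hat (bes a u) ξ‖ ≤ C * ‖u‖ := by
  have hj : MemLp (fun ξ => (jw (-a) ξ : ℂ)) 2 (volume : Measure Plane) := (memLp_jw ha).ofReal
  refine ⟨(eLpNorm (fun ξ => (jw (-a) ξ : ℂ)) 2 volume).toReal * (2 * Real.pi), by positivity,
    fun u => ?_⟩
  have h0 := l2Hat_bes (by linarith : 0 ≤ a) u
  have h1 : eLpNorm (l2Hat (bes a u)) 1 volume
      ≤ eLpNorm (fun ξ => (jw (-a) ξ : ℂ)) 2 volume * eLpNorm (l2Hat u) 2 volume := by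
    rw [eLpNorm_congr_ae h0]
    change eLpNorm ((fun ξ => (jw (-a) ξ : ℂ)) • l2Hat u) 1 volume ≤ _
    exact eLpNorm_smul_le_mul_eLpNorm (l2Hat_aesm u) hj.1
  have h2 : eLpNorm (l2Hat (bes a u)) 1 volume < ⊤ :=
    h1.trans_lt (ENNReal.mul_lt_top hj.2 (memLp_l2Hat u).2)
  have h3 : Integrable (l2Hat (bes a u)) volume := memLp_one_iff_integrable.1 ⟨l2Hat_aesm _, h2⟩
  refine ⟨h3, ?_⟩
  rw [integral_norm_eq_lintegral_enorm h3.1, ← eLpNorm_one_eq_lintegral_enorm]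
  refine (ENNReal.toReal_mono (ENNReal.mul_ne_top hj.2.ne (memLp_l2Hat u).2.ne) h1).trans ?_
  rw [ENNReal.toReal_mul, eLpNorm_l2Hat, ENNReal.toReal_mul, toReal_enorm,
    ENNReal.toReal_ofReal (by positivity)]
  exact (mul_assoc _ _ _).symm.le

theorem norm_chk_le (θ : Plane → ℂ) (ξ : Plane) : ‖chk θ ξ‖ ≤ ∫ z, ‖θ z‖ := by
  refine (norm_integral_le_integral_norm _).trans_eq ?_
  congr 1
  ext z
  rw [norm_mul, mul_comm Complex.I, Complex.norm_exp_ofReal_mul_I, one_mul]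

theorem ae_abs_le_of_integrable {u : L2} (hu : Integrable (l2Hat u) volume) :
    ∀ᵐ z, |u z| ≤ ∫ ξ, ‖l2Hat u ξ‖ := by
  filter_upwards [l2Hat_inversion hu] with z hz
  have h1 : |u z| = ‖(u z : ℂ)‖ := by simp
  rw [h1, hz, norm_mul, Complex.norm_real, Real.norm_of_nonneg (by positivity)]
  have h2 : ((2 * Real.pi) ^ 2)⁻¹ ≤ 1 := by
    apply inv_le_one_of_one_le₀
    nlinarith [Real.pi_gt_three]
  calc _ ≤ 1 * ‖chk (l2Hat u) z‖ := mul_le_mul_of_nonneg_right h2 (norm_nonneg _)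
    _ ≤ _ := by rw [one_mul]; exact norm_chk_le _ _

/-- The embedding `H^a ⊆ L^∞` for `a > 1`. -/
theorem exists_ae_abs_bes_le {a : ℝ} (ha : 1 < a) :
    ∃ C : ℝ, 0 ≤ C ∧ ∀ u : L2, ∀ᵐ z, |bes a u z| ≤ C * ‖u‖ := by
  obtain ⟨C, hC, h⟩ := integrable_l2Hat_bes ha
  refine ⟨C, hC, fun u => ?_⟩
  filter_upwards [ae_abs_le_of_integrable (h u).1] with z hz
  exact hz.trans (h u).2

/-! ### Derivatives on the Fourier side -/

/-- `g = ∂_i f`, expressed by the transforms. -/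
def HasD (i : Fin 2) (f g : L2) : Prop :=
  l2Hat g =ᵐ[volume] fun ξ => Complex.I * (ξ i : ℂ) * l2Hat f ξ

/-- Multiplying by `(1 + |ξ|²)^{-1/2}` turns the unbounded symbol `i ξ_i` into a bounded one. Both
sides then depend continuously on `f` and `g`, so the relation is closed under `L²` limits. -/
theorem hasD_iff (i : Fin 2) (f g : L2) : HasD i f g ↔ bes 1 g = op (dsymb i (-1)) f := by
  have h1 := l2Hat_bes zero_le_one g
  have h2 := l2Hat_op (isSymb_dsymb i le_rfl) f
  constructor
  · intro h
    apply l2Hat_inj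
    filter_upwards [h1, h2, h] with ξ a b c
    rw [a, b, c, dsymb]
    ring
  · intro h
    rw [h] at h1
    filter_upwards [h1, h2] with ξ a b
    rw [b, dsymb] at a
    have : (jw (-1) ξ : ℂ) ≠ 0 := by exact_mod_cast (jw_pos _ ξ).ne'
    apply mul_left_cancel₀ this
    rw [← a]
    ring

theorem hasD_bes (i : Fin 2) {a : ℝ} (ha : 1 ≤ a) (u : L2) :
    HasD i (bes a u) (op (dsymb i (-a)) u) := by
  filter_upwards [l2Hat_bes (by linarith : 0 ≤ a) u,
    l2Hat_op (isSymb_dsymb i (a := -a) (by linarith)) u] with ξ h1 h2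
  rw [h1, h2, dsymb]
  ring

theorem chk_lineDeriv (θ : 𝓢(Plane, ℂ)) (i : Fin 2) (ξ : Plane) :
    chk (fun z => fderiv ℝ θ z (EuclideanSpace.single i 1)) ξ
      = -(Complex.I * (ξ i : ℂ)) * chk θ ξ := by
  have h := DFunLike.congr_fun (SchwartzMap.fourierInv_lineDerivOp_eq θ (EuclideanSpace.single i 1))
    ((2 * Real.pi)⁻¹ • ξ)
  have e : (fun z => fderiv ℝ θ z (EuclideanSpace.single i 1))
      = (LineDeriv.lineDerivOp (EuclideanSpace.single i (1 : ℝ)) θ : 𝓢(Plane, ℂ)) := by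
    ext z
    rw [SchwartzMap.lineDerivOp_apply_eq_fderiv]
  rw [chk_eq, chk_eq, e, ← SchwartzMap.fourierInv_coe, h, ← SchwartzMap.fourierInv_coe]
  have hg : (fun x : Plane => inner ℝ x (EuclideanSpace.single i (1 : ℝ))).HasTemperateGrowth := by
    fun_prop
  rw [smul_apply, SchwartzMap.smulLeftCLM_apply_apply hg]
  simp only [EuclideanSpace.inner_single_right, PiLp.smul_apply, smul_eq_mul, Complex.real_smul]
  have : (Real.pi : ℂ) ≠ 0 := by exact_mod_cast Real.pi_ne_zero
  push_cast
  simp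
  field_simp

theorem pderiv_complex {θ : Plane → ℝ} (hθ : IsTest θ) (χ : 𝓢(Plane, ℂ))
    (hχ : ∀ z, χ z = (θ z : ℂ)) (i : Fin 2) (z : Plane) :
    fderiv ℝ χ z (EuclideanSpace.single i 1) = (pderiv i θ z : ℂ) := by
  have h : (χ : Plane → ℂ) = fun z => (θ z : ℂ) := funext hχ
  have hd : HasFDerivAt (fun z => (θ z : ℂ)) (Complex.ofRealCLM.comp (fderiv ℝ θ z)) z :=
    Complex.ofRealCLM.hasFDerivAt.comp z
      ((hθ.1.differentiable (by simp)).differentiableAt.hasFDerivAt)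
  rw [h, hd.fderiv]
  rfl

theorem isTest_pderiv {θ : Plane → ℝ} (h : IsTest θ) (i : Fin 2) : IsTest (pderiv i θ) :=
  ⟨(h.1.fderiv_right (m := ∞) (by simp)).clm_apply contDiff_const, h.compact_pderiv i⟩

/-- Parseval's formula against test functions. -/
theorem integral_mul_test (u : L2) {θ : Plane → ℝ} (hθ : IsTest θ) :
    ((∫ z, u z * θ z : ℝ) : ℂ)
      = (((2 * Real.pi) ^ 2)⁻¹ : ℝ) * ∫ ξ, l2Hat u ξ * chk (fun z => (θ z : ℂ)) ξ := by
  obtain ⟨χ, hχ⟩ := isTest_complex hθ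
  have h : (χ : Plane → ℂ) = fun z => (θ z : ℂ) := funext hχ
  rw [← h, ← l2Hat_pairing, ← integral_complex_ofReal]
  simp [hχ]

theorem chk_pderiv {θ : Plane → ℝ} (hθ : IsTest θ) (i : Fin 2) (ξ : Plane) :
    chk (fun z => (pderiv i θ z : ℂ)) ξ
      = -(Complex.I * (ξ i : ℂ)) * chk (fun z => (θ z : ℂ)) ξ := by
  obtain ⟨χ, hχ⟩ := isTest_complex hθ
  have h : (χ : Plane → ℂ) = fun z => (θ z : ℂ) := funext hχ
  have := chk_lineDeriv χ i ξ
  simp only [pderiv_complex hθ χ hχ] at this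
  rw [this, h]

theorem HasD.isWeakPartial {i : Fin 2} {f g : L2} (h : HasD i f g) : IsWeakPartial i f g := by
  intro θ hθ
  have e : ((∫ z, f z * pderiv i θ z : ℝ) : ℂ) = ((-∫ z, g z * θ z : ℝ) : ℂ) := by
    rw [Complex.ofReal_neg, integral_mul_test f (isTest_pderiv hθ i), integral_mul_test g hθ,
      ← mul_neg, ← integral_neg]
    congr 1
    refine integral_congr_ae ?_
    filter_upwards [h] with ξ hξ
    rw [hξ, chk_pderiv hθ]
    ring
  exact_mod_cast e

/-- Classical derivatives are derivatives on the Fourier side. -/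
theorem hasD_of_contDiff {i : Fin 2} {f : Plane → ℝ} (hf : ContDiff ℝ 1 f) (h0 : MemLp f 2 volume)
    (h1 : MemLp (pderiv i f) 2 volume) : HasD i h0.toLp h1.toLp := by
  -- That `ξ_i f̂` is square integrable is part of the conclusion; local integrability is enough to
  -- test against `C_c^∞`.
  have hl : LocallyIntegrable (fun ξ : Plane => Complex.I * (ξ i : ℂ) * l2Hat h0.toLp ξ) volume :=
    locallyIntegrableOn_univ.1 (((locallyIntegrable_l2Hat _).locallyIntegrableOn _).continuousOn_mul
      (by fun_prop) isOpen_univ.isLocallyClosed)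
  refine ae_eq_of_test (locallyIntegrable_l2Hat _) hl fun g hg => ?_
  obtain ⟨θ, hθ⟩ := exists_schwartz_chk hg
  have e1 : ∫ z, (f z : ℂ) * fderiv ℝ θ z (EuclideanSpace.single i 1)
      = -∫ z, (pderiv i f z : ℂ) * θ z := by
    have hd : ∀ z, HasFDerivAt (fun z => (f z : ℂ)) (Complex.ofRealCLM.comp (fderiv ℝ f z)) z :=
      fun z => Complex.ofRealCLM.hasFDerivAt.comp z
        ((hf.differentiable (by simp)).differentiableAt.hasFDerivAt)
    have hfd : ∀ z, fderiv ℝ (fun z => (f z : ℂ)) z (EuclideanSpace.single i 1)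
        = (pderiv i f z : ℂ) := fun z => by rw [(hd z).fderiv]; rfl
    have hθ2 : MemLp θ 2 volume := θ.memLp 2 volume
    have hθ3 : MemLp (fun z => fderiv ℝ θ z (EuclideanSpace.single i 1)) 2 volume := by
      have := (LineDeriv.lineDerivOp (EuclideanSpace.single i (1 : ℝ)) θ : 𝓢(Plane, ℂ)).memLp 2
        volume
      refine this.ae_eq (Eventually.of_forall fun z => ?_)
      rw [SchwartzMap.lineDerivOp_apply_eq_fderiv]
    have := integral_mul_fderiv_eq_neg_fderiv_mul_of_integrable (μ := volume) (𝕜 := ℂ)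
      (f := fun z => (f z : ℂ)) (g := θ)
      (v := EuclideanSpace.single i (1 : ℝ)) ?_ ?_ ?_ (fun z _ => (hd z).differentiableAt)
      (fun z _ => θ.differentiableAt)
    · simpa only [hfd] using this
    · simp only [hfd]
      exact MemLp.integrable_mul (p := 2) (q := 2) h1.ofReal hθ2
    · exact MemLp.integrable_mul (p := 2) (q := 2) h0.ofReal hθ3
    · exact MemLp.integrable_mul (p := 2) (q := 2) h0.ofReal hθ2
  obtain ⟨χ, hχ⟩ : ∃ χ : 𝓢(Plane, ℂ), ∀ z, χ z = fderiv ℝ θ z (EuclideanSpace.single i 1) :=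
    ⟨LineDeriv.lineDerivOp (EuclideanSpace.single i (1 : ℝ)) θ, fun z => by
      rw [SchwartzMap.lineDerivOp_apply_eq_fderiv]⟩
  have hχ' : (χ : Plane → ℂ) = fun z => fderiv ℝ θ z (EuclideanSpace.single i 1) := funext hχ
  have p1 := l2Hat_pairing h0.toLp χ
  have p2 := l2Hat_pairing h1.toLp θ
  have q1 : ∫ z, ((h0.toLp : L2) z : ℂ) * χ z
      = ∫ z, (f z : ℂ) * fderiv ℝ θ z (EuclideanSpace.single i 1) := by
    refine integral_congr_ae ?_
    filter_upwards [h0.coeFn_toLp] with z hz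
    rw [hz, hχ]
  have q2 : ∫ z, ((h1.toLp : L2) z : ℂ) * θ z = ∫ z, (pderiv i f z : ℂ) * θ z := by
    refine integral_congr_ae ?_
    filter_upwards [h1.coeFn_toLp] with z hz
    rw [hz]
  rw [q1, e1] at p1
  rw [q2] at p2
  rw [p2, ← mul_neg] at p1
  have hne : (((2 * Real.pi) ^ 2)⁻¹ : ℝ) ≠ 0 := by positivity
  have p3 := mul_left_cancel₀ (Complex.ofReal_ne_zero.2 hne) p1
  simp only [hχ', chk_lineDeriv, hθ] at p3
  rw [← neg_neg (∫ z, l2Hat h1.toLp z * (g z : ℂ)), p3, ← integral_neg]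
  congr 1
  ext ξ
  ring

/-! ### The kernel -/

theorem kernelHat_eq_chk (β : Plane → ℝ) (ξ : Plane) :
    kernelHat β ξ = chk (fun z => (β z : ℂ)) (-ξ) := by
  simp [kernelHat, chk]

theorem continuous_chk {θ : Plane → ℂ} (hθ : Integrable θ volume) : Continuous (chk θ) := by
  have : chk θ = fun ξ => 𝓕⁻ θ ((2 * Real.pi)⁻¹ • ξ) := funext (chk_eq _)
  rw [this]
  have h1 : Continuous (𝓕⁻ θ) := by
    rw [Real.fourierInv_eq_fourier_comp_neg]
    exact VectorFourier.fourierIntegral_continuous Real.continuous_fourierChar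
      (by exact continuous_inner) hθ.comp_neg
  exact h1.comp (continuous_const_smul _)

namespace IsKernel

variable {β : Plane → ℝ} {r : ℝ}

theorem continuous_hat (hβ : IsKernel β r) : Continuous (kernelHat β) := by
  have : kernelHat β = fun ξ => chk (fun z => (β z : ℂ)) (-ξ) := funext (kernelHat_eq_chk β)
  rw [this]
  exact (continuous_chk hβ.integrable.ofReal).comp continuous_neg

theorem hat_eq (hβ : IsKernel β r) (ξ : Plane) : kernelHat β ξ = ((kernelHat β ξ).re : ℂ) :=
  Complex.ext rfl (by simpa using hβ.im_eq_zero ξ)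

theorem hat_neg (hβ : IsKernel β r) (ξ : Plane) : kernelHat β (-ξ) = kernelHat β ξ := by
  have h : kernelHat β (-ξ) = conj (kernelHat β ξ) := by
    rw [kernelHat, kernelHat, ← integral_conj]
    congr 1
    ext z
    rw [map_mul, ← Complex.exp_conj]
    simp
  rw [h, hβ.hat_eq ξ, Complex.conj_ofReal]

theorem norm_hat (hβ : IsKernel β r) (ξ : Plane) : ‖kernelHat β ξ‖ = (kernelHat β ξ).re := by
  conv_lhs => rw [hβ.hat_eq ξ]
  rw [Complex.norm_real, Real.norm_of_nonneg (hβ.nonneg ξ)]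

theorem exists_bound (hβ : IsKernel β r) :
    ∃ C : ℝ, 0 < C ∧ ∀ ξ, (kernelHat β ξ).re ≤ C * jw (-r) ξ := by
  obtain ⟨C, hC, h⟩ := hβ.decay
  refine ⟨C, hC, fun ξ => (h ξ).trans_eq ?_⟩
  rw [jw]
  congr 2
  ring

theorem isSymb_hat (hβ : IsKernel β r) (hr : 0 ≤ r) : IsSymb (kernelHat β) := by
  obtain ⟨C, hC, h⟩ := hβ.exists_bound
  refine ⟨hβ.continuous_hat.measurable, ⟨C, fun ξ => ?_⟩, fun ξ => ?_⟩
  · rw [hβ.norm_hat]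
    exact (h ξ).trans (mul_le_of_le_one_right hC.le (jw_le_one (by linarith) ξ))
  · rw [hβ.hat_neg, hβ.hat_eq, Complex.conj_ofReal]

/-- The symbol `i ξ_i β̂(ξ) (1 + |ξ|²)^{a/2}` is bounded for `a ≤ r - 1`. -/
theorem isSymb_dsymb_mul (hβ : IsKernel β r) (i : Fin 2) {a : ℝ} (ha : a + 1 ≤ r) :
    IsSymb (fun ξ => dsymb i a ξ * kernelHat β ξ) := by
  obtain ⟨C, hC, h⟩ := hβ.exists_bound
  refine ⟨(dsymb_measurable i a).mul hβ.continuous_hat.measurable, ⟨C, fun ξ => ?_⟩, fun ξ => ?_⟩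
  · rw [norm_mul, hβ.norm_hat]
    calc _ ≤ jw (a + 1) ξ * (C * jw (-r) ξ) :=
          mul_le_mul (norm_dsymb_le i a ξ) (h ξ) (hβ.nonneg ξ) (jw_pos _ _).le
      _ = C * jw (a + 1 - r) ξ := by rw [sub_eq_add_neg (a + 1), jw_add (a + 1)]; ring
      _ ≤ C := mul_le_of_le_one_right hC.le (jw_le_one (by linarith) ξ)
  · rw [dsymb_symm, hβ.hat_neg, map_mul]
    congr 1
    rw [hβ.hat_eq, Complex.conj_ofReal]

end IsKernel

theorem IsTest.memLp {θ : Plane → ℝ} (h : IsTest θ) : MemLp θ 2 volume :=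
  h.1.continuous.memLp_of_hasCompactSupport h.2

theorem IsTest.integrable_l2Hat {θ : Plane → ℝ} (h : IsTest θ) :
    Integrable (l2Hat h.memLp.toLp) volume := by
  obtain ⟨χ, hχ⟩ := isTest_complex h
  have e1 : toComplex h.memLp.toLp = χ.toLp 2 volume := by
    ext1
    filter_upwards [toComplex_coe h.memLp.toLp, h.memLp.coeFn_toLp, χ.coeFn_toLp 2 volume]
      with z a b c
    rw [a, b, c, hχ]
  have e2 : l2Hat h.memLp.toLp =ᵐ[volume] fun ξ => (𝓕 χ) ((2 * Real.pi)⁻¹ • ξ) := by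
    filter_upwards [quasi_scale.ae ((𝓕 χ).coeFn_toLp 2 volume)] with ξ hξ
    rw [l2Hat, e1, SchwartzMap.toLp_fourier_eq]
    exact hξ
  refine Integrable.congr ?_ e2.symm
  exact (𝓕 χ).integrable.comp_smul (inv_ne_zero two_pi_ne)

/-- Fubini moves the convolution onto the test function. There the reflected kernel is convolved
with a function whose transform is integrable, so the inversion formula identifies the result. The
reflection does not change the symbol because `β̂` is real and even. -/
theorem integral_convol_mul_test {β : Plane → ℝ} {r : ℝ} (hβ : IsKernel β r) (hr : 0 ≤ r) (g : L2)
    {χ : Plane → ℝ} (hχ : IsTest χ) :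
    ∫ z, convol β g z * χ z = ∫ z, op (kernelHat β) g z * χ z := by
  have hχ2 := hχ.memLp
  have hχi : Integrable χ volume := hχ.1.continuous.integrable_of_hasCompactSupport hχ.2
  obtain ⟨M, hM⟩ := hχ.1.continuous.bounded_above_of_compact_support hχ.2
  have hs := hβ.isSymb_hat hr
  set X : L2 := hχ2.toLp with hX
  -- the convolution of the reflected kernel with the test function
  have hk : ∀ᵐ x, op (kernelHat β) X x = ∫ z, β (z - x) * χ z := by
    have hint : Integrable (l2Hat (op (kernelHat β) X)) volume := by
      obtain ⟨C, hC⟩ := hs.bdd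
      refine (hχ.integrable_l2Hat.bdd_mul (c := C) hs.meas.aestronglyMeasurable
        (Eventually.of_forall hC)).congr (l2Hat_op hs X).symm
    filter_upwards [l2Hat_inversion hint] with x hx
    have e1 : ∫ z, β (z - x) * χ z = ∫ y, β y * χ (y + x) := by
      rw [← integral_add_right_eq_self _ x]
      simp
    have e2 : ∫ y, ((β y * χ (y + x) : ℝ) : ℂ)
        = ∫ y, (β y : ℂ) * ((((2 * Real.pi) ^ 2)⁻¹ : ℝ) * chk (l2Hat X) (y + x)) := by
      have hq : Measure.QuasiMeasurePreserving (fun y : Plane => y + x) volume volume :=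
        (measurePreserving_add_right volume x).quasiMeasurePreserving
      refine integral_congr_ae ?_
      filter_upwards [hq.ae (l2Hat_inversion hχ.integrable_l2Hat), hq.ae hχ2.coeFn_toLp]
        with y a b
      rw [← a, b]
      push_cast
      rfl
    have e3 : ∫ y, (β y : ℂ) * chk (l2Hat X) (y + x) = chk (l2Hat (op (kernelHat β) X)) x := by
      have hint2 : Integrable (Function.uncurry fun (y ξ : Plane) => (β y : ℂ) *
          (Complex.exp (Complex.I * ((inner ℝ ξ (y + x) : ℝ) : ℂ)) * l2Hat X ξ))
          (volume.prod volume) := by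
        have h1 : Integrable (fun p : Plane × Plane => (β p.1 : ℂ) * l2Hat X p.2)
          (volume.prod volume) := hβ.integrable.ofReal.mul_prod hχ.integrable_l2Hat
        have h2 := h1.bdd_mul (c := 1) (f := fun p : Plane × Plane =>
            Complex.exp (Complex.I * ((inner ℝ p.2 (p.1 + x) : ℝ) : ℂ)))
          (by fun_prop) (by
            refine Filter.Eventually.of_forall fun p => ?_
            rw [mul_comm, Complex.norm_exp_ofReal_mul_I])
        refine h2.congr (Filter.Eventually.of_forall fun p => ?_)
        simp only [Function.uncurry]
        ring
      calc _ = ∫ y, ∫ ξ, (β y : ℂ) *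
            (Complex.exp (Complex.I * ((inner ℝ ξ (y + x) : ℝ) : ℂ)) * l2Hat X ξ) := by
            congr 1; ext y; rw [integral_const_mul, chk]
        _ = _ := integral_integral_swap hint2
        _ = _ := by
            rw [chk]
            refine integral_congr_ae ?_
            filter_upwards [l2Hat_op hs X] with ξ hξ
            rw [hξ, ← hβ.hat_neg, kernelHat, ← integral_mul_const, ← integral_const_mul]
            congr 1
            ext y
            rw [inner_add_right, Complex.ofReal_add, mul_add, Complex.exp_add, inner_neg_right,
              real_inner_comm]
            push_cast
            ring_nf
    have e4 : ((∫ z, β (z - x) * χ z : ℝ) : ℂ) = (op (kernelHat β) X x : ℂ) := by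
      rw [hx, e1, ← integral_complex_ofReal, e2, ← e3, ← integral_const_mul]
      congr 1
      ext y
      ring
    exact_mod_cast e4.symm
  -- As `g` need not be integrable, `|g| ≤ 1 + g²` is used: the two terms pair `β ∈ L¹` with `χ ∈
  -- L¹` and with `g² ∈ L¹`.
  have hF : Integrable (Function.uncurry fun (z x : Plane) => β (z - x) * g x * χ z)
      (volume.prod volume) := by
    have hg2 : Integrable (fun x => g x ^ 2) volume := (Lp.memLp g).integrable_sq
    have h1 : Integrable (fun p : Plane × Plane => g p.2 ^ 2 * β (p.1 - p.2))
        (volume.prod volume) :=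
      hg2.convolution_integrand (ContinuousLinearMap.mul ℝ ℝ) hβ.integrable
    have h2 : Integrable (fun p : Plane × Plane => χ p.1 * β (p.1 - p.2))
        (volume.prod volume) := by
      have h := (hχi.convolution_integrand (ContinuousLinearMap.mul ℝ ℝ)
        hβ.integrable.comp_neg).swap
      refine h.congr (Eventually.of_forall fun p => ?_)
      simp [Function.comp]
    have h3 := (h1.norm.const_mul M).add h2.norm
    refine h3.mono' ?_ (Eventually.of_forall fun p => ?_)
    · have hβm : AEStronglyMeasurable (fun p : Plane × Plane => β (p.1 - p.2))
          (volume.prod volume) :=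
        hβ.integrable.1.comp_quasiMeasurePreserving (quasiMeasurePreserving_sub volume volume)
      exact (hβm.mul (Lp.aestronglyMeasurable g).comp_snd).mul
        (hχ.1.continuous.comp continuous_fst).aestronglyMeasurable
    · simp only [Function.uncurry, Pi.add_apply, norm_mul, norm_pow]
      have h5 := hM p.1
      have h6 := norm_nonneg (β (p.1 - p.2))
      have h7 := norm_nonneg (χ p.1)
      have h8 : ‖g p.2‖ ≤ 1 + ‖g p.2‖ ^ 2 := by nlinarith [sq_nonneg (‖g p.2‖ - 1)]
      calc _ ≤ ‖β (p.1 - p.2)‖ * (1 + ‖g p.2‖ ^ 2) * ‖χ p.1‖ := by gcongr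
        _ = (‖g p.2‖ ^ 2 * ‖β (p.1 - p.2)‖) * ‖χ p.1‖ + ‖χ p.1‖ * ‖β (p.1 - p.2)‖ := by ring
        _ ≤ (‖g p.2‖ ^ 2 * ‖β (p.1 - p.2)‖) * M + ‖χ p.1‖ * ‖β (p.1 - p.2)‖ := by gcongr
        _ = _ := by ring
  have hc : op (fun ξ => conj (kernelHat β ξ)) = op (kernelHat β) := by
    congr 1
    ext ξ
    rw [hβ.hat_eq, Complex.conj_ofReal]
  calc ∫ z, convol β g z * χ z = ∫ z, ∫ x, β (z - x) * g x * χ z := by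
        congr 1; ext z; rw [convol, integral_mul_const]
    _ = ∫ x, ∫ z, β (z - x) * g x * χ z := integral_integral_swap hF
    _ = ∫ x, g x * op (kernelHat β) X x := by
        refine integral_congr_ae ?_
        filter_upwards [hk] with x hx
        rw [hx, ← integral_const_mul]
        congr 1; ext z; ring
    _ = ∫ x, op (kernelHat β) g x * X x := by rw [integral_op_mul hs, hc]
    _ = _ := by
        refine integral_congr_ae ?_
        filter_upwards [hχ2.coeFn_toLp] with x hx
        rw [hx]

/-- The force in terms of Fourier multipliers. -/
theorem eqForce_iff {s : ℝ} {β : Plane → ℝ} {r : ℝ} (hβ : IsKernel β r) (hr : 1 ≤ r) {F : ℝ → ℝ}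
    {w : XSpace s} {g : Fin 2 → L2} (hg : ∀ i, g i =ᵐ[volume] stress F w i) (a : L2) :
    EqForce β F w a ↔ a = ∑ i, op (fun ξ => dsymb i 0 ξ * kernelHat β ξ) (g i) := by
  have key : ∀ i, ∀ θ, IsTest θ → ∫ z, convol β (stress F w i) z * pderiv i θ z
      = -∫ z, op (fun ξ => dsymb i 0 ξ * kernelHat β ξ) (g i) z * θ z := by
    intro i θ hθ
    have h1 : convol β (stress F w i) = convol β (g i) := by
      ext z
      refine integral_congr_ae ?_
      filter_upwards [hg i] with x hx
      rw [hx]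
    rw [h1, integral_convol_mul_test hβ (by linarith) (g i) (isTest_pderiv hθ i)]
    have hD : HasD i (op (kernelHat β) (g i)) (op (fun ξ => dsymb i 0 ξ * kernelHat β ξ) (g i)) := by
      filter_upwards [l2Hat_op (hβ.isSymb_hat (by linarith)) (g i),
        l2Hat_op (hβ.isSymb_dsymb_mul i (a := 0) (by linarith)) (g i)] with ξ h2 h3
      rw [h3, h2, dsymb, jw_zero]
      push_cast
      ring
    exact hD.isWeakPartial θ hθ
  have key2 : ∀ θ, IsTest θ → -∑ i : Fin 2, ∫ z, convol β (stress F w i) z * pderiv i θ z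
      = ∫ z, (∑ i, op (fun ξ => dsymb i 0 ξ * kernelHat β ξ) (g i) : L2) z * θ z := by
    intro θ hθ
    have hi : ∀ i, Integrable
        (fun z => op (fun ξ => dsymb i 0 ξ * kernelHat β ξ) (g i) z * θ z) volume :=
      fun i => integrable_mul_cc (by norm_num) _ hθ.1.continuous hθ.2
    rw [Finset.sum_congr rfl fun i _ => key i θ hθ, Finset.sum_neg_distrib, neg_neg,
      ← integral_finsetSum _ fun i _ => hi i]
    refine integral_congr_ae ?_
    rw [Fin.sum_univ_two]
    filter_upwards [Lp.coeFn_add (op (fun ξ => dsymb 0 0 ξ * kernelHat β ξ) (g 0))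
      (op (fun ξ => dsymb 1 0 ξ * kernelHat β ξ) (g 1))] with z hz
    rw [hz, Fin.sum_univ_two, Pi.add_apply, add_mul]
  constructor
  · intro h
    ext1
    refine ae_eq_of_integral_contDiff_smul_eq ((Lp.memLp a).locallyIntegrable (by norm_num))
      ((Lp.memLp _).locallyIntegrable (by norm_num)) ?_
    intro θ h1 h2
    have := (h θ ⟨h1, h2⟩).trans (key2 θ ⟨h1, h2⟩)
    simpa [smul_eq_mul, mul_comm] using this
  · rintro rfl θ hθ
    rw [key2 θ hθ]

/-! ### Coordinates on `X^s` -/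

namespace XSpace

variable {s : ℝ}

theorem exists_lift (hs : 0 ≤ s) (w : XSpace s) : ∃ v : L2, bes s v = w.toL2 :=
  exists_bes_eq hs w.2.1

theorem toL2_injective : Function.Injective (toL2 : XSpace s → L2) := Subtype.val_injective

theorem sobolevNorm_le (w : XSpace s) : (sobolevNorm s w.toL2).toReal ≤ ‖w‖ := by
  rw [norm_def]
  have h1 := norm_nonneg (w.wpartial 0)
  have h2 := norm_nonneg (w.wpartial 1)
  linarith

theorem norm_wpartial_le (w : XSpace s) (i : Fin 2) : ‖w.wpartial i‖ ≤ ‖w‖ := by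
  rw [norm_def]
  have h0 : 0 ≤ (sobolevNorm s w.toL2).toReal := ENNReal.toReal_nonneg
  have h1 := norm_nonneg (w.wpartial 0)
  have h2 := norm_nonneg (w.wpartial 1)
  fin_cases i
  · change ‖w.wpartial 0‖ ≤ _
    linarith
  · change ‖w.wpartial 1‖ ≤ _
    linarith

theorem norm_le_of_bes (hs : 0 ≤ s) {w : XSpace s} {v : L2} (h : bes s v = w.toL2) :
    ‖v‖ ≤ ‖w‖ := by
  refine le_trans ?_ w.sobolevNorm_le
  rw [← h, sobolevNorm_bes hs, ENNReal.toReal_mul, toReal_enorm,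
    ENNReal.toReal_ofReal (by positivity)]
  nlinarith [norm_nonneg v, Real.pi_gt_three]

/-- The coordinate `(1 - Δ)^{s/2} w ∈ L²` of `w ∈ X^s`. -/
def lco (hs : 0 ≤ s) : XSpace s →L[ℝ] L2 :=
  LinearMap.mkContinuous
    { toFun := fun w => (exists_lift hs w).choose
      map_add' := fun v w => by
        apply bes_inj hs
        rw [map_add (bes s), (exists_lift hs v).choose_spec, (exists_lift hs w).choose_spec,
          (exists_lift hs (v + w)).choose_spec, map_add]
      map_smul' := fun c w => by
        apply bes_inj hs
        rw [RingHom.id_apply, map_smul (bes s), (exists_lift hs w).choose_spec,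
          (exists_lift hs (c • w)).choose_spec, map_smul] }
    1 (fun w => by
      rw [one_mul]
      exact norm_le_of_bes hs (exists_lift hs w).choose_spec)

theorem bes_lco (hs : 0 ≤ s) (w : XSpace s) : bes s (lco hs w) = w.toL2 :=
  (exists_lift hs w).choose_spec

/-- The coordinate `(1 - Δ)^{1/2} w ∈ L²` of `w ∈ X^s`. -/
def yco (hs : 1 ≤ s) : XSpace s →L[ℝ] L2 := (bes (s - 1)).comp (lco (by linarith))

theorem bes_yco (hs : 1 ≤ s) (w : XSpace s) : bes 1 (yco hs w) = w.toL2 := by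
  rw [yco, ContinuousLinearMap.comp_apply, bes_bes zero_le_one (by linarith),
    ← bes_lco (by linarith)]
  congr 2
  ring

end XSpace

/-- The partial derivative in terms of the coordinate `(1 - Δ)^{1/2} w`. -/
def dop (i : Fin 2) : L2 →L[ℝ] L2 := op (dsymb i (-1))

theorem norm_dop_le (i : Fin 2) (y : L2) : ‖dop i y‖ ≤ ‖y‖ := by
  have := norm_op_le (isSymb_dsymb i le_rfl) (C := 1)
    (fun ξ => (norm_dsymb_le i (-1) ξ).trans (jw_le_one (by norm_num) ξ)) y
  rwa [one_mul] at this

theorem IsWeakPartial.ae_eq {i : Fin 2} {u : Plane → ℝ} {g : L2} {h : Linfty}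
    (hg : IsWeakPartial i u g) (hh : IsWeakPartial i u h) : g =ᵐ[volume] h := by
  refine ae_eq_of_integral_contDiff_smul_eq ((Lp.memLp g).locallyIntegrable (by norm_num))
    ((Lp.memLp h).locallyIntegrable (by simp)) ?_
  intro θ h1 h2
  have h3 := (hg θ ⟨h1, h2⟩).symm.trans (hh θ ⟨h1, h2⟩)
  simpa [smul_eq_mul, mul_comm] using h3

/-- Identifies the `L^∞` derivative chosen in the definition of `X^s` with a Fourier multiplier.
Gradients thus lie in `L²` and in `L^∞` at once, which every nonlinear estimate uses. -/
theorem XSpace.dop_yco {s : ℝ} (hs : 1 ≤ s) (w : XSpace s) (i : Fin 2) :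
    dop i (yco hs w) =ᵐ[volume] w.wpartial i := by
  have h := (hasD_bes i le_rfl (yco hs w)).isWeakPartial
  rw [bes_yco] at h
  exact h.ae_eq (w.isWeakPartial i)

theorem ae_abs_le_norm (g : Linfty) : ∀ᵐ z, |g z| ≤ ‖g‖ := by
  have h := ae_le_eLpNormEssSup (f := (g : Plane → ℝ)) (μ := volume)
  filter_upwards [h] with z hz
  rw [Lp.norm_def, eLpNorm_exponent_top]
  have hf : eLpNormEssSup (g : Plane → ℝ) volume ≠ ⊤ := by
    rw [← eLpNorm_exponent_top]
    exact Lp.eLpNorm_ne_top g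
  have := ENNReal.toReal_mono hf hz
  simpa using this

theorem XSpace.ae_abs_dop_le {s : ℝ} (hs : 1 ≤ s) (w : XSpace s) (i : Fin 2) :
    ∀ᵐ z, |dop i (yco hs w) z| ≤ ‖w‖ := by
  filter_upwards [XSpace.dop_yco hs w i, ae_abs_le_norm (w.wpartial i)] with z h1 h2
  rw [h1]
  exact h2.trans (w.norm_wpartial_le i)

theorem norm_le_of_ae_abs_le {g : Linfty} {C : ℝ} (hC : 0 ≤ C) (h : ∀ᵐ z, |g z| ≤ C) :
    ‖g‖ ≤ C := by
  rw [Lp.norm_def, eLpNorm_exponent_top]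
  refine ENNReal.toReal_le_of_le_ofReal hC ?_
  exact eLpNormEssSup_le_of_ae_bound h

/-! ### Bessel potentials of order above 2 as maps into `X^s` -/

section Potential

variable {s ρ : ℝ}

theorem sobolevNorm_bes_le (h0 : 0 ≤ ρ) (hρs : s ≤ ρ) (u : L2) :
    sobolevNorm s (bes ρ u) ≤ ENNReal.ofReal (2 * Real.pi) * ‖u‖ₑ := by
  rw [sobolevNorm_eq, ← eLpNorm_l2Hat]
  refine eLpNorm_mono_ae ?_
  filter_upwards [l2Hat_bes h0 u] with ξ h
  rw [h, ← mul_assoc, ← Complex.ofReal_mul, ← jw_add, norm_mul, Complex.norm_real,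
    Real.norm_of_nonneg (jw_pos _ _).le]
  exact mul_le_of_le_one_left (norm_nonneg _) (jw_le_one (by linarith) ξ)

/-- A derivative of a potential of order `ρ` is a potential of order `ρ - 1` of a bounded operator,
and the Sobolev embedding in the plane needs `ρ - 1 > 1`. This is the origin of the condition `ρ >
2`. -/
theorem exists_ae_abs_op_dsymb_le (hρ : 2 < ρ) :
    ∃ C : ℝ, 0 ≤ C ∧ ∀ (i : Fin 2) (u : L2), ∀ᵐ z, |op (dsymb i (-ρ)) u z| ≤ C * ‖u‖ := by
  obtain ⟨C, hC, h⟩ := exists_ae_abs_bes_le (a := ρ - 1) (by linarith)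
  refine ⟨C, hC, fun i u => ?_⟩
  have e : op (dsymb i (-ρ)) u = bes (ρ - 1) (dop i u) := by
    refine (op_op (isSymb_jw (by linarith)) (isSymb_dsymb i le_rfl)
      (isSymb_dsymb i (by linarith)) (fun ξ => ?_) u).symm
    have : jw (-ρ) ξ = jw (-(ρ - 1)) ξ * jw (-1) ξ := by rw [← jw_add]; congr 1; ring
    rw [dsymb, dsymb, this]
    push_cast
    ring
  filter_upwards [h (dop i u)] with z hz
  rw [e]
  exact hz.trans (mul_le_mul_of_nonneg_left (norm_dop_le i u) hC)

theorem exists_weakPartial_bes (hρ : 2 < ρ) (i : Fin 2) (u : L2) :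
    ∃ g : Linfty, IsWeakPartial i (bes ρ u) g ∧ g =ᵐ[volume] op (dsymb i (-ρ)) u := by
  obtain ⟨C, hC, h⟩ := exists_ae_abs_op_dsymb_le hρ
  have hm : MemLp (op (dsymb i (-ρ)) u : Plane → ℝ) ∞ volume :=
    memLp_top_of_bound (Lp.aestronglyMeasurable _) (C * ‖u‖) (h i u)
  refine ⟨hm.toLp, fun θ hθ => ?_, hm.coeFn_toLp⟩
  rw [(hasD_bes i (by linarith) u).isWeakPartial θ hθ]
  congr 1
  refine integral_congr_ae ?_
  filter_upwards [hm.coeFn_toLp] with z hz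
  rw [hz]

theorem bes_mem_xSubmodule (hρ : 2 < ρ) (hρs : s ≤ ρ) (u : L2) : bes ρ u ∈ xSubmodule s := by
  refine ⟨(sobolevNorm_bes_le (by linarith) hρs u).trans_lt
    (ENNReal.mul_lt_top ENNReal.ofReal_lt_top (by simp)), fun i => ?_⟩
  obtain ⟨g, hg, -⟩ := exists_weakPartial_bes hρ i u
  exact ⟨g, hg⟩

/-- The Bessel potential of `u ∈ L²` as an element of `X^s`. -/
def besX (hρ : 2 < ρ) (hρs : s ≤ ρ) (u : L2) : XSpace s := ⟨bes ρ u, bes_mem_xSubmodule hρ hρs u⟩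

theorem toL2_besX (hρ : 2 < ρ) (hρs : s ≤ ρ) (u : L2) : (besX hρ hρs u).toL2 = bes ρ u := rfl

theorem exists_norm_besX_le (hρ : 2 < ρ) (hρs : s ≤ ρ) :
    ∃ C : ℝ, ∀ u : L2, ‖besX hρ hρs u‖ ≤ C * ‖u‖ := by
  obtain ⟨C, hC, h⟩ := exists_ae_abs_op_dsymb_le hρ
  refine ⟨2 * Real.pi + C + C, fun u => ?_⟩
  have h1 : (sobolevNorm s (bes ρ u)).toReal ≤ 2 * Real.pi * ‖u‖ := by
    have := ENNReal.toReal_mono (ENNReal.mul_ne_top ENNReal.ofReal_ne_top (by simp))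
      (sobolevNorm_bes_le (by linarith) hρs u)
    rwa [ENNReal.toReal_mul, toReal_enorm, ENNReal.toReal_ofReal (by positivity)] at this
  have h2 : ∀ i, ‖(besX hρ hρs u).wpartial i‖ ≤ C * ‖u‖ := by
    intro i
    obtain ⟨g, hg, hg'⟩ := exists_weakPartial_bes hρ i u
    have e : (besX hρ hρs u).wpartial i = g :=
      ((besX hρ hρs u).isWeakPartial i).unique (u := bes ρ u) hg
    rw [e]
    refine norm_le_of_ae_abs_le (by positivity) ?_
    filter_upwards [hg', h i u] with z a b
    rwa [a]
  rw [XSpace.norm_def, toL2_besX]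
  linarith [h2 0, h2 1]

/-- The Bessel potential as a map into `X^s`. -/
def potX (hρ : 2 < ρ) (hρs : s ≤ ρ) : L2 →L[ℝ] XSpace s :=
  LinearMap.mkContinuousOfExistsBound
    { toFun := besX hρ hρs
      map_add' := fun u v => XSpace.toL2_injective (by
        rw [map_add XSpace.toL2, toL2_besX, toL2_besX, toL2_besX, map_add])
      map_smul' := fun c u => XSpace.toL2_injective (by
        rw [map_smul XSpace.toL2, toL2_besX, toL2_besX, map_smul, RingHom.id_apply]) }
    (exists_norm_besX_le hρ hρs)

theorem toL2_potX (hρ : 2 < ρ) (hρs : s ≤ ρ) (u : L2) : (potX hρ hρs u).toL2 = bes ρ u := rfl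

theorem yco_potX (hs : 1 ≤ s) (hρ : 2 < ρ) (hρs : s ≤ ρ) (u : L2) :
    XSpace.yco hs (potX hρ hρs u) = bes (ρ - 1) u := by
  apply bes_inj zero_le_one
  rw [XSpace.bes_yco, toL2_potX, bes_bes zero_le_one (by linarith)]
  congr 2
  ring

end Potential

/-! ### Superposition operators on `L²` -/

open Classical in
/-- The composition `G(u_0, u_1)`, and `0` if it is not square integrable. -/
def cmp (G : (Fin 2 → ℝ) → ℝ) (u : Fin 2 → L2) : L2 :=
  if h : MemLp (fun z => G fun i => u i z) 2 (volume : Measure Plane) then h.toLp else 0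

/-- Lipschitz on the ball of radius `R` with constant `L`. -/
def LipBall (G : (Fin 2 → ℝ) → ℝ) (R L : ℝ) : Prop :=
  ∀ p q : Fin 2 → ℝ, ‖p‖ ≤ R → ‖q‖ ≤ R → |G p - G q| ≤ L * ‖p - q‖

theorem exists_lipBall {G : (Fin 2 → ℝ) → ℝ} (hG : ContDiff ℝ 1 G) (R : ℝ) :
    ∃ L : ℝ, 0 ≤ L ∧ LipBall G R L := by
  obtain ⟨C, hC⟩ := (isCompact_closedBall (0 : Fin 2 → ℝ) R).exists_bound_of_continuousOn
    (hG.continuous_fderiv (by simp)).continuousOn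
  refine ⟨max C 0, le_max_right _ _, fun p q hp hq => ?_⟩
  refine (convex_closedBall (0 : Fin 2 → ℝ) R).norm_image_sub_le_of_norm_fderiv_le (𝕜 := ℝ)
    (fun x _ => (hG.differentiable (by simp)).differentiableAt)
    (fun x hx => (hC x hx).trans (le_max_left _ _)) (by simpa using hq) (by simpa using hp)

theorem pi_norm_le_sum (p : Fin 2 → ℝ) : ‖p‖ ≤ |p 0| + |p 1| := by
  rw [pi_norm_le_iff_of_nonneg (by positivity)]
  intro i
  fin_cases i
  · simp
  · simp

theorem aesm_comp {G : (Fin 2 → ℝ) → ℝ} (hG : Continuous G) (u : Fin 2 → L2) :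
    AEStronglyMeasurable (fun z => G fun i => u i z) (volume : Measure Plane) :=
  hG.comp_aestronglyMeasurable
    (aemeasurable_pi_lambda _ fun i =>
      (Lp.aestronglyMeasurable (u i)).aemeasurable).aestronglyMeasurable

/-- The components of `u` are bounded by `R`. -/
def BddAE (u : Fin 2 → L2) (R : ℝ) : Prop := ∀ i, ∀ᵐ z, |u i z| ≤ R

theorem BddAE.ae_norm_le {u : Fin 2 → L2} {R : ℝ} (h : BddAE u R) :
    ∀ᵐ z, ‖(fun i => u i z)‖ ≤ R := by
  filter_upwards [h 0, h 1] with z h0 h1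
  rw [pi_norm_le_iff_of_nonneg ((abs_nonneg _).trans h0)]
  intro i
  fin_cases i
  · exact h0
  · exact h1

theorem memLp_comp {G : (Fin 2 → ℝ) → ℝ} (hG : Continuous G) (h0 : G 0 = 0) {R L : ℝ}
    (hL : LipBall G R L) (hL0 : 0 ≤ L) {u : Fin 2 → L2} (hu : BddAE u R) :
    MemLp (fun z => G fun i => u i z) 2 (volume : Measure Plane) := by
  have h1 : MemLp (fun z => |u 0 z| + |u 1 z|) 2 volume :=
    (Lp.memLp (u 0)).norm.add (Lp.memLp (u 1)).norm
  refine h1.of_le_mul (c := L) (aesm_comp hG u) ?_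
  filter_upwards [hu.ae_norm_le] with z hz
  have hR : (0 : ℝ) ≤ R := (norm_nonneg _).trans hz
  have := hL (fun i => u i z) 0 hz (by simpa using hR)
  rw [h0, sub_zero, sub_zero] at this
  rw [Real.norm_eq_abs, Real.norm_of_nonneg (by positivity)]
  exact this.trans (mul_le_mul_of_nonneg_left (pi_norm_le_sum _) hL0)

theorem cmp_coe {G : (Fin 2 → ℝ) → ℝ} {u : Fin 2 → L2}
    (h : MemLp (fun z => G fun i => u i z) 2 (volume : Measure Plane)) :
    cmp G u =ᵐ[volume] fun z => G fun i => u i z := by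
  rw [cmp, dif_pos h]
  exact h.coeFn_toLp

/-- The bound `R` in `L^∞` makes `G` effectively Lipschitz, so no smoothness of `u` and `v` enters.
This is the weak-norm estimate behind both the interpolation argument and the contraction for the
evolution. -/
theorem norm_cmp_sub_le {G : (Fin 2 → ℝ) → ℝ} (hG : Continuous G) (h0 : G 0 = 0) {R L : ℝ}
    (hL : LipBall G R L) (hL0 : 0 ≤ L) {u v : Fin 2 → L2} (hu : BddAE u R) (hv : BddAE v R) :
    ‖cmp G u - cmp G v‖ ≤ L * (‖u 0 - v 0‖ + ‖u 1 - v 1‖) := by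
  have hu' := memLp_comp hG h0 hL hL0 hu
  have hv' := memLp_comp hG h0 hL hL0 hv
  have h1 : ∀ i, MemLp (fun z => |(u i - v i : L2) z|) 2 volume := fun i =>
    (Lp.memLp (u i - v i)).norm
  have h2 : ‖((h1 0).add (h1 1)).toLp‖ ≤ ‖u 0 - v 0‖ + ‖u 1 - v 1‖ := by
    rw [MemLp.toLp_add (h1 0) (h1 1)]
    refine (norm_add_le _ _).trans (add_le_add ?_ ?_) <;>
    · rw [Lp.norm_toLp, Lp.norm_def]
      refine ENNReal.toReal_mono (Lp.eLpNorm_ne_top _) (eLpNorm_mono fun z => ?_)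
      simp
  refine le_trans ?_ (mul_le_mul_of_nonneg_left h2 hL0)
  refine Lp.norm_le_mul_norm_of_ae_le_mul ?_
  filter_upwards [cmp_coe hu', cmp_coe hv', Lp.coeFn_sub (cmp G u) (cmp G v),
    Lp.coeFn_sub (u 0) (v 0), Lp.coeFn_sub (u 1) (v 1), hu.ae_norm_le, hv.ae_norm_le,
    ((h1 0).add (h1 1)).coeFn_toLp] with z a b c d e f g k
  rw [c, Pi.sub_apply, a, b, k, Pi.add_apply, d, e, Real.norm_eq_abs, Pi.sub_apply, Pi.sub_apply,
    Real.norm_of_nonneg (by positivity)]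
  exact (hL _ _ f g).trans (mul_le_mul_of_nonneg_left (pi_norm_le_sum _) hL0)

/-- `∂F/∂w_{x_i}` as a function of the gradient. -/
def stressFun (F : ℝ → ℝ) (i : Fin 2) (p : Fin 2 → ℝ) : ℝ :=
  2 * p i * deriv F (p 0 ^ 2 + p 1 ^ 2)

theorem stressFun_zero (F : ℝ → ℝ) (i : Fin 2) : stressFun F i 0 = 0 := by simp [stressFun]

theorem contDiff_stressFun {F : ℝ → ℝ} {n : ℕ} (hF : ContDiff ℝ ((n + 1 : ℕ) : WithTop ℕ∞) F)
    (i : Fin 2) : ContDiff ℝ n (stressFun F i) := by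
  have h1 : ContDiff ℝ n (deriv F) := by
    have := contDiff_succ_iff_deriv (𝕜 := ℝ) (n := n) (f := F)
    push_cast at hF
    exact (this.1 hF).2.2
  have h2 : ContDiff ℝ n (fun p : Fin 2 → ℝ => p 0 ^ 2 + p 1 ^ 2) := by fun_prop
  have h3 : ContDiff ℝ n (fun p : Fin 2 → ℝ => 2 * p i) := by fun_prop
  exact h3.mul (h1.comp h2)

/-- The gradient in terms of `y = (1 - Δ)^{1/2} w`. -/
def gradOf (y : L2) (i : Fin 2) : L2 := dop i y

theorem stress_ae {s : ℝ} (hs : 1 ≤ s) {F : ℝ → ℝ} (hF : ContDiff ℝ 2 F) (w : XSpace s)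
    (i : Fin 2) : cmp (stressFun F i) (gradOf (w.yco hs)) =ᵐ[volume] stress F w i := by
  have hG : ContDiff ℝ 1 (stressFun F i) := contDiff_stressFun (n := 1) (by exact_mod_cast hF) i
  obtain ⟨L, hL0, hL⟩ := exists_lipBall hG ‖w‖
  have hm := memLp_comp hG.continuous (stressFun_zero F i) hL hL0
    (u := gradOf (w.yco hs)) (fun i => w.ae_abs_dop_le hs i)
  filter_upwards [cmp_coe hm, w.dop_yco hs 0, w.dop_yco hs 1] with z h h0 h1
  rw [h, stress, stressFun, gradSq]
  have : ∀ j, gradOf (w.yco hs) j z = w.wpartial j z := by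
    intro j
    fin_cases j
    · exact h0
    · exact h1
  rw [this, this, this]

/-! ### Products of Sobolev functions -/

/-- Young's inequality `L¹ * L² ⊆ L²`. -/
theorem eLpNorm_lconv_le {f g : Plane → ℝ≥0∞} (hf : AEMeasurable f volume)
    (hg : AEMeasurable g volume) :
    eLpNorm (fun ξ => ∫⁻ η, f η * g (ξ - η)) 2 volume ≤ (∫⁻ η, f η) * eLpNorm g 2 volume := by
  have hgs : AEMeasurable (fun p : Plane × Plane => g (p.1 - p.2)) (volume.prod volume) :=
    hg.comp_quasiMeasurePreserving (quasiMeasurePreserving_sub volume volume)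
  have hgx : ∀ ξ : Plane, AEMeasurable (fun η => g (ξ - η)) volume := fun ξ =>
    hg.comp_quasiMeasurePreserving (Measure.measurePreserving_sub_left volume ξ).quasiMeasurePreserving
  have h1 : ∀ ξ, (∫⁻ η, f η * g (ξ - η)) ^ (2 : ℝ)
      ≤ (∫⁻ η, f η) * ∫⁻ η, f η * g (ξ - η) ^ (2 : ℝ) := by
    intro ξ
    -- Cauchy–Schwarz after splitting `f = f^{1/2} f^{1/2}`; Tonelli then gives the inequality of
    -- norms.
    have h := ENNReal.lintegral_mul_le_Lp_mul_Lq volume Real.HolderConjugate.two_two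
      (f := fun η => f η ^ (1 / 2 : ℝ)) (g := fun η => f η ^ (1 / 2 : ℝ) * g (ξ - η))
      (hf.pow_const _) ((hf.pow_const _).mul (hgx ξ))
    have e : ∀ x : ℝ≥0∞, x ^ (1 / 2 : ℝ) * x ^ (1 / 2 : ℝ) = x := fun x => by
      rw [← ENNReal.rpow_add_of_nonneg _ _ (by norm_num) (by norm_num)]; norm_num
    have e2 : ∀ x : ℝ≥0∞, (x ^ (1 / 2 : ℝ)) ^ (2 : ℝ) = x := fun x => by
      rw [← ENNReal.rpow_mul]; norm_num
    simp only [Pi.mul_apply, ← mul_assoc, e, ENNReal.mul_rpow_of_nonneg _ _ zero_le_two, e2] at h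
    refine (ENNReal.rpow_le_rpow h zero_le_two).trans_eq ?_
    rw [ENNReal.mul_rpow_of_nonneg _ _ zero_le_two, e2, e2]
  have h2 : ∫⁻ ξ, ∫⁻ η, f η * g (ξ - η) ^ (2 : ℝ) = (∫⁻ η, f η) * ∫⁻ ξ, g ξ ^ (2 : ℝ) := by
    rw [lintegral_lintegral_swap (hf.comp_snd.mul (hgs.pow_const _)), ← lintegral_mul_const'' _ hf]
    refine lintegral_congr fun η => ?_
    have hgy : AEMeasurable (fun ξ => g (ξ - η)) volume :=
      hg.comp_quasiMeasurePreserving (measurePreserving_sub_right volume η).quasiMeasurePreserving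
    rw [lintegral_const_mul'' _ (hgy.pow_const _)]
    congr 1
    exact lintegral_sub_right_eq_self (fun ξ => g ξ ^ (2 : ℝ)) η
  rw [eLpNorm_eq_lintegral_rpow_enorm_toReal (by norm_num) (by norm_num),
    eLpNorm_eq_lintegral_rpow_enorm_toReal (by norm_num) (by norm_num)]
  simp only [enorm_eq_self, ENNReal.toReal_ofNat]
  have h3 : ∫⁻ ξ, (∫⁻ η, f η * g (ξ - η)) ^ (2 : ℝ)
      ≤ (∫⁻ η, f η) ^ (2 : ℝ) * ∫⁻ ξ, g ξ ^ (2 : ℝ) := by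
    calc _ ≤ ∫⁻ ξ, (∫⁻ η, f η) * ∫⁻ η, f η * g (ξ - η) ^ (2 : ℝ) := lintegral_mono h1
      _ = (∫⁻ η, f η) * ∫⁻ ξ, ∫⁻ η, f η * g (ξ - η) ^ (2 : ℝ) :=
          lintegral_const_mul'' _
            (hf.comp_snd.mul (hgs.pow_const _)).lintegral_prod_right'
      _ = _ := by rw [h2, ← mul_assoc, ENNReal.rpow_two, sq]
  refine (ENNReal.rpow_le_rpow h3 (by norm_num)).trans_eq ?_
  rw [ENNReal.mul_rpow_of_nonneg _ _ (by norm_num), ← ENNReal.rpow_mul]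
  norm_num

/-- The convolution of transforms, with the constant of the transform of a product. -/
def hatConv (U V : Plane → ℂ) (ξ : Plane) : ℂ :=
  (((2 * Real.pi) ^ 2)⁻¹ : ℝ) * ∫ η, U η * V (ξ - η)

theorem enorm_hatConv_le (U V : Plane → ℂ) (ξ : Plane) :
    ‖hatConv U V ξ‖ₑ ≤ ∫⁻ η, ‖U η‖ₑ * ‖V (ξ - η)‖ₑ := by
  have h1 : ‖((((2 * Real.pi) ^ 2)⁻¹ : ℝ) : ℂ)‖ₑ ≤ 1 := by
    rw [← ofReal_norm, Complex.norm_real, Real.norm_of_nonneg (by positivity)]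
    apply ENNReal.ofReal_le_one.2
    apply inv_le_one_of_one_le₀
    nlinarith [Real.pi_gt_three]
  rw [hatConv, enorm_mul]
  calc _ ≤ 1 * ∫⁻ η, ‖U η * V (ξ - η)‖ₑ := mul_le_mul' h1 (enorm_integral_le_lintegral_enorm _)
    _ = _ := by simp only [one_mul, enorm_mul]

theorem memLp_hatConv {U V : Plane → ℂ} (hU : Integrable U volume) (hV : MemLp V 2 volume) :
    MemLp (hatConv U V) 2 volume := by
  have hm : AEStronglyMeasurable (fun p : Plane × Plane => U p.2 * V (p.1 - p.2))
      (volume.prod volume) :=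
    hU.1.comp_snd.mul
      (hV.1.comp_quasiMeasurePreserving (quasiMeasurePreserving_sub volume volume))
  refine ⟨hm.integral_prod_right'.const_mul _, ?_⟩
  have h1 : eLpNorm (hatConv U V) 2 volume
      ≤ eLpNorm (fun ξ => ∫⁻ η, ‖U η‖ₑ * ‖V (ξ - η)‖ₑ) 2 volume :=
    eLpNorm_mono_enorm fun ξ => by simpa using enorm_hatConv_le U V ξ
  refine h1.trans_lt ((eLpNorm_lconv_le hU.1.enorm hV.1.enorm).trans_lt ?_)
  refine ENNReal.mul_lt_top hU.2 ?_
  rw [eLpNorm_enorm]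
  exact hV.2

theorem memLp_chk (χ : 𝓢(Plane, ℂ)) : MemLp (chk χ) 2 volume := by
  have h : chk χ = fun ξ => (𝓕⁻ χ) ((2 * Real.pi)⁻¹ • ξ) := by
    ext ξ
    rw [chk_eq, SchwartzMap.fourierInv_coe]
  have hc : Continuous (chk χ) := by
    rw [h]
    exact (𝓕⁻ χ).continuous.comp (continuous_const_smul _)
  refine ⟨hc.aestronglyMeasurable, ?_⟩
  rw [h, eLpNorm_scale ((𝓕⁻ χ).memLp 2 volume).1]
  exact ENNReal.mul_lt_top ENNReal.ofReal_lt_top ((𝓕⁻ χ).memLp 2 volume).2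

/-- The convolution of the transforms is square integrable and conjugate symmetric, hence the
transform of some real `P`. Testing `P` and applying Fubini, with translation in frequency turned
into modulation by `e^{iη·z}`, gives `P = u v`. Integrability of `û` justifies the exchanges. -/
theorem l2Hat_mul {u v w : L2} (hu : Integrable (l2Hat u) volume)
    (hw : w =ᵐ[volume] fun z => u z * v z) :
    l2Hat w =ᵐ[volume] hatConv (l2Hat u) (l2Hat v) := by
  have hsym : ∀ᵐ ξ, hatConv (l2Hat u) (l2Hat v) (-ξ) = conj (hatConv (l2Hat u) (l2Hat v) ξ) := by
    refine Eventually.of_forall fun ξ => ?_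
    rw [hatConv, hatConv, map_mul, Complex.conj_ofReal, ← integral_conj, ← integral_neg_eq_self]
    congr 1
    refine integral_congr_ae ?_
    have hq : Measure.QuasiMeasurePreserving (fun η : Plane => ξ - η) volume volume :=
      (Measure.measurePreserving_sub_left volume ξ).quasiMeasurePreserving
    filter_upwards [l2Hat_neg u, hq.ae (l2Hat_neg v)] with η h1 h2
    rw [h1, map_mul, ← h2]
    congr 2
    abel
  obtain ⟨P, hP⟩ := exists_l2Hat_eq (memLp_hatConv hu (memLp_l2Hat v)) hsym
  suffices h : P = w by rw [← h]; exact hP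
  ext1
  refine EventuallyEq.trans ?_ hw.symm
  have hb : ∀ᵐ z, ‖u z‖ ≤ ∫ ξ, ‖l2Hat u ξ‖ := ae_abs_le_of_integrable hu
  have hPw : (fun z => (P z : ℂ)) =ᵐ[volume] fun z => (w z : ℂ) := by
    refine ae_eq_of_test (((Lp.memLp P).ofReal).locallyIntegrable (by norm_num))
      (((Lp.memLp w).ofReal).locallyIntegrable (by norm_num)) fun θ hθ => ?_
    obtain ⟨χ, hχ⟩ := isTest_complex hθ
    have hχ2 := memLp_chk χ
    have hvθ : Integrable (fun z => (v z : ℂ) * θ z) volume := by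
      have := (integrable_mul_cc (by norm_num) v hθ.1.continuous hθ.2).ofReal (𝕜 := ℂ)
      simpa using this
    have shift : ∀ η : Plane, ∫ ζ, l2Hat v ζ * chk χ (ζ + η)
        = ((2 * Real.pi) ^ 2 : ℝ) *
          ∫ z, Complex.exp (Complex.I * ((inner ℝ η z : ℝ) : ℂ)) * ((v z : ℂ) * θ z) := by
      intro η
      have h1 : ContDiff ℝ ∞ fun z : Plane =>
          Complex.exp (Complex.I * ((inner ℝ η z : ℝ) : ℂ)) * (θ z : ℂ) := by
        have : ContDiff ℝ ∞ fun z : Plane => ((inner ℝ η z : ℝ) : ℂ) :=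
          Complex.ofRealCLM.contDiff.comp (contDiff_const.inner ℝ contDiff_id)
        exact (contDiff_const.mul this).cexp.mul (Complex.ofRealCLM.contDiff.comp hθ.1)
      have h2 : HasCompactSupport fun z : Plane =>
          Complex.exp (Complex.I * ((inner ℝ η z : ℝ) : ℂ)) * (θ z : ℂ) := by
        have : HasCompactSupport (fun z => (θ z : ℂ)) :=
          hθ.2.comp_left (g := Complex.ofReal) Complex.ofReal_zero
        exact this.mul_left
      have h3 := l2Hat_pairing v (h2.toSchwartzMap h1)
      have h4 : ∀ ζ, chk (h2.toSchwartzMap h1) ζ = chk χ (ζ + η) := by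
        intro ζ
        rw [chk, chk]
        congr 1
        ext z
        change _ * (Complex.exp (Complex.I * ((inner ℝ η z : ℝ) : ℂ)) * (θ z : ℂ)) = _
        rw [hχ, inner_add_right, Complex.ofReal_add, mul_add, Complex.exp_add, real_inner_comm η z,
          mul_assoc]
      simp only [h4] at h3
      have h5 : ∫ z, (v z : ℂ) * (h2.toSchwartzMap h1) z
          = ∫ z, Complex.exp (Complex.I * ((inner ℝ η z : ℝ) : ℂ)) * ((v z : ℂ) * θ z) := by
        congr 1
        ext z
        change (v z : ℂ) * (Complex.exp (Complex.I * ((inner ℝ η z : ℝ) : ℂ)) * (θ z : ℂ)) = _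
        ring
      rw [← h5, h3, ← mul_assoc, ← Complex.ofReal_mul, mul_inv_cancel₀ (by positivity)]
      simp
    have F1 : Integrable (Function.uncurry fun (ξ η : Plane) =>
        l2Hat u η * l2Hat v (ξ - η) * chk χ ξ) (volume.prod volume) := by
      have i1 : Integrable (fun p : Plane × Plane => ‖l2Hat u p.2‖ * ‖l2Hat v (p.1 - p.2)‖ ^ 2)
          (volume.prod volume) :=
        hu.norm.convolution_integrand (ContinuousLinearMap.mul ℝ ℝ)
          ((memLp_two_iff_integrable_sq_norm (l2Hat_aesm v)).1 (memLp_l2Hat v))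
      have i2 : Integrable (fun p : Plane × Plane => ‖chk χ p.1‖ ^ 2 * ‖l2Hat u p.2‖)
          (volume.prod volume) :=
        ((memLp_two_iff_integrable_sq_norm hχ2.1).1 hχ2).mul_prod hu.norm
      refine (i1.add i2).mono' ?_ (Eventually.of_forall fun p => ?_)
      · exact (hu.1.comp_snd.mul ((l2Hat_aesm v).comp_quasiMeasurePreserving
          (quasiMeasurePreserving_sub volume volume))).mul hχ2.1.comp_fst
      · simp only [Function.uncurry, norm_mul, Pi.add_apply]
        nlinarith [mul_nonneg (norm_nonneg (l2Hat u p.2))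
            (sq_nonneg (‖l2Hat v (p.1 - p.2)‖ - ‖chk χ p.1‖)),
          mul_nonneg (norm_nonneg (l2Hat u p.2)) (sq_nonneg (‖l2Hat v (p.1 - p.2)‖)),
          mul_nonneg (norm_nonneg (l2Hat u p.2)) (sq_nonneg (‖chk χ p.1‖))]
    have F2 : Integrable (Function.uncurry fun (η z : Plane) => l2Hat u η *
        (Complex.exp (Complex.I * ((inner ℝ η z : ℝ) : ℂ)) * ((v z : ℂ) * θ z)))
        (volume.prod volume) := by
      have h1 := (hu.mul_prod hvθ).bdd_mul (c := 1) (f := fun p : Plane × Plane =>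
        Complex.exp (Complex.I * ((inner ℝ p.1 p.2 : ℝ) : ℂ))) (by fun_prop) (by
          refine Filter.Eventually.of_forall fun p => ?_
          rw [mul_comm, Complex.norm_exp_ofReal_mul_I])
      refine h1.congr (Filter.Eventually.of_forall fun p => ?_)
      simp only [Function.uncurry]
      ring
    have p1 := l2Hat_pairing P χ
    simp only [hχ] at p1
    rw [p1]
    have e1 : ∫ ξ, l2Hat P ξ * chk χ ξ
        = (((2 * Real.pi) ^ 2)⁻¹ : ℝ) * ∫ ξ, ∫ η, l2Hat u η * l2Hat v (ξ - η) * chk χ ξ := by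
      rw [← integral_const_mul]
      refine integral_congr_ae ?_
      filter_upwards [hP] with ξ hξ
      rw [hξ, hatConv, integral_mul_const]
      ring
    have e2 : ∫ ξ, ∫ η, l2Hat u η * l2Hat v (ξ - η) * chk χ ξ
        = ((2 * Real.pi) ^ 2 : ℝ) * ∫ η, ∫ z, l2Hat u η *
          (Complex.exp (Complex.I * ((inner ℝ η z : ℝ) : ℂ)) * ((v z : ℂ) * θ z)) := by
      rw [integral_integral_swap F1, ← integral_const_mul]
      congr 1
      ext η
      rw [integral_const_mul]
      have := shift η
      rw [← integral_add_right_eq_self _ η]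
      simp only [add_sub_cancel_right, mul_assoc]
      rw [integral_const_mul, this]
      ring
    have e3 : ∫ η, ∫ z, l2Hat u η *
          (Complex.exp (Complex.I * ((inner ℝ η z : ℝ) : ℂ)) * ((v z : ℂ) * θ z))
        = ((2 * Real.pi) ^ 2 : ℝ) * ∫ z, (w z : ℂ) * θ z := by
      rw [integral_integral_swap F2, ← integral_const_mul]
      refine integral_congr_ae ?_
      filter_upwards [hw, l2Hat_inversion hu] with z h1 h2
      have hne : (((2 * Real.pi) ^ 2 : ℝ) : ℂ) ≠ 0 := by
        exact_mod_cast (by positivity : ((2 * Real.pi) ^ 2 : ℝ) ≠ 0)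
      have h3 : ∫ η, l2Hat u η *
          (Complex.exp (Complex.I * ((inner ℝ η z : ℝ) : ℂ)) * ((v z : ℂ) * θ z))
          = chk (l2Hat u) z * ((v z : ℂ) * θ z) := by
        rw [chk, ← integral_mul_const]
        congr 1
        ext η
        ring
      rw [h3, h1, Complex.ofReal_mul, h2, Complex.ofReal_inv]
      field_simp
    rw [e1, e2, e3]
    have : (((2 * Real.pi) ^ 2)⁻¹ : ℝ) * ((2 * Real.pi) ^ 2) = 1 := inv_mul_cancel₀ (by positivity)
    have h3 : ((((2 * Real.pi) ^ 2)⁻¹ : ℝ) : ℂ) * (((2 * Real.pi) ^ 2 : ℝ) : ℂ) = 1 := by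
      exact_mod_cast this
    linear_combination (((((2 * Real.pi) ^ 2)⁻¹ : ℝ) : ℂ) * (((2 * Real.pi) ^ 2 : ℝ) : ℂ) + 1) *
      (∫ z, (w z : ℂ) * θ z) * h3
  filter_upwards [hPw, hw] with z h1 h2
  rw [← h2]
  exact_mod_cast h1

theorem memLp_mul_of_integrable {u : L2} (hu : Integrable (l2Hat u) volume) (v : L2) :
    MemLp (fun z => u z * v z) 2 volume := by
  refine (Lp.memLp v).of_le_mul (c := ∫ ξ, ‖l2Hat u ξ‖)
    ((Lp.aestronglyMeasurable u).mul (Lp.aestronglyMeasurable v)) ?_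
  filter_upwards [ae_abs_le_of_integrable hu] with z hz
  rw [norm_mul]
  exact mul_le_mul_of_nonneg_right hz (norm_nonneg _)

theorem jw_anti {a : ℝ} (ha : a ≤ 0) {ξ η : Plane} (h : ‖ξ‖ ≤ ‖η‖) : jw a η ≤ jw a ξ :=
  Real.rpow_le_rpow_of_nonpos (by positivity)
    (by nlinarith [norm_nonneg ξ]) (by linarith)

theorem jw_add_le {c : ℝ} (hc : 0 ≤ c) {η ζ : Plane} (h : ‖η‖ ≤ ‖ζ‖) :
    jw c (η + ζ) ≤ 2 ^ c * jw c ζ := by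
  have h1 : ‖η + ζ‖ ≤ 2 * ‖ζ‖ := (norm_add_le _ _).trans (by linarith)
  have h2 : (1 + ‖η + ζ‖ ^ 2) ≤ 2 ^ 2 * (1 + ‖ζ‖ ^ 2) := by
    nlinarith [norm_nonneg (η + ζ), norm_nonneg ζ]
  calc jw c (η + ζ) ≤ ((2 : ℝ) ^ 2 * (1 + ‖ζ‖ ^ 2)) ^ (c / 2) :=
        Real.rpow_le_rpow (by positivity) h2 (by linarith)
    _ = _ := by
        rw [Real.mul_rpow (by positivity) (by positivity), ← Real.rpow_natCast,
          ← Real.rpow_mul (by norm_num), jw]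
        congr 2
        push_cast
        ring

/-- The larger of `|η|` and `|ξ - η|` is at least `|ξ| / 2`, so its factor absorbs the weight at `ξ`
and keeps a nonpositive exponent `c - a` or `c - b`. That power only grows when moved to the smaller
frequency, which then carries the whole exponent `-(a + b - c)`. -/
theorem jw_split {a b c : ℝ} (hc : 0 ≤ c) (hca : c ≤ a) (hcb : c ≤ b) (ξ η : Plane) :
    jw c ξ * (jw (-a) η * jw (-b) (ξ - η))
      ≤ 2 ^ c * (jw (-(a + b - c)) η + jw (-(a + b - c)) (ξ - η)) := by
  have key : ∀ (a b : ℝ) (η ζ : Plane), c ≤ a → c ≤ b → ‖η‖ ≤ ‖ζ‖ →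
      jw c (η + ζ) * (jw (-a) η * jw (-b) ζ) ≤ 2 ^ c * jw (-(a + b - c)) η := by
    intro a b η ζ ha hb h
    calc _ ≤ 2 ^ c * jw c ζ * (jw (-a) η * jw (-b) ζ) :=
          mul_le_mul_of_nonneg_right (jw_add_le hc h) (mul_pos (jw_pos _ _) (jw_pos _ _)).le
      _ = 2 ^ c * (jw (-a) η * jw (c - b) ζ) := by rw [sub_eq_add_neg, jw_add]; ring
      _ ≤ 2 ^ c * (jw (-a) η * jw (c - b) η) :=
          mul_le_mul_of_nonneg_left (mul_le_mul_of_nonneg_left (jw_anti (by linarith) h)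
            (jw_pos _ _).le) (by positivity)
      _ = _ := by rw [← jw_add]; congr 2; ring
  have h1 := jw_pos (-(a + b - c)) η
  have h2 := jw_pos (-(a + b - c)) (ξ - η)
  have h3 : (0 : ℝ) < 2 ^ c := by positivity
  rcases le_total ‖η‖ ‖ξ - η‖ with h | h
  · have := key a b η (ξ - η) hca hcb h
    rw [add_sub_cancel] at this
    nlinarith
  · have := key b a (ξ - η) η hcb hca h
    rw [sub_add_cancel, add_comm b a, mul_comm (jw (-b) (ξ - η))] at this
    nlinarith

theorem lintegral_jw_mul_le {κ : ℝ} (hκ : 1 < κ) (h : L2) :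
    ∫⁻ ξ, ENNReal.ofReal (jw (-κ) ξ) * ‖l2Hat h ξ‖ₑ
      ≤ eLpNorm (fun ξ => jw (-κ) ξ) 2 volume * eLpNorm (l2Hat h) 2 volume := by
  have h1 : eLpNorm ((fun ξ => jw (-κ) ξ) • l2Hat h) 1 volume
      ≤ eLpNorm (fun ξ => jw (-κ) ξ) 2 volume * eLpNorm (l2Hat h) 2 volume :=
    eLpNorm_smul_le_mul_eLpNorm (l2Hat_aesm h) (memLp_jw hκ).1
  rw [eLpNorm_one_eq_lintegral_enorm] at h1
  refine le_trans (le_of_eq ?_) h1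
  refine lintegral_congr fun ξ => ?_
  rw [Pi.smul_apply', enorm_smul, ← ofReal_norm (jw (-κ) ξ), Real.norm_of_nonneg (jw_pos _ _).le]

/-- The product estimate `H^a · H^b ⊆ H^c`. -/
theorem exists_mul_bound {a b c : ℝ} (hc : 0 ≤ c) (hca : c ≤ a) (hcb : c ≤ b)
    (habc : 1 < a + b - c) :
    ∃ C : ℝ, 0 ≤ C ∧ ∀ h k : L2, Integrable (l2Hat (bes a h)) volume →
      ∃ l : L2, bes c l =ᵐ[volume] (fun z => bes a h z * bes b k z) ∧ ‖l‖ ≤ C * ‖h‖ * ‖k‖ := by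
  set κ := a + b - c with hκ
  have hK := memLp_jw habc
  set K := eLpNorm (fun ξ => jw (-κ) ξ) 2 (volume : Measure Plane) with hKdef
  -- `2 ^ c` comes from `jw_split`, `2 K` from two convolutions estimated by Cauchy–Schwarz, and
  -- `2π` is left over from the three uses of Plancherel.
  refine ⟨2 ^ c * (2 * K.toReal) * (2 * Real.pi), by positivity, fun h k hint => ?_⟩
  have hm := memLp_mul_of_integrable hint (bes b k)
  set w : L2 := hm.toLp with hw
  have hwe := hm.coeFn_toLp
  have hhat := l2Hat_mul hint hwe
  set A : Plane → ℝ≥0∞ := fun ξ => ‖l2Hat h ξ‖ₑ with hA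
  set B : Plane → ℝ≥0∞ := fun ξ => ‖l2Hat k ξ‖ₑ with hB
  set κA : Plane → ℝ≥0∞ := fun ξ => ENNReal.ofReal (jw (-κ) ξ) * A ξ with hκA
  set κB : Plane → ℝ≥0∞ := fun ξ => ENNReal.ofReal (jw (-κ) ξ) * B ξ with hκB
  have mA : AEMeasurable A volume := (l2Hat_aesm h).enorm
  have mB : AEMeasurable B volume := (l2Hat_aesm k).enorm
  have mj : Measurable fun ξ => ENNReal.ofReal (jw (-κ) ξ) := (jw_measurable _).ennreal_ofReal
  have mκA : AEMeasurable κA volume := mj.aemeasurable.mul mA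
  have mκB : AEMeasurable κB volume := mj.aemeasurable.mul mB
  -- In each of the two convolutions one factor carries the weight of exponent `-κ` with `κ > 1`. It
  -- is therefore in `L¹`, and Young's inequality applies.
  have hpt : ∀ᵐ ξ, ‖(jw c ξ : ℂ) * l2Hat w ξ‖ₑ ≤ ENNReal.ofReal (2 ^ c) *
      ((∫⁻ η, κA η * B (ξ - η)) + ∫⁻ η, κB η * A (ξ - η)) := by
    filter_upwards [hhat] with ξ hξ
    have hq : Measure.QuasiMeasurePreserving (fun η : Plane => ξ - η) volume volume :=
      (Measure.measurePreserving_sub_left volume ξ).quasiMeasurePreserving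
    have e1 : ∫⁻ η, κB η * A (ξ - η) = ∫⁻ η, A η * κB (ξ - η) := by
      rw [← lintegral_sub_left_eq_self (fun η => κB η * A (ξ - η)) ξ]
      simp [mul_comm]
    have mB' : AEMeasurable (fun η => B (ξ - η)) volume := mB.comp_quasiMeasurePreserving hq
    have e2 := lintegral_add_left' (mκA.mul mB') (fun η => A η * κB (ξ - η))
    simp only [Pi.mul_apply] at e2
    rw [e1, ← e2, hξ, enorm_mul, ← lintegral_const_mul' _ _ ENNReal.ofReal_ne_top]
    refine (mul_le_mul_right (enorm_hatConv_le _ _ ξ) _).trans ?_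
    rw [← lintegral_const_mul' _ _ (by simp)]
    refine lintegral_mono_ae ?_
    filter_upwards [l2Hat_bes (hc.trans hca) h, hq.ae (l2Hat_bes (hc.trans hcb) k)] with η h1 h2
    rw [h1, h2, enorm_mul, enorm_mul]
    have en : ∀ t ζ, ‖((jw t ζ : ℝ) : ℂ)‖ₑ = ENNReal.ofReal (jw t ζ) := fun t ζ => by
      rw [← ofReal_norm, Complex.norm_real, Real.norm_of_nonneg (jw_pos _ _).le]
    rw [en, en, en]
    have hs := ENNReal.ofReal_le_ofReal (jw_split hc hca hcb ξ η)
    rw [ENNReal.ofReal_mul (jw_pos _ _).le, ENNReal.ofReal_mul (jw_pos _ _).le,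
      ENNReal.ofReal_mul (by positivity), ENNReal.ofReal_add (jw_pos _ _).le (jw_pos _ _).le] at hs
    calc _ = ENNReal.ofReal (jw c ξ) * (ENNReal.ofReal (jw (-a) η) *
            ENNReal.ofReal (jw (-b) (ξ - η))) * (A η * B (ξ - η)) := by ring
      _ ≤ _ := mul_le_mul_left hs _
      _ = _ := by simp only [hκA, hκB, hκ]; ring
  have mc : ∀ f g : Plane → ℝ≥0∞, AEMeasurable f volume → AEMeasurable g volume →
      AEStronglyMeasurable (fun ξ => ∫⁻ η, f η * g (ξ - η)) volume := fun f g hf hg =>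
    (AEMeasurable.lintegral_prod_right' (hf.comp_snd.mul (hg.comp_quasiMeasurePreserving
      (quasiMeasurePreserving_sub volume volume)))).aestronglyMeasurable
  have hN : sobolevNorm c w ≤ ENNReal.ofReal (2 ^ c) * (2 * K) *
      (eLpNorm (l2Hat h) 2 volume * eLpNorm (l2Hat k) 2 volume) := by
    rw [sobolevNorm_eq]
    have s1 : eLpNorm (fun ξ => (jw c ξ : ℂ) * l2Hat w ξ) 2 volume
        ≤ ENNReal.ofReal (2 ^ c) * eLpNorm (fun ξ => (∫⁻ η, κA η * B (ξ - η))
          + ∫⁻ η, κB η * A (ξ - η)) 2 volume := by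
      refine eLpNorm_le_mul_eLpNorm_of_ae_le_mul'' 2 ?_ ?_
      · exact (mc _ _ mκA mB).add (mc _ _ mκB mA)
      · filter_upwards [hpt] with ξ hξ
        simpa using hξ
    refine s1.trans ?_
    have s2 := eLpNorm_add_le (p := 2) (mc _ _ mκA mB) (mc _ _ mκB mA) (by norm_num)
    have s3 := eLpNorm_lconv_le mκA mB
    have s4 := eLpNorm_lconv_le mκB mA
    have s5 := lintegral_jw_mul_le habc h
    have s6 := lintegral_jw_mul_le habc k
    have eA : eLpNorm A 2 volume = eLpNorm (l2Hat h) 2 volume := eLpNorm_enorm _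
    have eB : eLpNorm B 2 volume = eLpNorm (l2Hat k) 2 volume := eLpNorm_enorm _
    rw [eB] at s3
    rw [eA] at s4
    calc _ ≤ ENNReal.ofReal (2 ^ c) * (K * eLpNorm (l2Hat h) 2 volume * eLpNorm (l2Hat k) 2 volume
            + K * eLpNorm (l2Hat k) 2 volume * eLpNorm (l2Hat h) 2 volume) := by
          refine mul_le_mul_right (s2.trans (add_le_add (s3.trans ?_) (s4.trans ?_))) _
          · exact mul_le_mul_left s5 _
          · exact mul_le_mul_left s6 _
      _ = _ := by ring
  have hfin : ENNReal.ofReal (2 ^ c) * (2 * K) *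
      (eLpNorm (l2Hat h) 2 volume * eLpNorm (l2Hat k) 2 volume) ≠ ⊤ :=
    ENNReal.mul_ne_top (ENNReal.mul_ne_top ENNReal.ofReal_ne_top
      (ENNReal.mul_ne_top (by norm_num) hK.2.ne))
      (ENNReal.mul_ne_top (memLp_l2Hat h).2.ne (memLp_l2Hat k).2.ne)
  obtain ⟨l, hl⟩ := exists_bes_eq hc (hN.trans_lt hfin.lt_top)
  refine ⟨l, by rw [hl]; exact hwe, ?_⟩
  have hr := ENNReal.toReal_mono hfin hN
  rw [← hl, sobolevNorm_bes hc, eLpNorm_l2Hat, eLpNorm_l2Hat] at hr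
  simp only [ENNReal.toReal_mul, toReal_enorm, ENNReal.toReal_ofNat] at hr
  rw [ENNReal.toReal_ofReal (by positivity), ENNReal.toReal_ofReal (by positivity)] at hr
  have hpi : (0 : ℝ) < 2 * Real.pi := by positivity
  refine le_of_mul_le_mul_left (hr.trans_eq ?_) hpi
  ring

/-! ### Band-limited functions -/

/-- The symbol `(1 + |ξ|²)^{a/2}` cut off at `(1 + |ξ|²)^{1/2} = lam`. -/
def csymb (lam a : ℝ) (ξ : Plane) : ℂ := if jw 1 ξ ≤ lam then (jw a ξ : ℂ) else 0

theorem jw_eq_rpow (a : ℝ) (ξ : Plane) : jw a ξ = jw 1 ξ ^ a := by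
  rw [jw, jw, ← Real.rpow_mul (by positivity)]
  ring_nf

theorem jw_one_ge (ξ : Plane) : 1 ≤ jw 1 ξ := one_le_jw zero_le_one ξ

theorem isSymb_csymb (lam a : ℝ) : IsSymb (csymb lam a) := by
  refine ⟨?_, ⟨|lam| ^ |a|, fun ξ => ?_⟩, fun ξ => ?_⟩
  · exact Measurable.ite (measurableSet_le (jw_measurable 1) measurable_const)
      (Complex.measurable_ofReal.comp (jw_measurable a)) measurable_const
  · rw [csymb]
    split_ifs with h
    · rw [Complex.norm_real, Real.norm_of_nonneg (jw_pos _ _).le]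
      calc jw a ξ ≤ jw |a| ξ := jw_mono (le_abs_self a) ξ
        _ = jw 1 ξ ^ |a| := jw_eq_rpow _ _
        _ ≤ |lam| ^ |a| :=
          Real.rpow_le_rpow (jw_pos _ _).le (h.trans (le_abs_self lam)) (abs_nonneg a)
    · rw [norm_zero]
      positivity
  · rw [csymb, csymb, jw_neg, jw_neg]
    split_ifs <;> simp

/-- Band-limited functions. -/
def BandLim (lam : ℝ) (k : L2) : Prop := ∀ᵐ ξ, lam < jw 1 ξ → l2Hat k ξ = 0

theorem bandLim_csymb (lam a : ℝ) (h : L2) : BandLim lam (op (csymb lam a) h) := by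
  filter_upwards [l2Hat_op (isSymb_csymb lam a) h] with ξ hξ hl
  rw [hξ, csymb, if_neg (not_le.2 hl), zero_mul]

theorem BandLim.op {lam : ℝ} {k : L2} (hk : BandLim lam k) {m : Plane → ℂ} (hm : IsSymb m) :
    BandLim lam (op m k) := by
  filter_upwards [l2Hat_op hm k, hk] with ξ h1 h2 hl
  rw [h1, h2 hl, mul_zero]

theorem BandLim.integrable {lam : ℝ} {k : L2} (hk : BandLim lam k) :
    Integrable (l2Hat k) volume := by
  have h1 : IntegrableOn (l2Hat k) (Metric.closedBall 0 lam) volume := by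
    have : IsFiniteMeasure (volume.restrict (Metric.closedBall (0 : Plane) lam)) :=
      ⟨by
        rw [Measure.restrict_apply_univ]
        exact measure_closedBall_lt_top (x := (0 : Plane)) (r := lam)⟩
    exact ((memLp_l2Hat k).restrict _).integrable (by norm_num)
  refine (integrable_indicator_iff Metric.isClosed_closedBall.measurableSet).2 h1 |>.congr ?_
  filter_upwards [hk] with ξ hξ
  by_cases h : ξ ∈ Metric.closedBall (0 : Plane) lam
  · rw [Set.indicator_of_mem h]
  · rw [Set.indicator_of_notMem h, hξ]
    rw [mem_closedBall_zero_iff, not_le] at h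
    exact h.trans_le (norm_le_jw_one ξ)

theorem BandLim.integrable_pow {lam : ℝ} {k : L2} (hk : BandLim lam k) (n : ℕ) :
    Integrable (fun ξ => ‖ξ‖ ^ n * ‖l2Hat k ξ‖) volume := by
  refine (hk.integrable.norm.const_mul (|lam| ^ n)).mono'
    ((continuous_norm.pow n).aestronglyMeasurable.mul (l2Hat_aesm k).norm) ?_
  filter_upwards [hk] with ξ hξ
  rw [Real.norm_of_nonneg (by positivity)]
  by_cases h : lam < jw 1 ξ
  · rw [hξ h, norm_zero, mul_zero, mul_zero]
  · refine mul_le_mul_of_nonneg_right (pow_le_pow_left₀ (norm_nonneg _) ?_ n) (norm_nonneg _)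
    exact (norm_le_jw_one ξ).trans ((not_lt.1 h).trans (le_abs_self lam))

theorem chk_eq_fourier (θ : Plane → ℂ) :
    chk θ = fun z => 𝓕 θ (-((2 * Real.pi)⁻¹ • z)) := by
  ext z
  rw [chk_eq, Real.fourierInv_eq_fourier_neg]

theorem contDiff_chk {θ : Plane → ℂ} (h : ∀ n : ℕ, Integrable (fun ξ => ‖ξ‖ ^ n * ‖θ ξ‖) volume) :
    ContDiff ℝ ∞ (chk θ) := by
  rw [chk_eq_fourier]
  have h1 : ContDiff ℝ ∞ (𝓕 θ) := Real.contDiff_fourier (N := ⊤) fun n _ => h n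
  exact h1.comp (contDiff_const_smul _).neg

theorem fderiv_chk {θ : Plane → ℂ} (h0 : Integrable θ volume)
    (h1 : Integrable (fun ξ => ‖ξ‖ * ‖θ ξ‖) volume) (z : Plane) (i : Fin 2) :
    fderiv ℝ (chk θ) z (EuclideanSpace.single i 1)
      = chk (fun ξ => Complex.I * (ξ i : ℂ) * θ ξ) z := by
  have hA : HasFDerivAt (fun z : Plane => -((2 * Real.pi)⁻¹ • z))
      (-((2 * Real.pi)⁻¹ • ContinuousLinearMap.id ℝ Plane)) z :=
    ((hasFDerivAt_id z).const_smul ((2 * Real.pi)⁻¹)).neg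
  have hm : AEStronglyMeasurable
      (VectorFourier.fourierSMulRight (innerSL ℝ) θ : Plane → Plane →L[ℝ] ℂ) volume :=
    h0.1.fourierSMulRight
  have hi : Integrable (VectorFourier.fourierSMulRight (innerSL ℝ) θ : Plane → Plane →L[ℝ] ℂ)
      volume := by
    refine (h1.const_mul (2 * Real.pi * ‖(innerSL ℝ : Plane →L[ℝ] Plane →L[ℝ] ℝ)‖)).mono' hm
      (Eventually.of_forall fun ξ => ?_)
    refine (VectorFourier.norm_fourierSMulRight_le (innerSL ℝ) θ ξ).trans_eq (by ring)
  have hF := Real.hasFDerivAt_fourier h0 h1 (-((2 * Real.pi)⁻¹ • z))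
  have hc := (hF.comp z hA).fderiv
  rw [Function.comp_def] at hc
  rw [chk_eq_fourier, hc, ContinuousLinearMap.comp_apply]
  rw [Real.fourier_continuousLinearMap_apply hi, Real.fourier_eq', chk]
  refine integral_congr_ae (Eventually.of_forall fun ξ => ?_)
  have : (Real.pi : ℂ) ≠ 0 := by exact_mod_cast Real.pi_ne_zero
  simp only [VectorFourier.fourierSMulRight_apply, neg_apply, smul_apply,
    ContinuousLinearMap.id_apply, smul_eq_mul, inner_neg_right,
    inner_smul_right, Complex.real_smul, real_inner_comm z ξ]
  push_cast
  have e : (-2 * (Real.pi : ℂ) * -((2 * (Real.pi : ℂ))⁻¹ * ((inner ℝ z ξ : ℝ) : ℂ)) * Complex.I)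
      = Complex.I * ((inner ℝ z ξ : ℝ) : ℂ) := by
    field_simp
  have hin : innerSL ℝ ξ (-((2 * Real.pi)⁻¹ • EuclideanSpace.single i (1 : ℝ)))
      = -((2 * Real.pi)⁻¹ * ξ i) := by
    change inner ℝ ξ _ = _
    simp [inner_smul_right, EuclideanSpace.inner_single_right]
  rw [e, hin]
  push_cast
  field_simp

/-- The smooth representative of a band-limited function. -/
def rep (k : L2) (z : Plane) : ℝ := ((2 * Real.pi) ^ 2)⁻¹ * (chk (l2Hat k) z).re

theorem BandLim.rep_ae {lam : ℝ} {k : L2} (hk : BandLim lam k) : rep k =ᵐ[volume] k := by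
  filter_upwards [l2Hat_inversion hk.integrable] with z hz
  have := congrArg Complex.re hz
  rw [Complex.re_ofReal_mul, Complex.ofReal_re] at this
  rw [this, rep]

theorem BandLim.contDiff_rep {lam : ℝ} {k : L2} (hk : BandLim lam k) : ContDiff ℝ ∞ (rep k) :=
  contDiff_const.mul (Complex.reCLM.contDiff.comp (contDiff_chk hk.integrable_pow))

theorem BandLim.pderiv_rep {lam : ℝ} {k g : L2} (hk : BandLim lam k) {i : Fin 2}
    (h : HasD i k g) : pderiv i (rep k) = rep g := by
  ext z
  have hd : HasFDerivAt (chk (l2Hat k)) (fderiv ℝ (chk (l2Hat k)) z) z :=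
    ((contDiff_chk hk.integrable_pow).differentiable (by simp)).differentiableAt.hasFDerivAt
  have h1 : HasFDerivAt (rep k)
      ((((2 * Real.pi) ^ 2)⁻¹ : ℝ) • Complex.reCLM.comp (fderiv ℝ (chk (l2Hat k)) z)) z :=
    (Complex.reCLM.hasFDerivAt.comp z hd).const_mul (((2 * Real.pi) ^ 2)⁻¹)
  rw [pderiv, h1.fderiv, rep]
  simp only [smul_apply, ContinuousLinearMap.comp_apply, smul_eq_mul]
  rw [fderiv_chk hk.integrable (by simpa using hk.integrable_pow 1)]
  have e : chk (fun ξ => Complex.I * (ξ i : ℂ) * l2Hat k ξ) z = chk (l2Hat g) z := by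
    refine integral_congr_ae ?_
    filter_upwards [h] with ξ hξ
    rw [hξ]
  rw [e]
  rfl

theorem hasD_csymb (lam a : ℝ) (i : Fin 2) (h : L2) :
    HasD i (op (csymb lam a) h) (dop i (op (csymb lam (a + 1)) h)) := by
  filter_upwards [l2Hat_op (isSymb_csymb lam a) h, l2Hat_op (isSymb_csymb lam (a + 1)) h,
    l2Hat_op (isSymb_dsymb i le_rfl) (op (csymb lam (a + 1)) h)] with ξ h1 h2 h3
  rw [dop, h3, h2, h1, csymb, csymb, dsymb]
  split_ifs with hl
  · have : jw a ξ = jw (-1) ξ * jw (a + 1) ξ := by rw [← jw_add]; congr 1; ring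
    rw [this]
    push_cast
    ring
  · simp

theorem HasD.dop {i : Fin 2} {f g : L2} (h : HasD i f g) (j : Fin 2) :
    HasD i (dop j f) (dop j g) := by
  filter_upwards [h, l2Hat_op (isSymb_dsymb j le_rfl) f, l2Hat_op (isSymb_dsymb j le_rfl) g]
    with ξ h1 h2 h3
  rw [AntiPlane.dop, h2, h3, h1]
  ring

/-- The partial derivative of a function of two variables. -/
def pd (j : Fin 2) (G : (Fin 2 → ℝ) → ℝ) (p : Fin 2 → ℝ) : ℝ := fderiv ℝ G p (Pi.single j 1)

theorem contDiff_pd {n : ℕ} {G : (Fin 2 → ℝ) → ℝ} (hG : ContDiff ℝ (n + 1 : ℕ) G) (j : Fin 2) :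
    ContDiff ℝ n (pd j G) :=
  (hG.fderiv_right (m := n) (by push_cast; rfl)).clm_apply contDiff_const

theorem pderiv_comp {G : (Fin 2 → ℝ) → ℝ} (hG : ContDiff ℝ 1 G) {V : Fin 2 → Plane → ℝ}
    (hV : ∀ j, ContDiff ℝ 1 (V j)) (i : Fin 2) (z : Plane) :
    pderiv i (fun z => G fun j => V j z) z
      = ∑ j, pd j G (fun j => V j z) * pderiv i (V j) z := by
  have h1 : HasFDerivAt (fun z j => V j z) (ContinuousLinearMap.pi fun j => fderiv ℝ (V j) z) z :=
    hasFDerivAt_pi.2 fun j => ((hV j).differentiable (by simp)).differentiableAt.hasFDerivAt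
  have h2 : HasFDerivAt G (fderiv ℝ G fun j => V j z) (fun j => V j z) :=
    (hG.differentiable (by simp)).differentiableAt.hasFDerivAt
  have h3 := (h2.comp z h1).fderiv
  rw [Function.comp_def] at h3
  rw [pderiv, h3, ContinuousLinearMap.comp_apply]
  have h4 : (ContinuousLinearMap.pi fun j => fderiv ℝ (V j) z) (EuclideanSpace.single i 1)
      = ∑ j, pderiv i (V j) z • Pi.single j (1 : ℝ) := by
    rw [Fin.sum_univ_two]
    ext j
    fin_cases j <;> simp [pderiv]
  rw [h4, map_sum]
  refine Finset.sum_congr rfl fun j _ => ?_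
  rw [map_smul, smul_eq_mul, mul_comm, pd]

/-- Multiplication by a bounded function. -/
theorem exists_bdd_mul {m : Plane → ℝ} (hm : AEStronglyMeasurable m volume) {M : ℝ}
    (hM : ∀ᵐ z, |m z| ≤ M) (u : L2) :
    ∃ w : L2, w =ᵐ[volume] (fun z => m z * u z) ∧ ‖w‖ ≤ M * ‖u‖ := by
  have hmem : MemLp (fun z => m z * u z) 2 volume := by
    refine (Lp.memLp u).of_le_mul (c := M) (hm.mul (Lp.aestronglyMeasurable u)) ?_
    filter_upwards [hM] with z hz
    rw [norm_mul]
    exact mul_le_mul_of_nonneg_right hz (norm_nonneg _)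
  refine ⟨hmem.toLp, hmem.coeFn_toLp, Lp.norm_le_mul_norm_of_ae_le_mul ?_⟩
  filter_upwards [hM, hmem.coeFn_toLp] with z hz h
  rw [h, norm_mul]
  exact mul_le_mul_of_nonneg_right hz (norm_nonneg _)

theorem exists_bound_ball {G : (Fin 2 → ℝ) → ℝ} (hG : Continuous G) (R : ℝ) :
    ∃ M : ℝ, 0 ≤ M ∧ ∀ p : Fin 2 → ℝ, ‖p‖ ≤ R → |G p| ≤ M := by
  obtain ⟨C, hC⟩ := (isCompact_closedBall (0 : Fin 2 → ℝ) R).exists_bound_of_continuousOn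
    hG.continuousOn
  exact ⟨max C 0, le_max_right _ _, fun p hp => (hC p (by simpa using hp)).trans (le_max_left _ _)⟩

/-- The chain rule for band-limited functions. -/
theorem hasD_cmp_bandLim {G : (Fin 2 → ℝ) → ℝ} (hG : ContDiff ℝ 1 G) (h0 : G 0 = 0) {R lam : ℝ}
    {v : Fin 2 → L2} (hv : ∀ j, BandLim lam (v j)) (hR : BddAE v R) {i : Fin 2} {d : Fin 2 → L2}
    (hd : ∀ j, HasD i (v j) (d j)) (hdb : ∀ j, BandLim lam (d j)) {g : L2}
    (hg : g =ᵐ[volume] fun z => ∑ j, pd j G (fun l => v l z) * d j z) :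
    HasD i (cmp G v) g := by
  obtain ⟨L, hL0, hL⟩ := exists_lipBall hG R
  have hm := memLp_comp hG.continuous h0 hL hL0 hR
  have hV : ∀ j, ContDiff ℝ 1 (rep (v j)) := fun j => (hv j).contDiff_rep.of_le (by simp)
  have hvz : ∀ᵐ z, (fun l => rep (v l) z) = fun l => v l z := by
    filter_upwards [(hv 0).rep_ae, (hv 1).rep_ae] with z h0 h1
    ext l
    fin_cases l
    · exact h0
    · exact h1
  have hf : ContDiff ℝ 1 (fun z => G fun j => rep (v j) z) := hG.comp (contDiff_pi.2 hV)
  have e0 : (fun z => G fun j => rep (v j) z) =ᵐ[volume] fun z => G fun j => v j z := by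
    filter_upwards [hvz] with z hz
    rw [hz]
  have e1 : pderiv i (fun z => G fun j => rep (v j) z) =ᵐ[volume] g := by
    filter_upwards [hvz, hg, (hdb 0).rep_ae, (hdb 1).rep_ae] with z h1 h2 h3 h4
    rw [pderiv_comp hG hV, h1, h2, Fin.sum_univ_two, Fin.sum_univ_two,
      (hv 0).pderiv_rep (hd 0), (hv 1).pderiv_rep (hd 1), h3, h4]
  have m0 : MemLp (fun z => G fun j => rep (v j) z) 2 volume := hm.ae_eq e0.symm
  have m1 : MemLp (pderiv i fun z => G fun j => rep (v j) z) 2 volume := (Lp.memLp g).ae_eq e1.symm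
  have := hasD_of_contDiff hf m0 m1
  have a0 : m0.toLp = cmp G v := by
    ext1
    exact (m0.coeFn_toLp.trans e0).trans (cmp_coe hm).symm
  have a1 : m1.toLp = g := by
    ext1
    exact m1.coeFn_toLp.trans e1
  rwa [a0, a1] at this

/-! ### Superposition operators on `H^σ`, `1 < σ < 2` -/

theorem lintegral_l2Hat_sq (u : L2) :
    ∫⁻ ξ, ‖l2Hat u ξ‖ₑ ^ 2 = ENNReal.ofReal (2 * Real.pi) ^ 2 * ‖u‖ₑ ^ 2 := by
  have h := eLpNorm_nnreal_pow_eq_lintegral (f := l2Hat u) (μ := volume) (p := 2) (by norm_num)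
  have e := eLpNorm_l2Hat u
  rw [← mul_pow, ← e]
  simpa using h.symm

theorem sq_add_le (a b : ℝ≥0∞) : (a + b) ^ 2 ≤ 2 * (a ^ 2 + b ^ 2) := by
  have h := ENNReal.rpow_add_le_mul_rpow_add_rpow a b (p := 2) (by norm_num)
  have e : (2 : ℝ) - 1 = 1 := by norm_num
  rw [e] at h
  simpa using h

theorem hasD_of_rep {i : Fin 2} {f : Plane → ℝ} (hf : ContDiff ℝ 1 f) {a b : L2}
    (ha : a =ᵐ[volume] f) (hb : b =ᵐ[volume] pderiv i f) : HasD i a b := by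
  have m0 : MemLp f 2 volume := (Lp.memLp a).ae_eq ha
  have m1 : MemLp (pderiv i f) 2 volume := (Lp.memLp b).ae_eq hb
  have := hasD_of_contDiff hf m0 m1
  have a0 : m0.toLp = a := by
    ext1
    exact m0.coeFn_toLp.trans ha.symm
  have a1 : m1.toLp = b := by
    ext1
    exact m1.coeFn_toLp.trans hb.symm
  rwa [a0, a1] at this

theorem pderiv_mul {f g : Plane → ℝ} (hf : ContDiff ℝ 1 f) (hg : ContDiff ℝ 1 g) (i : Fin 2)
    (z : Plane) :
    pderiv i (fun z => f z * g z) z = f z * pderiv i g z + g z * pderiv i f z := by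
  have h := ((hf.differentiable (by simp)).differentiableAt (x := z)).hasFDerivAt.mul
    ((hg.differentiable (by simp)).differentiableAt (x := z)).hasFDerivAt
  change fderiv ℝ (f * g) z _ = _
  rw [h.fderiv]
  simp [pderiv]

theorem pderiv_add {f g : Plane → ℝ} (hf : ContDiff ℝ 1 f) (hg : ContDiff ℝ 1 g) (i : Fin 2)
    (z : Plane) : pderiv i (fun z => f z + g z) z = pderiv i f z + pderiv i g z := by
  have h := ((hf.differentiable (by simp)).differentiableAt (x := z)).hasFDerivAt.add
    ((hg.differentiable (by simp)).differentiableAt (x := z)).hasFDerivAt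
  change fderiv ℝ (f + g) z _ = _
  rw [h.fderiv]
  simp [pderiv]

theorem bes_csymb {a : ℝ} (ha : 0 ≤ a) (lam b : ℝ) (h : L2) :
    bes a (op (csymb lam b) h) = op (csymb lam (b - a)) h := by
  refine op_op (isSymb_jw (by linarith)) (isSymb_csymb lam b) (isSymb_csymb lam (b - a)) ?_ h
  intro ξ
  rw [csymb, csymb]
  split_ifs
  · rw [← Complex.ofReal_mul, ← jw_add]
    congr 2
    ring
  · simp

theorem norm_csymb_le_of_le {lam a b : ℝ} (hab : a ≤ b) (h : L2) :
    ‖op (csymb lam a) h‖ ≤ ‖op (csymb lam b) h‖ := by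
  have := norm_le_of_l2Hat (u := op (csymb lam a) h) (v := op (csymb lam b) h) zero_le_one (by
    filter_upwards [l2Hat_op (isSymb_csymb lam a) h, l2Hat_op (isSymb_csymb lam b) h] with ξ h1 h2
    rw [h1, h2, one_mul, norm_mul, norm_mul]
    refine mul_le_mul_of_nonneg_right ?_ (norm_nonneg _)
    rw [csymb, csymb]
    split_ifs
    · rw [Complex.norm_real, Complex.norm_real, Real.norm_of_nonneg (jw_pos _ _).le,
        Real.norm_of_nonneg (jw_pos _ _).le]
      exact jw_mono hab ξ
    · rfl)
  rwa [one_mul] at this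

theorem norm_csymb_zero_le (lam : ℝ) (h : L2) : ‖op (csymb lam 0) h‖ ≤ ‖h‖ := by
  have := norm_op_le (isSymb_csymb lam 0) (C := 1) (fun ξ => by
    rw [csymb]
    split_ifs
    · simp [jw_zero]
    · simp) h
  rwa [one_mul] at this

theorem dop_op_comm {m : Plane → ℂ} (hm : IsSymb m) (i : Fin 2) (h : L2) :
    dop i (op m h) = op m (dop i h) := by
  have hd := isSymb_dsymb i (a := -1) le_rfl
  rw [dop, op_op hd hm (hd.mul hm) (fun _ => rfl), op_op hm hd (hd.mul hm) fun _ => mul_comm _ _]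

theorem exists_ae_abs_csymb_le {σ : ℝ} (hσ : 1 < σ) : ∃ C : ℝ, 0 ≤ C ∧ ∀ (lam : ℝ) (h : L2),
    ∀ᵐ z, |op (csymb lam (-σ)) h z| ≤ C * ‖h‖ := by
  obtain ⟨C, hC, hb⟩ := exists_ae_abs_bes_le hσ
  refine ⟨C, hC, fun lam h => ?_⟩
  have e := bes_csymb (by linarith : 0 ≤ σ) lam 0 h
  rw [zero_sub] at e
  rw [← e]
  filter_upwards [hb (op (csymb lam 0) h)] with z hz
  exact hz.trans (mul_le_mul_of_nonneg_left (norm_csymb_zero_le _ _) hC)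

/-- The second derivatives of compositions with band-limited functions. -/
theorem exists_second_deriv {σ : ℝ} (hσ : 1 < σ) (hσ2 : σ < 2) {G : (Fin 2 → ℝ) → ℝ}
    (hG : ContDiff ℝ 2 G) (h0 : G 0 = 0) (R : ℝ) :
    ∃ C : ℝ, 0 ≤ C ∧ ∀ (lam : ℝ) (h : Fin 2 → L2), (∀ j, ‖h j‖ ≤ R) → ∀ i, ∃ g f : L2,
      HasD i (cmp G fun j => op (csymb lam (-σ)) (h j)) f ∧ HasD i f g ∧
      ‖g‖ ≤ C * (‖op (csymb lam (2 - σ)) (h 0)‖ + ‖op (csymb lam (2 - σ)) (h 1)‖) := by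
  obtain ⟨B, hB, hb⟩ := exists_ae_abs_csymb_le hσ
  -- The product `H^{σ-1} · H¹ ⊆ L²` treats the quadratic terms `∂v_l ∂v_j`: one factor is bounded
  -- by `R` in `H^{σ-1}`, the other by the `H²` norm. The final bound is therefore linear in the
  -- `H²` norm.
  obtain ⟨K, hK, hprod⟩ := exists_mul_bound (a := σ - 1) (b := 1) (c := 0) le_rfl (by linarith)
    zero_le_one (by linarith)
  have hG1 : ContDiff ℝ 1 G := hG.of_le (by norm_num)
  have hp1 : ∀ j, ContDiff ℝ 1 (pd j G) := fun j => contDiff_pd (n := 1) (by exact_mod_cast hG) j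
  have hp2 : ∀ j l, ContDiff ℝ 0 (pd l (pd j G)) := fun j l =>
    contDiff_pd (n := 0) (by simpa using hp1 j) l
  -- By the Sobolev embedding the values of `v` lie in the ball of radius `B * R`, whatever the
  -- cut-off `lam`.
  choose M1 hM1 hM1b using fun j => exists_bound_ball (hp1 j).continuous (B * R)
  choose M2 hM2 hM2b using fun j l => exists_bound_ball (hp2 j l).continuous (B * R)
  set N1 := M1 0 + M1 1 with hN1
  set N2 := M2 0 0 + M2 0 1 + M2 1 0 + M2 1 1 with hN2
  have hR0 : ∀ h : Fin 2 → L2, (∀ j, ‖h j‖ ≤ R) → 0 ≤ R := fun h hh => (norm_nonneg _).trans (hh 0)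
  refine ⟨N2 * (K * |R|) + N1, ?_, fun lam h hh i => ?_⟩
  · have := hM1 0
    have := hM1 1
    have := hM2 0 0
    have := hM2 0 1
    have := hM2 1 0
    have := hM2 1 1
    positivity
  set v : Fin 2 → L2 := fun j => op (csymb lam (-σ)) (h j) with hv
  set k : Fin 2 → L2 := fun j => op (csymb lam (2 - σ)) (h j) with hk
  set d : Fin 2 → L2 := fun j => dop i (op (csymb lam (-σ + 1)) (h j)) with hd
  set e : Fin 2 → L2 := fun j => dop i (dop i (k j)) with he
  have hvd : ∀ j, HasD i (v j) (d j) := fun j => hasD_csymb lam (-σ) i (h j)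
  have hde : ∀ j, HasD i (d j) (e j) := fun j => by
    have := (hasD_csymb lam (-σ + 1) i (h j)).dop i
    rwa [show -σ + 1 + 1 = 2 - σ by ring] at this
  have bv : ∀ j, BandLim lam (v j) := fun j => bandLim_csymb _ _ _
  have bd : ∀ j, BandLim lam (d j) := fun j => (bandLim_csymb _ _ _).op (isSymb_dsymb i le_rfl)
  have hvR : BddAE v (B * R) := fun j => by
    filter_upwards [hb lam (h j)] with z hz
    exact hz.trans (mul_le_mul_of_nonneg_left (hh j) hB)
  have hvR' := hvR.ae_norm_le
  choose a ha han using fun j => exists_bdd_mul (aesm_comp (hp1 j).continuous v) (M := M1 j)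
    (by filter_upwards [hvR'] with z hz using hM1b j _ hz) (d j)
  choose b hbe hbn using fun j => exists_bdd_mul (aesm_comp (hp1 j).continuous v) (M := M1 j)
    (by filter_upwards [hvR'] with z hz using hM1b j _ hz) (e j)
  have hdl : ∀ l, d l = bes (σ - 1) (dop i (op (csymb lam 0) (h l))) := fun l => by
    rw [hd, bes, ← dop_op_comm (isSymb_jw (by linarith)), ← bes,
      bes_csymb (by linarith)]
    ring_nf
  have hdj : ∀ j, d j = bes 1 (dop i (k j)) := fun j => by
    rw [hd, hk, bes, ← dop_op_comm (isSymb_jw (by linarith)), ← bes, bes_csymb (by linarith)]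
    ring_nf
  have hdd : ∀ l j, ∃ w : L2, w =ᵐ[volume] (fun z => d l z * d j z) ∧
      ‖w‖ ≤ K * |R| * ‖k j‖ := fun l j => by
    obtain ⟨w, hw, hwn⟩ := hprod (dop i (op (csymb lam 0) (h l))) (dop i (k j))
      (by rw [← hdl]; exact (bd l).integrable)
    rw [← hdl, ← hdj, bes_zero] at hw
    refine ⟨w, hw, hwn.trans ?_⟩
    have h1 : ‖dop i (op (csymb lam 0) (h l))‖ ≤ |R| :=
      (norm_dop_le _ _).trans ((norm_csymb_zero_le _ _).trans ((hh l).trans (le_abs_self R)))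
    exact mul_le_mul (mul_le_mul_of_nonneg_left h1 hK) (norm_dop_le _ _) (norm_nonneg _)
      (by positivity)
  choose w hw hwn using hdd
  choose c hc hcn using fun j l => exists_bdd_mul (aesm_comp (hp2 j l).continuous v)
    (M := M2 j l) (by filter_upwards [hvR'] with z hz using hM2b j l _ hz) (w l j)
  have hvz : ∀ᵐ z, (fun l => rep (v l) z) = fun l => v l z := by
    filter_upwards [(bv 0).rep_ae, (bv 1).rep_ae] with z h0 h1
    ext l
    fin_cases l
    · exact h0
    · exact h1
  have hV : ∀ j, ContDiff ℝ 1 (rep (v j)) := fun j => (bv j).contDiff_rep.of_le (by simp)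
  have hDr : ∀ j, ContDiff ℝ 1 (rep (d j)) := fun j => (bd j).contDiff_rep.of_le (by simp)
  have hPr : ∀ j, ContDiff ℝ 1 fun z => pd j G fun l => rep (v l) z := fun j =>
    (hp1 j).comp (contDiff_pi.2 hV)
  have be : ∀ j, BandLim lam (e j) := fun j =>
    ((bandLim_csymb _ _ _).op (isSymb_dsymb i le_rfl)).op (isSymb_dsymb i le_rfl)
  -- The terms of the twofold chain rule: `c j l = ∂_l∂_jG(v) d_l d_j`, `b j = ∂_jG(v) e_j` and `a j
  -- = ∂_jG(v) d_j`, where `d` and `e` are the first and second derivatives of `v` in the direction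
  -- `i`.
  refine ⟨((c 0 0 + c 0 1) + b 0) + ((c 1 0 + c 1 1) + b 1), a 0 + a 1, ?_, ?_, ?_⟩
  · refine hasD_cmp_bandLim hG1 h0 bv hvR hvd bd ?_
    filter_upwards [Lp.coeFn_add (a 0) (a 1), ha 0, ha 1] with z h1 h2 h3
    rw [h1, Pi.add_apply, h2, h3, Fin.sum_univ_two]
  · refine hasD_of_rep (f := fun z => (pd 0 G fun l => rep (v l) z) * rep (d 0) z
      + (pd 1 G fun l => rep (v l) z) * rep (d 1) z)
      (((hPr 0).mul (hDr 0)).add ((hPr 1).mul (hDr 1))) ?_ ?_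
    · filter_upwards [Lp.coeFn_add (a 0) (a 1), ha 0, ha 1, hvz, (bd 0).rep_ae, (bd 1).rep_ae]
        with z h1 h2 h3 h4 h5 h6
      rw [h1, Pi.add_apply, h2, h3, h4, h5, h6]
    · filter_upwards [Lp.coeFn_add ((c 0 0 + c 0 1) + b 0) ((c 1 0 + c 1 1) + b 1),
        Lp.coeFn_add (c 0 0 + c 0 1) (b 0), Lp.coeFn_add (c 1 0 + c 1 1) (b 1),
        Lp.coeFn_add (c 0 0) (c 0 1), Lp.coeFn_add (c 1 0) (c 1 1),
        hc 0 0, hc 0 1, hc 1 0, hc 1 1, hbe 0, hbe 1, hvz, (bd 0).rep_ae, (bd 1).rep_ae,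
        hw 0 0, hw 0 1, hw 1 0, hw 1 1, (be 0).rep_ae, (be 1).rep_ae]
        with z a1 a2 a3 a4 a5 a6 a7 a8 a9 b1 b2 b3 b4 b5 b6 b7 b8 b9 c1 c2
      rw [pderiv_add ((hPr 0).mul (hDr 0)) ((hPr 1).mul (hDr 1)), pderiv_mul (hPr 0) (hDr 0),
        pderiv_mul (hPr 1) (hDr 1), pderiv_comp (hp1 0) hV, pderiv_comp (hp1 1) hV, b3,
        (bd 0).pderiv_rep (hde 0), (bd 1).pderiv_rep (hde 1), Fin.sum_univ_two, Fin.sum_univ_two,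
        (bv 0).pderiv_rep (hvd 0), (bv 1).pderiv_rep (hvd 1), b4, b5, c1, c2,
        a1, Pi.add_apply, a2, a3, Pi.add_apply, Pi.add_apply, a4, a5, Pi.add_apply, Pi.add_apply,
        a6, a7, a8, a9, b1, b2, b6, b7, b8, b9]
      ring
  · have k0 := norm_nonneg (k 0)
    have k1 := norm_nonneg (k 1)
    have P := mul_nonneg hK (abs_nonneg R)
    have e0 : ∀ j, ‖e j‖ ≤ ‖k j‖ := fun j => (norm_dop_le _ _).trans (norm_dop_le _ _)
    have hcb : ∀ j l, ‖c j l‖ ≤ M2 j l * (K * |R| * ‖k j‖) := fun j l =>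
      (hcn j l).trans (mul_le_mul_of_nonneg_left (hwn l j) (hM2 j l))
    have hbb : ∀ j, ‖b j‖ ≤ M1 j * ‖k j‖ := fun j =>
      (hbn j).trans (mul_le_mul_of_nonneg_left (e0 j) (hM1 j))
    have t1 := norm_add_le ((c 0 0 + c 0 1) + b 0) ((c 1 0 + c 1 1) + b 1)
    have t2 := norm_add_le (c 0 0 + c 0 1) (b 0)
    have t3 := norm_add_le (c 1 0 + c 1 1) (b 1)
    have t4 := norm_add_le (c 0 0) (c 0 1)
    have t5 := norm_add_le (c 1 0) (c 1 1)
    have s1 : ‖(c 0 0 + c 0 1) + b 0 + ((c 1 0 + c 1 1) + b 1)‖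
        ≤ (M2 0 0 + M2 0 1) * (K * |R| * ‖k 0‖) + M1 0 * ‖k 0‖ +
          ((M2 1 0 + M2 1 1) * (K * |R| * ‖k 1‖) + M1 1 * ‖k 1‖) := by
      linarith [hcb 0 0, hcb 0 1, hcb 1 0, hcb 1 1, hbb 0, hbb 1]
    refine s1.trans ?_
    have q : ∀ m n x y : ℝ, 0 ≤ m → 0 ≤ n → 0 ≤ x → 0 ≤ y →
        m * (K * |R| * x) + n * (K * |R| * y) ≤ (m + n) * (K * |R|) * (x + y) := by
      intro m n x y hm hn hx hy
      have := mul_nonneg (mul_nonneg hm P) hy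
      have := mul_nonneg (mul_nonneg hn P) hx
      nlinarith
    have q1 := q (M2 0 0 + M2 0 1) (M2 1 0 + M2 1 1) ‖k 0‖ ‖k 1‖
      (add_nonneg (hM2 0 0) (hM2 0 1)) (add_nonneg (hM2 1 0) (hM2 1 1)) k0 k1
    have q2 : M1 0 * ‖k 0‖ + M1 1 * ‖k 1‖ ≤ N1 * (‖k 0‖ + ‖k 1‖) := by
      have := mul_nonneg (hM1 0) k1
      have := mul_nonneg (hM1 1) k0
      rw [hN1]
      nlinarith
    have q3 : (M2 0 0 + M2 0 1 + (M2 1 0 + M2 1 1)) = N2 := by rw [hN2]; ring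
    rw [q3] at q1
    change _ ≤ (N2 * (K * |R|) + N1) * (‖k 0‖ + ‖k 1‖)
    linarith

/-- The energy density `|ĥ_0|² + |ĥ_1|²`. -/
def hsq (h : Fin 2 → L2) (ξ : Plane) : ℝ≥0∞ := ‖l2Hat (h 0) ξ‖ₑ ^ 2 + ‖l2Hat (h 1) ξ‖ₑ ^ 2

theorem hsq_aemeasurable (h : Fin 2 → L2) : AEMeasurable (hsq h) volume :=
  ((l2Hat_aesm _).enorm.pow_const 2).add ((l2Hat_aesm _).enorm.pow_const 2)

/-- High frequencies of compositions. -/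
theorem exists_tail_bound {σ : ℝ} (hσ : 1 < σ) (hσ2 : σ < 2) {G : (Fin 2 → ℝ) → ℝ}
    (hG : ContDiff ℝ 2 G) (h0 : G 0 = 0) (R : ℝ) :
    ∃ C : ℝ≥0∞, C ≠ ⊤ ∧ ∀ (lam : ℝ) (h : Fin 2 → L2), 0 < lam → (∀ j, ‖h j‖ ≤ R) →
      ∫⁻ ξ in {ξ | lam < jw 1 ξ}, ‖l2Hat (cmp G fun j => bes σ (h j)) ξ‖ₑ ^ 2
        ≤ C * ((∫⁻ ξ in {ξ | lam < jw 1 ξ}, ENNReal.ofReal (jw (-(2 * σ)) ξ) * hsq h ξ)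
          + ENNReal.ofReal (lam ^ (-4 : ℝ)) *
            ∫⁻ ξ in {ξ | lam < jw 1 ξ}ᶜ, ENNReal.ofReal (jw (4 - 2 * σ) ξ) * hsq h ξ) := by
  obtain ⟨A, hA, hsec⟩ := exists_second_deriv hσ hσ2 hG h0 R
  obtain ⟨B, hB, hb⟩ := exists_ae_abs_csymb_le hσ
  obtain ⟨B', hB', hb'⟩ := exists_ae_abs_bes_le hσ
  have hG1 : ContDiff ℝ 1 G := hG.of_le (by norm_num)
  obtain ⟨L, hL0, hL⟩ := exists_lipBall hG1 (max B B' * |R|)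
  -- One factor 2 comes from splitting the composition into two parts, another from the two
  -- components; `2 * A` accounts for the two second derivatives in the Laplacian.
  refine ⟨4 * ENNReal.ofReal (L + 2 * A) ^ 2, by finiteness, fun lam h hlam hh => ?_⟩
  set S : Set Plane := {ξ | lam < jw 1 ξ} with hS
  have mS : MeasurableSet S := measurableSet_lt measurable_const (jw_measurable 1)
  -- Here `v` is the part of `u` below frequency `lam`, and `G(u) = (G(u) - G(v)) + G(v)`: the first
  -- term is estimated in `L²` by the high frequencies of `u`, the second in `H²` by the low ones.
  set u : Fin 2 → L2 := fun j => bes σ (h j) with hu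
  set v : Fin 2 → L2 := fun j => op (csymb lam (-σ)) (h j) with hv
  set k : Fin 2 → L2 := fun j => op (csymb lam (2 - σ)) (h j) with hk
  have hRR : ∀ j, ‖h j‖ ≤ |R| := fun j => (hh j).trans (le_abs_self R)
  have uB : BddAE u (max B B' * |R|) := fun j => by
    filter_upwards [hb' (h j)] with z hz
    exact hz.trans (mul_le_mul (le_max_right _ _) (hRR j) (norm_nonneg _)
      (hB.trans (le_max_left _ _)))
  have vB : BddAE v (max B B' * |R|) := fun j => by
    filter_upwards [hb lam (h j)] with z hz
    exact hz.trans (mul_le_mul (le_max_left _ _) (hRR j) (norm_nonneg _)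
      (hB.trans (le_max_left _ _)))
  have zB : BddAE (fun _ => 0) (max B B' * |R|) := fun j => by
    filter_upwards [Lp.coeFn_zero ℝ 2 (volume : Measure Plane)] with z hz
    rw [hz]
    simp only [Pi.zero_apply, abs_zero]
    exact mul_nonneg (hB.trans (le_max_left _ _)) (abs_nonneg R)
  have c0 : cmp G (fun _ => 0) = 0 := by
    ext1
    filter_upwards [cmp_coe (memLp_comp hG.continuous h0 hL hL0 zB),
      Lp.coeFn_zero ℝ 2 (volume : Measure Plane)] with z h1 h2
    rw [h1, h2]
    simp only [Pi.zero_apply]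
    exact h0
  set f := cmp G u with hf
  set f' := cmp G v with hf'
  have d1 : ‖f - f'‖ ≤ L * (‖u 0 - v 0‖ + ‖u 1 - v 1‖) :=
    norm_cmp_sub_le hG.continuous h0 hL hL0 uB vB
  have d2 : ‖f'‖ ≤ L * (‖k 0‖ + ‖k 1‖) := by
    have := norm_cmp_sub_le hG.continuous h0 hL hL0 vB zB
    rw [c0, sub_zero, sub_zero, sub_zero] at this
    exact this.trans (mul_le_mul_of_nonneg_left (add_le_add
      (norm_csymb_le_of_le (by linarith) _) (norm_csymb_le_of_le (by linarith) _)) hL0)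
  choose g p hp hg hgn using hsec lam h hh
  -- `K = (1 - Δ) G(v)`, so above `lam` the transform of `G(v)` is at most `lam^{-2}` times that of
  -- `K`.
  set K : L2 := f' - (g 0 + g 1) with hK
  have hKn : ‖K‖ ≤ (L + 2 * A) * (‖k 0‖ + ‖k 1‖) := by
    have := norm_sub_le f' (g 0 + g 1)
    have := norm_add_le (g 0) (g 1)
    have := hgn 0
    have := hgn 1
    linarith
  have d1' : ‖f - f'‖ ≤ (L + 2 * A) * (‖u 0 - v 0‖ + ‖u 1 - v 1‖) :=
    d1.trans (mul_le_mul_of_nonneg_right (by linarith) (by positivity))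
  have hKhat : ∀ᵐ ξ, l2Hat K ξ = (jw 2 ξ : ℂ) * l2Hat f' ξ := by
    filter_upwards [l2Hat_sub f' (g 0 + g 1), l2Hat_add (g 0) (g 1), hp 0, hp 1, hg 0, hg 1]
      with ξ a1 a2 a3 a4 a5 a6
    rw [a1, a2, a5, a6, a3, a4, jw_two, EuclideanSpace.norm_sq_eq, Fin.sum_univ_two]
    push_cast
    simp only [Real.norm_eq_abs, ← Complex.ofReal_pow, sq_abs]
    push_cast
    linear_combination (-(ξ 0 : ℂ) ^ 2 - (ξ 1 : ℂ) ^ 2) * l2Hat f' ξ * Complex.I_sq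
  set N := ENNReal.ofReal (L + 2 * A) with hN
  have hLA : 0 ≤ L + 2 * A := by positivity
  have sqn : ∀ (w a b : L2), ‖w‖ ≤ (L + 2 * A) * (‖a‖ + ‖b‖) →
      ∫⁻ ξ, ‖l2Hat w ξ‖ₑ ^ 2 ≤ 2 * N ^ 2 * ∫⁻ ξ, (‖l2Hat a ξ‖ₑ ^ 2 + ‖l2Hat b ξ‖ₑ ^ 2) := by
    intro w a b hw
    have h1 : ‖w‖ₑ ≤ N * (‖a‖ₑ + ‖b‖ₑ) := by
      rw [← ofReal_norm, ← ofReal_norm a, ← ofReal_norm b, ← ENNReal.ofReal_add (norm_nonneg _)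
        (norm_nonneg _), ← ENNReal.ofReal_mul hLA]
      exact ENNReal.ofReal_le_ofReal hw
    rw [lintegral_add_left' ((l2Hat_aesm _).enorm.pow_const 2), lintegral_l2Hat_sq,
      lintegral_l2Hat_sq, lintegral_l2Hat_sq]
    calc _ ≤ ENNReal.ofReal (2 * Real.pi) ^ 2 * (N * (‖a‖ₑ + ‖b‖ₑ)) ^ 2 := by gcongr
      _ = ENNReal.ofReal (2 * Real.pi) ^ 2 * N ^ 2 * (‖a‖ₑ + ‖b‖ₑ) ^ 2 := by ring
      _ ≤ ENNReal.ofReal (2 * Real.pi) ^ 2 * N ^ 2 * (2 * (‖a‖ₑ ^ 2 + ‖b‖ₑ ^ 2)) := by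
          gcongr
          exact sq_add_le _ _
      _ = _ := by ring
  have I1 : ∫⁻ ξ, (‖l2Hat (u 0 - v 0) ξ‖ₑ ^ 2 + ‖l2Hat (u 1 - v 1) ξ‖ₑ ^ 2)
      = ∫⁻ ξ in S, ENNReal.ofReal (jw (-(2 * σ)) ξ) * hsq h ξ := by
    rw [← lintegral_indicator mS]
    have hd : ∀ j, ∀ᵐ ξ, ‖l2Hat (u j - v j) ξ‖ₑ ^ 2
        = S.indicator (fun ξ => ENNReal.ofReal (jw (-(2 * σ)) ξ) * ‖l2Hat (h j) ξ‖ₑ ^ 2) ξ := by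
      intro j
      filter_upwards [l2Hat_sub (u j) (v j), l2Hat_bes (by linarith : 0 ≤ σ) (h j),
        l2Hat_op (isSymb_csymb lam (-σ)) (h j)] with ξ a1 a2 a3
      rw [a1, a2, a3, csymb]
      by_cases hξ : ξ ∈ S
      · rw [Set.indicator_of_mem hξ, if_neg (not_le.2 hξ), zero_mul, sub_zero, enorm_mul, mul_pow,
          ← ofReal_norm ((jw (-σ) ξ : ℝ) : ℂ), Complex.norm_real,
          Real.norm_of_nonneg (jw_pos _ _).le, ← ENNReal.ofReal_pow (jw_pos _ _).le, sq, ← jw_add]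
        congr 3
        ring
      · rw [Set.indicator_of_notMem hξ, if_pos (not_lt.1 hξ), sub_self, enorm_zero]
        simp
    refine lintegral_congr_ae ?_
    filter_upwards [hd 0, hd 1] with ξ a1 a2
    rw [a1, a2]
    by_cases hξ : ξ ∈ S
    · simp only [Set.indicator_of_mem hξ, hsq, mul_add]
    · simp only [Set.indicator_of_notMem hξ, add_zero]
  have I2 : ∫⁻ ξ, (‖l2Hat (k 0) ξ‖ₑ ^ 2 + ‖l2Hat (k 1) ξ‖ₑ ^ 2)
      = ∫⁻ ξ in Sᶜ, ENNReal.ofReal (jw (4 - 2 * σ) ξ) * hsq h ξ := by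
    rw [← lintegral_indicator mS.compl]
    have hd : ∀ j, ∀ᵐ ξ, ‖l2Hat (k j) ξ‖ₑ ^ 2
        = Sᶜ.indicator (fun ξ => ENNReal.ofReal (jw (4 - 2 * σ) ξ) * ‖l2Hat (h j) ξ‖ₑ ^ 2) ξ := by
      intro j
      filter_upwards [l2Hat_op (isSymb_csymb lam (2 - σ)) (h j)] with ξ a3
      rw [a3, csymb]
      by_cases hξ : ξ ∈ S
      · rw [Set.indicator_of_notMem (by simpa using hξ), if_neg (not_le.2 hξ)]
        simp
      · rw [Set.indicator_of_mem (by simpa using hξ), if_pos (not_lt.1 hξ), enorm_mul, mul_pow,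
          ← ofReal_norm ((jw (2 - σ) ξ : ℝ) : ℂ), Complex.norm_real,
          Real.norm_of_nonneg (jw_pos _ _).le, ← ENNReal.ofReal_pow (jw_pos _ _).le, sq, ← jw_add]
        congr 3
        ring
    refine lintegral_congr_ae ?_
    filter_upwards [hd 0, hd 1] with ξ a1 a2
    rw [a1, a2]
    by_cases hξ : ξ ∈ Sᶜ
    · simp only [Set.indicator_of_mem hξ, hsq, mul_add]
    · simp only [Set.indicator_of_notMem hξ, add_zero]
  have s1 := sqn _ _ _ d1'
  have s2 := sqn _ _ _ hKn
  rw [I1] at s1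
  rw [I2] at s2
  set Λ := ENNReal.ofReal (lam ^ (-4 : ℝ)) with hΛ
  have hpt : ∀ᵐ ξ ∂(volume.restrict S), ‖l2Hat f ξ‖ₑ ^ 2
      ≤ 2 * (‖l2Hat (f - f') ξ‖ₑ ^ 2 + Λ * ‖l2Hat K ξ‖ₑ ^ 2) := by
    rw [ae_restrict_iff' mS]
    filter_upwards [hKhat, l2Hat_sub f f'] with ξ a1 a2 hξ
    have e : l2Hat f ξ = l2Hat (f - f') ξ + l2Hat f' ξ := by rw [a2]; ring
    have hlow : ‖l2Hat f' ξ‖ₑ ^ 2 ≤ Λ * ‖l2Hat K ξ‖ₑ ^ 2 := by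
      rw [a1, enorm_mul, mul_pow, ← mul_assoc, ← ofReal_norm ((jw 2 ξ : ℝ) : ℂ), Complex.norm_real,
          Real.norm_of_nonneg (jw_pos _ _).le, ← ENNReal.ofReal_pow (jw_pos _ _).le, hΛ,
          ← ENNReal.ofReal_mul (by positivity)]
      refine le_mul_of_one_le_left zero_le ?_
      rw [← ENNReal.ofReal_one]
      refine ENNReal.ofReal_le_ofReal ?_
      have h4 : jw 2 ξ ^ 2 = jw 1 ξ ^ (4 : ℝ) := by
        rw [sq, ← jw_add, jw_eq_rpow]
        norm_num
      rw [h4, Real.rpow_neg hlam.le, ← div_eq_inv_mul, one_le_div (by positivity)]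
      exact Real.rpow_le_rpow hlam.le (le_of_lt hξ) (by norm_num)
    calc _ ≤ (‖l2Hat (f - f') ξ‖ₑ + ‖l2Hat f' ξ‖ₑ) ^ 2 := by
            rw [e]
            gcongr
            exact enorm_add_le _ _
      _ ≤ _ := (sq_add_le _ _).trans (by gcongr)
  calc _ ≤ ∫⁻ ξ in S, 2 * (‖l2Hat (f - f') ξ‖ₑ ^ 2 + Λ * ‖l2Hat K ξ‖ₑ ^ 2) := lintegral_mono_ae hpt
    _ ≤ ∫⁻ ξ, 2 * (‖l2Hat (f - f') ξ‖ₑ ^ 2 + Λ * ‖l2Hat K ξ‖ₑ ^ 2) := setLIntegral_le_lintegral _ _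
    _ = 2 * ((∫⁻ ξ, ‖l2Hat (f - f') ξ‖ₑ ^ 2) + Λ * ∫⁻ ξ, ‖l2Hat K ξ‖ₑ ^ 2) := by
        rw [lintegral_const_mul' _ _ (by norm_num),
          lintegral_add_left' ((l2Hat_aesm _).enorm.pow_const 2),
          lintegral_const_mul' _ _ ENNReal.ofReal_ne_top]
    _ ≤ 2 * ((2 * N ^ 2 * ∫⁻ ξ in S, ENNReal.ofReal (jw (-(2 * σ)) ξ) * hsq h ξ) +
          Λ * (2 * N ^ 2 * ∫⁻ ξ in Sᶜ, ENNReal.ofReal (jw (4 - 2 * σ) ξ) * hsq h ξ)) := by gcongr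
    _ = _ := by ring

/-! ### Integration of the tail bound over the cut-off frequency -/

theorem lintegral_layer {W : ℝ → ℝ≥0∞} (hW : Measurable W) {g : Plane → ℝ≥0∞}
    (hg : AEMeasurable g volume) (S : Set ℝ) {E : Set (ℝ × Plane)} (hE : MeasurableSet E) :
    ∫⁻ t in S, W t * ∫⁻ ξ in {ξ | (t, ξ) ∈ E}, g ξ
      = ∫⁻ ξ, g ξ * ∫⁻ t in S, {t | (t, ξ) ∈ E}.indicator W t := by
  have m1 : ∀ t, MeasurableSet {ξ | (t, ξ) ∈ E} := fun t => hE.preimage measurable_prodMk_left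
  have m2 : ∀ ξ, MeasurableSet {t | (t, ξ) ∈ E} := fun ξ => hE.preimage measurable_prodMk_right
  have e1 : ∀ t, W t * ∫⁻ ξ in {ξ | (t, ξ) ∈ E}, g ξ
      = ∫⁻ ξ, E.indicator (fun p => W p.1 * g p.2) (t, ξ) := fun t => by
    rw [← lintegral_indicator (m1 t), ← lintegral_const_mul'' _ (hg.indicator (m1 t))]
    refine lintegral_congr fun ξ => ?_
    by_cases h : (t, ξ) ∈ E
    · rw [Set.indicator_of_mem h, Set.indicator_of_mem (show ξ ∈ {ξ | (t, ξ) ∈ E} from h)]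
    · rw [Set.indicator_of_notMem h, Set.indicator_of_notMem (show ξ ∉ {ξ | (t, ξ) ∈ E} from h),
        mul_zero]
  simp only [e1]
  rw [lintegral_lintegral_swap (f := fun t ξ => E.indicator (fun p => W p.1 * g p.2) (t, ξ))]
  · refine lintegral_congr fun ξ => ?_
    rw [← lintegral_const_mul _ (hW.indicator (m2 ξ))]
    refine lintegral_congr fun t => ?_
    by_cases h : (t, ξ) ∈ E
    · rw [Set.indicator_of_mem h, Set.indicator_of_mem (show t ∈ {t | (t, ξ) ∈ E} from h), mul_comm]
    · rw [Set.indicator_of_notMem h, Set.indicator_of_notMem (show t ∉ {t | (t, ξ) ∈ E} from h),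
        mul_zero]
  · exact ((hW.comp measurable_fst).aemeasurable.mul hg.comp_snd).indicator hE

/-- Only the layer `(b / 2, b)` is kept. This is why cut-offs above `Λ` control frequencies above `2
* Λ`. -/
theorem layer_lower {p Λ b : ℝ} (hp : 0 ≤ p) (hΛ : 0 < Λ) (hb : 2 * Λ ≤ b) :
    ENNReal.ofReal ((b / 2) ^ (p + 1))
      ≤ ∫⁻ t in Set.Ioi Λ, {t | t < b}.indicator (fun t => ENNReal.ofReal (t ^ p)) t := by
  have hb2 : 0 < b / 2 := by linarith
  calc ENNReal.ofReal ((b / 2) ^ (p + 1))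
      = ∫⁻ t in Set.Ioo (b / 2) b, ENNReal.ofReal ((b / 2) ^ p) := by
        rw [setLIntegral_const, Real.volume_Ioo, ← ENNReal.ofReal_mul (by positivity),
          Real.rpow_add_one hb2.ne']
        congr 2
        ring
    _ ≤ ∫⁻ t in Set.Ioo (b / 2) b, {t | t < b}.indicator (fun t => ENNReal.ofReal (t ^ p)) t := by
        refine setLIntegral_mono' measurableSet_Ioo fun t ht => ?_
        rw [Set.indicator_of_mem (show t ∈ {t | t < b} from ht.2)]
        exact ENNReal.ofReal_le_ofReal (Real.rpow_le_rpow hb2.le ht.1.le hp)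
    _ ≤ _ := lintegral_mono_set fun t ht => lt_of_le_of_lt (by linarith : Λ ≤ b / 2) ht.1

theorem layer_upper {p Λ b : ℝ} (hp : 0 ≤ p) (hΛ : 0 < Λ) (hb : 0 < b) :
    ∫⁻ t in Set.Ioi Λ, {t | t < b}.indicator (fun t => ENNReal.ofReal (t ^ p)) t
      ≤ if Λ < b then ENNReal.ofReal (b ^ (p + 1)) else 0 := by
  split_ifs with h
  · calc _ = ∫⁻ t in Set.Iio b ∩ Set.Ioi Λ, ENNReal.ofReal (t ^ p) := by
          rw [← Measure.restrict_restrict measurableSet_Iio, ← lintegral_indicator measurableSet_Iio]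
          rfl
      _ ≤ ∫⁻ t in Set.Iio b ∩ Set.Ioi Λ, ENNReal.ofReal (b ^ p) := by
          refine setLIntegral_mono' (measurableSet_Iio.inter measurableSet_Ioi) fun t ht => ?_
          have : 0 < t := hΛ.trans ht.2
          exact ENNReal.ofReal_le_ofReal (Real.rpow_le_rpow this.le (le_of_lt ht.1) hp)
      _ ≤ ∫⁻ t in Set.Ioo 0 b, ENNReal.ofReal (b ^ p) :=
          lintegral_mono_set fun t ht => ⟨hΛ.trans ht.2, ht.1⟩
      _ = _ := by
          rw [setLIntegral_const, Real.volume_Ioo, ← ENNReal.ofReal_mul (by positivity),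
            Real.rpow_add_one hb.ne', sub_zero]
  · refine (setLIntegral_eq_zero measurableSet_Ioi fun t ht => ?_).le
    refine Set.indicator_of_notMem (fun h' => h ?_) _
    exact lt_trans ht h'

theorem layer_tail {p Λ b : ℝ} (hp : p < -1) (hΛ : 0 < Λ) :
    ∫⁻ t in Set.Ioi Λ, {t | b ≤ t}.indicator (fun t => ENNReal.ofReal (t ^ p)) t
      ≤ ENNReal.ofReal (max Λ b ^ (p + 1) * (-(p + 1))⁻¹) := by
  have hm : 0 < max Λ b := lt_max_of_lt_left hΛ
  calc _ = ∫⁻ t in Set.Ici b ∩ Set.Ioi Λ, ENNReal.ofReal (t ^ p) := by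
          rw [← Measure.restrict_restrict measurableSet_Ici, ← lintegral_indicator measurableSet_Ici]
          rfl
    _ ≤ ∫⁻ t in Set.Ici (max Λ b), ENNReal.ofReal (t ^ p) :=
        lintegral_mono_set fun t ht =>
          Set.mem_Ici.2 (max_le (le_of_lt ht.2) ht.1)
    _ = ∫⁻ t in Set.Ioi (max Λ b), ENNReal.ofReal (t ^ p) := by
        rw [restrict_Ioi_eq_restrict_Ici]
    _ = ENNReal.ofReal (∫ t in Set.Ioi (max Λ b), t ^ p) := by
        refine (ofReal_integral_eq_lintegral_ofReal (integrableOn_Ioi_rpow_of_lt hp hm) ?_).symm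
        rw [EventuallyLE, ae_restrict_iff' measurableSet_Ioi]
        exact Eventually.of_forall fun t ht => Real.rpow_nonneg (hm.trans ht).le _
    _ ≤ _ := by
        rw [integral_Ioi_rpow_of_lt hp hm, inv_neg, mul_neg, neg_div, div_eq_mul_inv]

/-- The weight of the frequency `ξ` in the bound for frequencies above `Λ`. -/
def tailWt (σ Λ : ℝ) (ξ : Plane) : ℝ≥0∞ :=
  (if Λ < jw 1 ξ then 1 else 0) + ENNReal.ofReal (jw (4 - 2 * σ) ξ * max Λ (jw 1 ξ) ^ (2 * σ - 4))

theorem tailWt_measurable (σ Λ : ℝ) : Measurable (tailWt σ Λ) := by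
  have h1 := jw_measurable 1
  have h2 := jw_measurable (4 - 2 * σ)
  refine (Measurable.ite (measurableSet_lt measurable_const h1) measurable_const
    measurable_const).add (Measurable.ennreal_ofReal (h2.mul ?_))
  exact (measurable_const.max h1).pow_const _

theorem tailWt_le {σ : ℝ} (hσ : σ < 2) (Λ : ℝ) (ξ : Plane) : tailWt σ Λ ξ ≤ 2 := by
  have h1 : jw (4 - 2 * σ) ξ * max Λ (jw 1 ξ) ^ (2 * σ - 4) ≤ 1 := by
    have hb := jw_pos 1 ξ
    have h2 : max Λ (jw 1 ξ) ^ (2 * σ - 4) ≤ jw 1 ξ ^ (2 * σ - 4) :=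
      Real.rpow_le_rpow_of_nonpos hb (le_max_right _ _) (by linarith)
    refine (mul_le_mul_of_nonneg_left h2 (jw_pos _ _).le).trans_eq ?_
    rw [jw_eq_rpow, ← Real.rpow_add hb]
    ring_nf
    simp
  have h2 := ENNReal.ofReal_le_ofReal h1
  rw [ENNReal.ofReal_one] at h2
  rw [tailWt]
  refine (add_le_add (b := 1) ?_ h2).trans_eq one_add_one_eq_two
  split_ifs <;> simp

/-- With the uniform bound `tailWt_le`, dominated convergence makes the right-hand side of
`exists_weighted_tail` small for large `Λ` and fixed `h`; the continuity of the superposition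
operator rests on this. -/
theorem tendsto_tailWt {σ : ℝ} (hσ : σ < 2) (ξ : Plane) :
    Tendsto (fun Λ => tailWt σ Λ ξ) atTop (𝓝 0) := by
  have h1 : Tendsto (fun Λ : ℝ => jw (4 - 2 * σ) ξ * Λ ^ (2 * σ - 4)) atTop (𝓝 0) := by
    have := (tendsto_rpow_neg_atTop (y := 4 - 2 * σ) (by linarith)).const_mul (jw (4 - 2 * σ) ξ)
    rw [mul_zero] at this
    refine this.congr fun Λ => ?_
    rw [neg_sub]
  have h2 := ENNReal.tendsto_ofReal h1
  rw [ENNReal.ofReal_zero] at h2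
  refine h2.congr' ?_
  filter_upwards [eventually_ge_atTop (jw 1 ξ)] with Λ hΛ
  rw [tailWt, if_neg (not_lt.2 hΛ), zero_add, max_eq_left hΛ]

/-- The bound for weighted high frequencies of compositions. -/
theorem exists_weighted_tail {σ : ℝ} (hσ : 1 < σ) (hσ2 : σ < 2) {G : (Fin 2 → ℝ) → ℝ}
    (hG : ContDiff ℝ 2 G) (h0 : G 0 = 0) (R : ℝ) :
    ∃ C : ℝ≥0∞, C ≠ ⊤ ∧ ∀ (Λ : ℝ) (h : Fin 2 → L2), 0 < Λ → (∀ j, ‖h j‖ ≤ R) →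
      ∫⁻ ξ in {ξ | 2 * Λ ≤ jw 1 ξ},
          ENNReal.ofReal (jw (2 * σ) ξ) * ‖l2Hat (cmp G fun j => bes σ (h j)) ξ‖ₑ ^ 2
        ≤ C * ∫⁻ ξ, hsq h ξ * tailWt σ Λ ξ := by
  obtain ⟨C, hC, htail⟩ := exists_tail_bound hσ hσ2 hG h0 R
  -- The constant `1 / (4 - 2σ)` of `∫_m^∞ t^{2σ-5} dt`, a convergent integral because `σ < 2`.
  set κ := ENNReal.ofReal (-(2 * σ - 1 - 4 + 1))⁻¹ with hκ
  refine ⟨ENNReal.ofReal (2 ^ (2 * σ)) * (C * (1 + κ)), by finiteness, fun Λ h hΛ hh => ?_⟩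
  set f := cmp G fun j => bes σ (h j) with hf
  have hp : 0 ≤ 2 * σ - 1 := by linarith
  have hp4 : 2 * σ - 1 - 4 < -1 := by linarith
  -- The integral of `t^{2σ-1}` up to `(1 + |ξ|²)^{1/2}` is comparable to the weight of `H^σ`; `W'`
  -- includes the factor `t^{-4}` of the low-frequency term in the tail bound.
  set W : ℝ → ℝ≥0∞ := fun t => ENNReal.ofReal (t ^ (2 * σ - 1)) with hW
  set W' : ℝ → ℝ≥0∞ := fun t => ENNReal.ofReal (t ^ (2 * σ - 1 - 4)) with hW'
  have mW : Measurable W := (measurable_id.pow_const _).ennreal_ofReal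
  have mW' : Measurable W' := (measurable_id.pow_const _).ennreal_ofReal
  have mE : MeasurableSet {p : ℝ × Plane | p.1 < jw 1 p.2} :=
    measurableSet_lt measurable_fst ((jw_measurable 1).comp measurable_snd)
  have mf : AEMeasurable (fun ξ => ‖l2Hat f ξ‖ₑ ^ 2) volume := (l2Hat_aesm f).enorm.pow_const 2
  have mS := measurableSet_le (measurable_const (a := 2 * Λ)) (jw_measurable 1)
  have mh := hsq_aemeasurable h
  have mj : ∀ a, Measurable fun ξ => ENNReal.ofReal (jw a ξ) := fun a =>
    (jw_measurable a).ennreal_ofReal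
  have L1 := lintegral_layer mW mf (Set.Ioi Λ) mE
  have L2 := lintegral_layer mW ((mj (-(2 * σ))).aemeasurable.mul mh) (Set.Ioi Λ) mE
  have L3 := lintegral_layer mW' ((mj (4 - 2 * σ)).aemeasurable.mul mh) (Set.Ioi Λ) mE.compl
  simp only [Pi.mul_apply] at L2 L3
  have step1 : ∫⁻ ξ in {ξ | 2 * Λ ≤ jw 1 ξ}, ENNReal.ofReal (jw (2 * σ) ξ) * ‖l2Hat f ξ‖ₑ ^ 2
      ≤ ENNReal.ofReal (2 ^ (2 * σ)) * ∫⁻ ξ, ‖l2Hat f ξ‖ₑ ^ 2 *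
        ∫⁻ t in Set.Ioi Λ, {t | t < jw 1 ξ}.indicator W t := by
    rw [← lintegral_const_mul' _ _ ENNReal.ofReal_ne_top]
    refine le_trans (setLIntegral_mono' mS fun ξ hξ => ?_) (setLIntegral_le_lintegral _ _)
    have h1 := layer_lower hp hΛ hξ
    have hb := jw_pos 1 ξ
    have e : jw (2 * σ) ξ = 2 ^ (2 * σ) * (jw 1 ξ / 2) ^ (2 * σ - 1 + 1) := by
      rw [jw_eq_rpow, sub_add_cancel, ← Real.mul_rpow (by norm_num) (by positivity)]
      congr 1
      ring
    rw [e, ENNReal.ofReal_mul (by positivity), mul_assoc, mul_comm (‖l2Hat f ξ‖ₑ ^ 2)]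
    gcongr
  have step2 : ∫⁻ ξ, ‖l2Hat f ξ‖ₑ ^ 2 * ∫⁻ t in Set.Ioi Λ, {t | t < jw 1 ξ}.indicator W t
      ≤ C * ((∫⁻ ξ, (ENNReal.ofReal (jw (-(2 * σ)) ξ) * hsq h ξ) *
          ∫⁻ t in Set.Ioi Λ, {t | t < jw 1 ξ}.indicator W t) +
        ∫⁻ ξ, (ENNReal.ofReal (jw (4 - 2 * σ) ξ) * hsq h ξ) *
          ∫⁻ t in Set.Ioi Λ, {t | jw 1 ξ ≤ t}.indicator W' t) := by
    have e3 : ∀ ξ, {t : ℝ | jw 1 ξ ≤ t} = {t | (t, ξ) ∈ {p : ℝ × Plane | p.1 < jw 1 p.2}ᶜ} := by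
      intro ξ
      ext t
      simp
    simp only [e3]
    refine (L1.symm.le).trans ?_
    refine le_trans ?_ (mul_le_mul_right (add_le_add L2.le L3.le) C)
    have hmeas : Measurable fun t : ℝ => W t *
        ∫⁻ ξ in {ξ | (t, ξ) ∈ {p : ℝ × Plane | p.1 < jw 1 p.2}},
          ENNReal.ofReal (jw (-(2 * σ)) ξ) * hsq h ξ := by
      refine mW.mul (Antitone.measurable fun a b hab => lintegral_mono_set fun ξ hξ => ?_)
      exact lt_of_le_of_lt hab hξ
    rw [← lintegral_add_left hmeas, ← lintegral_const_mul' _ _ hC]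
    refine setLIntegral_mono' measurableSet_Ioi fun t ht => ?_
    have ht0 : 0 < t := hΛ.trans ht
    refine (mul_le_mul_right (htail t h ht0 hh) (W t)).trans_eq ?_
    have eW : W' t = W t * ENNReal.ofReal (t ^ (-4 : ℝ)) := by
      rw [hW', hW]
      simp only
      rw [← ENNReal.ofReal_mul (by positivity), ← Real.rpow_add ht0]
      ring_nf
    rw [eW]
    simp only [Set.mem_ofPred_eq]
    have e4 : {ξ : Plane | t < jw 1 ξ}ᶜ = {ξ | (t, ξ) ∈ {p : ℝ × Plane | p.1 < jw 1 p.2}ᶜ} := by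
      ext ξ
      simp
    rw [e4]
    ring
  have step3 : (∫⁻ ξ, (ENNReal.ofReal (jw (-(2 * σ)) ξ) * hsq h ξ) *
          ∫⁻ t in Set.Ioi Λ, {t | t < jw 1 ξ}.indicator W t)
      ≤ ∫⁻ ξ, hsq h ξ * tailWt σ Λ ξ := by
    refine lintegral_mono fun ξ => ?_
    have h1 := layer_upper hp hΛ (jw_pos 1 ξ)
    calc _ ≤ (ENNReal.ofReal (jw (-(2 * σ)) ξ) * hsq h ξ) *
            if Λ < jw 1 ξ then ENNReal.ofReal (jw 1 ξ ^ (2 * σ - 1 + 1)) else 0 := by gcongr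
      _ = hsq h ξ * if Λ < jw 1 ξ then 1 else 0 := by
          split_ifs
          · rw [mul_comm, ← mul_assoc, ← ENNReal.ofReal_mul (by have := jw_pos 1 ξ; positivity),
              sub_add_cancel, ← jw_eq_rpow, mul_comm (jw _ _), jw_mul_neg, ENNReal.ofReal_one,
              one_mul, mul_one]
          · simp
      _ ≤ _ := by
          gcongr
          exact le_self_add
  have step4 : (∫⁻ ξ, (ENNReal.ofReal (jw (4 - 2 * σ) ξ) * hsq h ξ) *
          ∫⁻ t in Set.Ioi Λ, {t | jw 1 ξ ≤ t}.indicator W' t)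
      ≤ κ * ∫⁻ ξ, hsq h ξ * tailWt σ Λ ξ := by
    rw [← lintegral_const_mul' _ _ ENNReal.ofReal_ne_top]
    refine lintegral_mono fun ξ => ?_
    have h1 := layer_tail (b := jw 1 ξ) hp4 hΛ
    have hm : 0 < max Λ (jw 1 ξ) := lt_max_of_lt_left hΛ
    calc _ ≤ (ENNReal.ofReal (jw (4 - 2 * σ) ξ) * hsq h ξ) *
            ENNReal.ofReal (max Λ (jw 1 ξ) ^ (2 * σ - 1 - 4 + 1) * (-(2 * σ - 1 - 4 + 1))⁻¹) := by
          gcongr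
      _ = κ * (hsq h ξ *
            ENNReal.ofReal (jw (4 - 2 * σ) ξ * max Λ (jw 1 ξ) ^ (2 * σ - 4))) := by
          rw [ENNReal.ofReal_mul (by positivity), ENNReal.ofReal_mul (jw_pos _ _).le, hκ]
          ring_nf
      _ ≤ _ := by
          gcongr
          exact le_add_self
  calc _ ≤ ENNReal.ofReal (2 ^ (2 * σ)) * (C * ((∫⁻ ξ, hsq h ξ * tailWt σ Λ ξ)
        + κ * ∫⁻ ξ, hsq h ξ * tailWt σ Λ ξ)) := by
        refine step1.trans ?_
        gcongr
        refine step2.trans ?_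
        gcongr
    _ = _ := by ring

/-- `u ↦ G(u)` acts continuously and boundedly on `H^σ`, in the coordinates given by `bes σ`. -/
def HasComp (σ : ℝ) (G : (Fin 2 → ℝ) → ℝ) : Prop :=
  ∃ Φ : (Fin 2 → L2) → L2, Continuous Φ ∧ (∀ R, ∃ C, ∀ h, (∀ i, ‖h i‖ ≤ R) → ‖Φ h‖ ≤ C) ∧
    ∀ h, bes σ (Φ h) = cmp G fun i => bes σ (h i)

theorem sobolevNorm_sq (a : ℝ) (u : L2) :
    sobolevNorm a u ^ 2 = ∫⁻ ξ, ENNReal.ofReal (jw (2 * a) ξ) * ‖l2Hat u ξ‖ₑ ^ 2 := by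
  have h := eLpNorm_nnreal_pow_eq_lintegral (f := fun ξ => (jw a ξ : ℂ) * l2Hat u ξ)
    (μ := volume) (p := 2) (by norm_num)
  have h' : eLpNorm (fun ξ => (jw a ξ : ℂ) * l2Hat u ξ) 2 volume ^ 2
      = ∫⁻ ξ, ‖(jw a ξ : ℂ) * l2Hat u ξ‖ₑ ^ 2 := by simpa using h
  rw [sobolevNorm_eq, h']
  refine lintegral_congr fun ξ => ?_
  rw [enorm_mul, mul_pow, ← ofReal_norm ((jw a ξ : ℝ) : ℂ), Complex.norm_real,
    Real.norm_of_nonneg (jw_pos _ _).le, ← ENNReal.ofReal_pow (jw_pos _ _).le, sq (jw a ξ), ← jw_add]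
  congr 3
  ring

theorem lintegral_hsq_le (h : Fin 2 → L2) :
    ∫⁻ ξ, hsq h ξ ≤ 2 * ENNReal.ofReal (2 * Real.pi) ^ 2 * ‖h‖ₑ ^ 2 := by
  have hj : ∀ j, ‖h j‖ₑ ≤ ‖h‖ₑ := fun j => by
    rw [← ofReal_norm, ← ofReal_norm]
    exact ENNReal.ofReal_le_ofReal (norm_le_pi_norm h j)
  unfold hsq
  rw [lintegral_add_left' ((l2Hat_aesm _).enorm.pow_const 2), lintegral_l2Hat_sq,
    lintegral_l2Hat_sq]
  calc _ ≤ ENNReal.ofReal (2 * Real.pi) ^ 2 * ‖h‖ₑ ^ 2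
        + ENNReal.ofReal (2 * Real.pi) ^ 2 * ‖h‖ₑ ^ 2 := by
        gcongr
        · exact hj 0
        · exact hj 1
    _ = _ := by ring

theorem enorm_sq_add_le (a b : ℂ) : ‖a + b‖ₑ ^ 2 ≤ 2 * (‖a‖ₑ ^ 2 + ‖b‖ₑ ^ 2) :=
  (pow_le_pow_left₀ zero_le (enorm_add_le a b) 2).trans (sq_add_le _ _)

theorem tendsto_of_enorm_sq {X : Type*} {l : Filter X} {f : X → L2} {a : L2}
    (h : Tendsto (fun x => ‖f x - a‖ₑ ^ 2) l (𝓝 0)) : Tendsto f l (𝓝 a) := by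
  rw [tendsto_iff_edist_tendsto_0]
  have h1 := (ENNReal.continuous_rpow_const (y := 1 / 2)).tendsto 0 |>.comp h
  simp only [Function.comp_def] at h1
  rw [ENNReal.zero_rpow_of_pos (by norm_num)] at h1
  refine h1.congr fun x => ?_
  rw [edist_eq_enorm_sub, ← ENNReal.rpow_natCast, ← ENNReal.rpow_mul]
  norm_num

/-- Boundedness is the weighted tail estimate at `Λ = 1/2`, where the region `1 ≤ (1 + |ξ|²)^{1/2}`
is the whole plane. For continuity at `h`, the high frequencies of the images of nearby `h'` are
controlled by the tail of `h` plus a multiple of `‖h' - h‖²`, and the low frequencies by the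
Lipschitz bound in `L²`. -/
theorem hasComp_base {σ : ℝ} (hσ : 1 < σ) (hσ2 : σ < 2) {G : (Fin 2 → ℝ) → ℝ}
    (hG : ContDiff ℝ 2 G) (h0 : G 0 = 0) : HasComp σ G := by
  have hσ0 : 0 ≤ σ := by linarith
  have hG1 : ContDiff ℝ 1 G := hG.of_le (by norm_num)
  set c := ENNReal.ofReal (2 * Real.pi) ^ 2 with hc
  have hct : c ≠ ⊤ := by finiteness
  have hc1 : 1 ≤ c := by
    refine one_le_pow₀ ?_
    rw [← ENNReal.ofReal_one]
    exact ENNReal.ofReal_le_ofReal (by nlinarith [Real.pi_gt_three])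
  obtain ⟨B, hB, hb⟩ := exists_ae_abs_bes_le hσ
  set f : (Fin 2 → L2) → L2 := fun h => cmp G fun j => bes σ (h j) with hf
  have hbdd : ∀ R, ∃ C : ℝ≥0∞, C ≠ ⊤ ∧ ∀ h : Fin 2 → L2, (∀ j, ‖h j‖ ≤ R) →
      sobolevNorm σ (f h) ^ 2 ≤ C * ‖h‖ₑ ^ 2 := by
    intro R
    obtain ⟨C, hC, hw⟩ := exists_weighted_tail hσ hσ2 hG h0 R
    refine ⟨C * (2 * (2 * c)), by finiteness, fun h hh => ?_⟩
    have h1 := hw (1 / 2) h (by norm_num) hh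
    have hu : {ξ : Plane | 2 * (1 / 2 : ℝ) ≤ jw 1 ξ} = Set.univ := by
      ext ξ
      simpa using jw_one_ge ξ
    rw [hu, Measure.restrict_univ] at h1
    rw [sobolevNorm_sq]
    refine h1.trans ?_
    rw [mul_assoc]
    gcongr
    calc _ ≤ ∫⁻ ξ, 2 * hsq h ξ := lintegral_mono fun ξ => by
            rw [mul_comm]
            gcongr
            exact tailWt_le hσ2 _ _
      _ = 2 * ∫⁻ ξ, hsq h ξ := lintegral_const_mul' _ _ (by norm_num)
      _ ≤ 2 * (2 * c * ‖h‖ₑ ^ 2) := by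
            gcongr
            exact lintegral_hsq_le h
      _ = _ := by ring
  have hex : ∀ h, ∃ l, bes σ l = f h := fun h => by
    obtain ⟨C, hC, hw⟩ := hbdd ‖h‖
    refine exists_bes_eq hσ0 ?_
    have h1 : sobolevNorm σ (f h) ^ 2 < ⊤ :=
      (hw h fun j => norm_le_pi_norm h j).trans_lt (by finiteness)
    by_contra h2
    rw [not_lt, top_le_iff] at h2
    rw [h2] at h1
    simp at h1
  choose Φ hΦ using hex
  have hn : ∀ l, sobolevNorm σ (bes σ l) ^ 2 = c * ‖l‖ₑ ^ 2 := fun l => by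
    rw [sobolevNorm_bes hσ0, mul_pow]
  refine ⟨Φ, ?_, ?_, hΦ⟩
  · rw [continuous_iff_continuousAt]
    intro h
    refine tendsto_of_enorm_sq ?_
    obtain ⟨C, hC, hw⟩ := exists_weighted_tail hσ hσ2 hG h0 (‖h‖ + 1)
    obtain ⟨L, hL0, hL⟩ := exists_lipBall hG1 (B * (‖h‖ + 1))
    set T : ℝ → ℝ≥0∞ := fun Λ => ∫⁻ ξ, hsq h ξ * tailWt σ Λ ξ with hT
    have hTlim : Tendsto T atTop (𝓝 0) := by
      have h1 := tendsto_lintegral_filter_of_dominated_convergence' (l := atTop)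
        (μ := (volume : Measure Plane))
        (F := fun Λ ξ => hsq h ξ * tailWt σ Λ ξ) (f := fun _ => 0) (fun ξ => hsq h ξ * 2)
        (Eventually.of_forall fun Λ => (hsq_aemeasurable h).mul (tailWt_measurable σ Λ).aemeasurable)
        (Eventually.of_forall fun Λ => Eventually.of_forall fun ξ => by
          gcongr
          exact tailWt_le hσ2 _ _) ?_ ?_
      · simpa using h1
      · rw [lintegral_mul_const' _ _ (by norm_num)]
        exact ENNReal.mul_ne_top ((lintegral_hsq_le h).trans_lt (by finiteness)).ne (by norm_num)
      · have hfin : ∫⁻ ξ, hsq h ξ ≠ ⊤ := ((lintegral_hsq_le h).trans_lt (by finiteness)).ne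
        filter_upwards [ae_lt_top' (hsq_aemeasurable h) hfin] with ξ hξ
        have := ENNReal.Tendsto.const_mul (tendsto_tailWt hσ2 ξ) (Or.inr hξ.ne)
        rwa [mul_zero] at this
    have key : ∀ Λ, 0 < Λ → ∀ h', ‖h' - h‖ ≤ 1 →
        ‖Φ h' - Φ h‖ₑ ^ 2 ≤ 6 * C * T Λ + (16 * C * c +
          ENNReal.ofReal ((2 * Λ) ^ (2 * σ)) * c * ENNReal.ofReal (2 * L) ^ 2) * ‖h' - h‖ₑ ^ 2 := by
      intro Λ hΛ h' hh'
      have R1 : ∀ j, ‖h j‖ ≤ ‖h‖ + 1 := fun j => (norm_le_pi_norm h j).trans (by linarith)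
      have R2 : ∀ j, ‖h' j‖ ≤ ‖h‖ + 1 := fun j => by
        have h1 := norm_le_pi_norm h' j
        have h2 := norm_add_le h (h' - h)
        rw [add_sub_cancel] at h2
        linarith
      have A1 := hw Λ h hΛ R1
      have A2 := hw Λ h' hΛ R2
      have A3 : ∫⁻ ξ, hsq h' ξ * tailWt σ Λ ξ ≤ 2 * T Λ + 8 * c * ‖h' - h‖ₑ ^ 2 := by
        calc _ ≤ ∫⁻ ξ, (2 * (hsq h ξ * tailWt σ Λ ξ) + 4 * hsq (h' - h) ξ) := by
              refine lintegral_mono_ae ?_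
              filter_upwards [l2Hat_sub (h' 0) (h 0), l2Hat_sub (h' 1) (h 1)] with ξ e0 e1
              have e0' : l2Hat (h' 0) ξ = l2Hat (h 0) ξ + l2Hat (h' 0 - h 0) ξ := by rw [e0]; ring
              have e1' : l2Hat (h' 1) ξ = l2Hat (h 1) ξ + l2Hat (h' 1 - h 1) ξ := by rw [e1]; ring
              have hle : hsq h' ξ ≤ 2 * hsq h ξ + 2 * hsq (h' - h) ξ := by
                rw [hsq, e0', e1', hsq, hsq]
                refine (add_le_add (enorm_sq_add_le _ _) (enorm_sq_add_le _ _)).trans_eq ?_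
                simp only [Pi.sub_apply]
                ring
              calc _ ≤ (2 * hsq h ξ + 2 * hsq (h' - h) ξ) * tailWt σ Λ ξ := by gcongr
                _ = 2 * (hsq h ξ * tailWt σ Λ ξ) + 2 * hsq (h' - h) ξ * tailWt σ Λ ξ := by ring
                _ ≤ 2 * (hsq h ξ * tailWt σ Λ ξ) + 2 * hsq (h' - h) ξ * 2 := by
                    gcongr
                    exact tailWt_le hσ2 _ _
                _ = _ := by ring
          _ = 2 * T Λ + 4 * ∫⁻ ξ, hsq (h' - h) ξ := by
              rw [lintegral_add_left' (f := fun ξ => 2 * (hsq h ξ * tailWt σ Λ ξ))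
                (((hsq_aemeasurable h).mul (tailWt_measurable σ Λ).aemeasurable).const_mul _),
                lintegral_const_mul' _ _ (by norm_num), lintegral_const_mul' _ _ (by norm_num)]
          _ ≤ 2 * T Λ + 4 * (2 * c * ‖h' - h‖ₑ ^ 2) := by
              gcongr
              exact lintegral_hsq_le _
          _ = _ := by ring
      have A4 : ‖f h' - f h‖ₑ ≤ ENNReal.ofReal (2 * L) * ‖h' - h‖ₑ := by
        have hBd : ∀ k : Fin 2 → L2, (∀ j, ‖k j‖ ≤ ‖h‖ + 1) →
            BddAE (fun j => bes σ (k j)) (B * (‖h‖ + 1)) := fun k hk j => by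
          filter_upwards [hb (k j)] with z hz
          exact hz.trans (mul_le_mul_of_nonneg_left (hk j) hB)
        have h1 := norm_cmp_sub_le hG.continuous h0 hL hL0 (hBd h' R2) (hBd h R1)
        have h2 : ∀ j, ‖bes σ (h' j) - bes σ (h j)‖ ≤ ‖h' - h‖ := fun j => by
          rw [← map_sub]
          exact (norm_bes_le hσ0 _).trans (norm_le_pi_norm (h' - h) j)
        rw [← ofReal_norm, ← ofReal_norm, ← ENNReal.ofReal_mul (by positivity)]
        refine ENNReal.ofReal_le_ofReal (h1.trans ?_)
        have := mul_le_mul_of_nonneg_left (add_le_add (h2 0) (h2 1)) hL0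
        linarith
      have mS := measurableSet_le (measurable_const (a := 2 * Λ)) (jw_measurable 1)
      set S : Set Plane := {ξ | 2 * Λ ≤ jw 1 ξ} with hS
      have B1 : ∫⁻ ξ in S, ENNReal.ofReal (jw (2 * σ) ξ) * ‖l2Hat (f h' - f h) ξ‖ₑ ^ 2
          ≤ 2 * (C * (2 * T Λ + 8 * c * ‖h' - h‖ₑ ^ 2) + C * T Λ) := by
        calc _ ≤ ∫⁻ ξ in S, 2 * (ENNReal.ofReal (jw (2 * σ) ξ) * ‖l2Hat (f h') ξ‖ₑ ^ 2
              + ENNReal.ofReal (jw (2 * σ) ξ) * ‖l2Hat (f h) ξ‖ₑ ^ 2) := by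
              refine lintegral_mono_ae (ae_restrict_of_ae ?_)
              filter_upwards [l2Hat_sub (f h') (f h)] with ξ e
              have h1 := enorm_sq_add_le (l2Hat (f h') ξ) (-l2Hat (f h) ξ)
              rw [enorm_neg, ← sub_eq_add_neg, ← e] at h1
              refine (mul_le_mul_right h1 _).trans_eq ?_
              ring
          _ = 2 * ((∫⁻ ξ in S, ENNReal.ofReal (jw (2 * σ) ξ) * ‖l2Hat (f h') ξ‖ₑ ^ 2)
              + ∫⁻ ξ in S, ENNReal.ofReal (jw (2 * σ) ξ) * ‖l2Hat (f h) ξ‖ₑ ^ 2) := by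
              rw [lintegral_const_mul' _ _ (by norm_num), lintegral_add_left']
              exact ((jw_measurable _).ennreal_ofReal.aemeasurable.mul
                ((l2Hat_aesm _).enorm.pow_const 2)).restrict
          _ ≤ _ := by
              gcongr
              exact A2.trans (mul_le_mul_right A3 C)
      have B2 : ∫⁻ ξ in Sᶜ, ENNReal.ofReal (jw (2 * σ) ξ) * ‖l2Hat (f h' - f h) ξ‖ₑ ^ 2
          ≤ ENNReal.ofReal ((2 * Λ) ^ (2 * σ)) * (c * ‖f h' - f h‖ₑ ^ 2) := by
        calc _ ≤ ∫⁻ ξ in Sᶜ, ENNReal.ofReal ((2 * Λ) ^ (2 * σ)) * ‖l2Hat (f h' - f h) ξ‖ₑ ^ 2 := by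
              refine setLIntegral_mono' mS.compl fun ξ hξ => ?_
              gcongr
              rw [jw_eq_rpow]
              exact Real.rpow_le_rpow (jw_pos _ _).le (not_le.1 (show ¬ 2 * Λ ≤ jw 1 ξ from hξ)).le
                  (by linarith)
          _ ≤ _ := by
              refine (setLIntegral_le_lintegral _ _).trans_eq ?_
              rw [lintegral_const_mul' _ _ ENNReal.ofReal_ne_top, lintegral_l2Hat_sq]
      have hmain : c * ‖Φ h' - Φ h‖ₑ ^ 2
          = ∫⁻ ξ, ENNReal.ofReal (jw (2 * σ) ξ) * ‖l2Hat (f h' - f h) ξ‖ₑ ^ 2 := by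
        rw [← hn, map_sub, hΦ, hΦ, sobolevNorm_sq]
      calc ‖Φ h' - Φ h‖ₑ ^ 2 ≤ c * ‖Φ h' - Φ h‖ₑ ^ 2 := le_mul_of_one_le_left zero_le hc1
        _ ≤ 2 * (C * (2 * T Λ + 8 * c * ‖h' - h‖ₑ ^ 2) + C * T Λ) +
            ENNReal.ofReal ((2 * Λ) ^ (2 * σ)) * (c * (ENNReal.ofReal (2 * L) * ‖h' - h‖ₑ) ^ 2) := by
            rw [hmain, ← lintegral_add_compl _ mS]
            refine add_le_add B1 (B2.trans ?_)
            gcongr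
        _ = _ := by ring
    rw [ENNReal.tendsto_nhds_zero]
    intro ε hε
    have hε2 : 0 < ε / 2 := ENNReal.half_pos hε.ne'
    have h1 : Tendsto (fun Λ => 6 * C * T Λ) atTop (𝓝 0) := by
      have := ENNReal.Tendsto.const_mul (a := 6 * C) hTlim (Or.inr (by finiteness))
      rwa [mul_zero] at this
    -- `Λ` is fixed first and depends only on the tail of `h`; the low-frequency constant, which
    -- grows with `Λ`, is compensated afterwards by the smallness of `‖h' - h‖`.
    obtain ⟨Λ, hΛ1, hΛ⟩ := ((ENNReal.tendsto_nhds_zero.1 h1 _ hε2).and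
      (eventually_gt_atTop 0)).exists
    have h2 : Tendsto (fun h' : Fin 2 → L2 => (16 * C * c +
        ENNReal.ofReal ((2 * Λ) ^ (2 * σ)) * c * ENNReal.ofReal (2 * L) ^ 2) * ‖h' - h‖ₑ ^ 2)
        (𝓝 h) (𝓝 0) := by
      have hs : Tendsto (fun h' : Fin 2 → L2 => ‖h' - h‖ₑ ^ 2) (𝓝 h) (𝓝 0) := by
        have hcont : Continuous fun h' : Fin 2 → L2 => ‖h' - h‖ₑ ^ 2 := by fun_prop
        have := hcont.tendsto h
        simpa using this
      have := ENNReal.Tendsto.const_mul hs (Or.inr (show (16 * C * c +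
        ENNReal.ofReal ((2 * Λ) ^ (2 * σ)) * c * ENNReal.ofReal (2 * L) ^ 2) ≠ ⊤ by finiteness))
      rwa [mul_zero] at this
    filter_upwards [ENNReal.tendsto_nhds_zero.1 h2 _ hε2, Metric.closedBall_mem_nhds h one_pos]
      with h' a1 a2
    rw [mem_closedBall_iff_norm] at a2
    exact (key Λ hΛ h' a2).trans ((add_le_add hΛ1 a1).trans_eq (ENNReal.add_halves ε))
  · intro R
    obtain ⟨C, hC, hw⟩ := hbdd R
    refine ⟨(√(C * ENNReal.ofReal (R ^ 2)).toReal), fun h hh => ?_⟩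
    have hR : 0 ≤ R := (norm_nonneg _).trans (hh 0)
    have h1 := hw h hh
    rw [← hΦ, hn] at h1
    have h2 : ‖Φ h‖ₑ ^ 2 ≤ C * ENNReal.ofReal (R ^ 2) := by
      refine (le_mul_of_one_le_left zero_le hc1).trans (h1.trans ?_)
      gcongr
      rw [ENNReal.ofReal_pow hR, ← ofReal_norm]
      gcongr
      exact (pi_norm_le_iff_of_nonneg hR).2 hh
    refine Real.le_sqrt_of_sq_le ?_
    have h3 := ENNReal.toReal_mono (by finiteness) h2
    simpa using h3

/-! ### Superposition operators on `H^σ` for all `σ > 1` -/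

theorem tendsto_csymb (h : L2) :
    Tendsto (fun n : ℕ => op (csymb n 0) h) atTop (𝓝 h) := by
  refine tendsto_of_enorm_sq ?_
  set c := ENNReal.ofReal (2 * Real.pi) ^ 2 with hc
  have hc1 : 1 ≤ c := by
    refine one_le_pow₀ ?_
    rw [← ENNReal.ofReal_one]
    exact ENNReal.ofReal_le_ofReal (by nlinarith [Real.pi_gt_three])
  have h1 : Tendsto (fun n : ℕ => ∫⁻ ξ, {ξ : Plane | (n : ℝ) < jw 1 ξ}.indicator
      (fun ξ => ‖l2Hat h ξ‖ₑ ^ 2) ξ) atTop (𝓝 (∫⁻ _ : Plane, 0)) := by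
    refine tendsto_lintegral_of_dominated_convergence' (fun ξ => ‖l2Hat h ξ‖ₑ ^ 2) (fun n => ?_)
      (fun n => Eventually.of_forall fun ξ => Set.indicator_le_self _ _ _) ?_
      (Eventually.of_forall fun ξ => ?_)
    · exact ((l2Hat_aesm h).enorm.pow_const 2).indicator
        (measurableSet_lt measurable_const (jw_measurable 1))
    · rw [lintegral_l2Hat_sq]
      finiteness
    · refine (tendsto_const_nhds (x := (0 : ℝ≥0∞))).congr' ?_
      filter_upwards [tendsto_natCast_atTop_atTop.eventually_ge_atTop (jw 1 ξ)] with n hn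
      exact (Set.indicator_of_notMem (show ξ ∉ {ξ : Plane | (n : ℝ) < jw 1 ξ} from not_lt.2 hn)
        _).symm
  rw [lintegral_zero] at h1
  refine tendsto_of_tendsto_of_tendsto_of_le_of_le tendsto_const_nhds h1
    (fun n => zero_le) fun n => ?_
  calc ‖op (csymb n 0) h - h‖ₑ ^ 2 ≤ c * ‖op (csymb n 0) h - h‖ₑ ^ 2 :=
        le_mul_of_one_le_left zero_le hc1
    _ = ∫⁻ ξ, ‖l2Hat (op (csymb n 0) h - h) ξ‖ₑ ^ 2 := (lintegral_l2Hat_sq _).symm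
    _ = _ := by
        refine lintegral_congr_ae ?_
        filter_upwards [l2Hat_sub (op (csymb n 0) h) h, l2Hat_op (isSymb_csymb n 0) h] with ξ a b
        rw [a, b, csymb]
        by_cases hξ : (n : ℝ) < jw 1 ξ
        · rw [Set.indicator_of_mem (show ξ ∈ {ξ : Plane | (n : ℝ) < jw 1 ξ} from hξ),
            if_neg (not_le.2 hξ), zero_mul, zero_sub, enorm_neg]
        · rw [Set.indicator_of_notMem (show ξ ∉ {ξ : Plane | (n : ℝ) < jw 1 ξ} from hξ),
            if_pos (not_lt.1 hξ), jw_zero]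
          simp

/-- The product `H^a × H^b → H^b` for `a > 1`, `b ≤ a`, in the coordinates given by `bes`. -/
theorem exists_mul_map {a b : ℝ} (ha : 1 < a) (hb : 0 ≤ b) (hba : b ≤ a) :
    ∃ P : L2 → L2 → L2, (∀ h k, bes b (P h k) =ᵐ[volume] fun z => bes a h z * bes b k z) ∧
      Continuous (fun p : L2 × L2 => P p.1 p.2) ∧ ∃ C, ∀ h k, ‖P h k‖ ≤ C * ‖h‖ * ‖k‖ := by
  obtain ⟨C, hC, hm⟩ := exists_mul_bound hb hba le_rfl (by linarith : 1 < a + b - b)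
  obtain ⟨D, hD, hint⟩ := integrable_l2Hat_bes ha
  choose P hP hPn using fun h k => hm h k (hint h).1
  have hadd1 : ∀ h h' k, P (h + h') k = P h k + P h' k := fun h h' k => by
    apply bes_inj hb
    ext1
    rw [map_add]
    filter_upwards [hP (h + h') k, hP h k, hP h' k, Lp.coeFn_add (bes b (P h k)) (bes b (P h' k)),
      Lp.coeFn_add (bes a h) (bes a h')] with z a1 a2 a3 a4 a5
    rw [a1, a4, Pi.add_apply, a2, a3, map_add, a5, Pi.add_apply, add_mul]
  have hadd2 : ∀ h k k', P h (k + k') = P h k + P h k' := fun h k k' => by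
    apply bes_inj hb
    ext1
    rw [map_add]
    filter_upwards [hP h (k + k'), hP h k, hP h k', Lp.coeFn_add (bes b (P h k)) (bes b (P h k')),
      Lp.coeFn_add (bes b k) (bes b k')] with z a1 a2 a3 a4 a5
    rw [a1, a4, Pi.add_apply, a2, a3, map_add, a5, Pi.add_apply, mul_add]
  have hs1 : ∀ (c : ℝ) h k, P (c • h) k = c • P h k := fun c h k => by
    apply bes_inj hb
    ext1
    rw [map_smul]
    filter_upwards [hP (c • h) k, hP h k, Lp.coeFn_smul c (bes b (P h k)),
      Lp.coeFn_smul c (bes a h)] with z a1 a2 a3 a4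
    rw [a1, a3, Pi.smul_apply, a2, map_smul, a4, Pi.smul_apply, smul_eq_mul, smul_eq_mul, mul_assoc]
  have hs2 : ∀ (c : ℝ) h k, P h (c • k) = c • P h k := fun c h k => by
    apply bes_inj hb
    ext1
    rw [map_smul]
    filter_upwards [hP h (c • k), hP h k, Lp.coeFn_smul c (bes b (P h k)),
      Lp.coeFn_smul c (bes b k)] with z a1 a2 a3 a4
    rw [a1, a3, Pi.smul_apply, a2, map_smul, a4, Pi.smul_apply, smul_eq_mul, smul_eq_mul]
    ring
  refine ⟨P, hP, ?_, C, hPn⟩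
  exact ((LinearMap.mk₂ ℝ P hadd1 hs1 hadd2 hs2).mkContinuous₂ C hPn).continuous₂

theorem continuous_of_pi {ι : Type*} {Φ : (ι → L2) → L2} (hΦ : Continuous Φ) (A : L2 →L[ℝ] L2) :
    Continuous fun h : ι → L2 => Φ fun j => A (h j) :=
  hΦ.comp (continuous_pi fun j => A.continuous.comp (continuous_apply j))

-- For `f = G(u)` one writes `(1 - Δ)^{σ/2} f = (1 - Δ)^{(σ-2)/2} (f - ∑ ∂_i ∂_i f)`. Here `f ∈
-- H^a`, and `∂_i f = ∑ ∂_jG(u) ∂_i u_j` is in `H^{σ-1}` by the product `H^a · H^{σ-1} ⊆ H^{σ-1}`,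
-- where `a > 1` and `a ≥ σ - 1`. The constants `∂_jG(0)` are split off so that the remaining factor
-- vanishes at the origin and can belong to `H^a`.
set_option maxHeartbeats 800000 in
theorem hasComp_step {σ a : ℝ} (hσ : 2 ≤ σ) (ha : 1 < a) (haσ : a ≤ σ) (hσa : σ - 1 ≤ a)
    {G : (Fin 2 → ℝ) → ℝ} (hG : ContDiff ℝ 2 G) (h0 : G 0 = 0) (hc0 : HasComp a G)
    (hc1 : ∀ j, HasComp a fun p => pd j G p - pd j G 0) : HasComp σ G := by
  obtain ⟨Φ, hΦc, hΦb, hΦ⟩ := hc0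
  choose Ψ hΨc hΨb hΨ using hc1
  obtain ⟨P, hP, hPc, K, hK⟩ := exists_mul_map ha (by linarith : 0 ≤ σ - 1) hσa
  obtain ⟨B, hB, hb⟩ := exists_ae_abs_bes_le ha
  set T : (Fin 2 → L2) → (Fin 2 → L2) := fun h j => bes (σ - a) (h j) with hT
  have hTu : ∀ h j, bes a (T h j) = bes σ (h j) := fun h j => by
    rw [hT, bes_bes (by linarith) (by linarith)]
    congr 2
    ring
  set g : Fin 2 → (Fin 2 → L2) → L2 := fun i h =>
    ∑ j, (P (Ψ j (T h)) (dop i (h j)) + pd j G 0 • dop i (h j)) with hg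
  have hgc : ∀ i, Continuous (g i) := fun i => by
    refine continuous_finsetSum _ fun j _ => ?_
    have hd : Continuous (fun h : Fin 2 → L2 => dop i (h j)) :=
      (dop i).continuous.comp (continuous_apply j)
    exact (hPc.comp ((continuous_of_pi (hΨc j) (bes (σ - a))).prodMk hd)).add (hd.const_smul (pd j G 0))
  have hm : IsSymb fun ξ => (jw (σ - 2 - a) ξ : ℂ) := isSymb_jw (by linarith)
  have hf : ∀ h : Fin 2 → L2, bes a (Φ (T h)) = cmp G fun j => bes σ (h j) := fun h => by
    rw [hΦ]
    simp only [hTu]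
  have hgrad : ∀ (i : Fin 2) (u : L2), bes (σ - 1) (dop i u) = op (dsymb i (-σ)) u :=
    fun i u => by
      refine op_op (isSymb_jw (a := -(σ - 1)) (by linarith)) (isSymb_dsymb i le_rfl)
        (isSymb_dsymb i (a := -σ) (by linarith)) (fun ξ => ?_) u
      have : jw (-σ) ξ = jw (-(σ - 1)) ξ * jw (-1) ξ := by rw [← jw_add]; congr 1; ring
      rw [dsymb, dsymb, this]
      push_cast
      ring
  have hD : ∀ (i : Fin 2) (h : Fin 2 → L2), HasD i (cmp G fun j => bes σ (h j)) (bes (σ - 1) (g i h)) := by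
    intro i h
    -- The chain rule holds for frequency truncations, which are smooth. Both sides of it are
    -- continuous in `h`, so it passes to the limit in the bounded form given by `hasD_iff`.
    set H : ℕ → Fin 2 → L2 := fun n j => op (csymb n 0) (h j) with hH
    have hlim : Tendsto H atTop (𝓝 h) := tendsto_pi_nhds.2 fun j => tendsto_csymb (h j)
    have hbl : ∀ (n : ℕ) j, BandLim n (H n j) := fun n j => bandLim_csymb _ _ _
    have hn : ∀ n, HasD i (cmp G fun j => bes σ (H n j)) (bes (σ - 1) (g i (H n))) := by
      intro n
      refine hasD_cmp_bandLim (R := B * ‖T (H n)‖) (lam := n) (hG.of_le (by norm_num)) h0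
        (fun j => (hbl n j).op (isSymb_jw (a := -σ) (by linarith))) (fun j => ?_)
        (fun j => hasD_bes i (by linarith) (H n j))
        (fun j => (hbl n j).op (isSymb_dsymb i (by linarith))) ?_
      · filter_upwards [hb (T (H n) j)] with z hz
        change |bes σ (H n j) z| ≤ _
        rw [← hTu]
        exact hz.trans (mul_le_mul_of_nonneg_left (norm_le_pi_norm _ j) hB)
      · have hu : ∀ j, ∀ᵐ z, |bes a (T (H n) j) z| ≤ B * ‖T (H n)‖ := fun j => by
          filter_upwards [hb (T (H n) j)] with z hz
          exact hz.trans (mul_le_mul_of_nonneg_left (norm_le_pi_norm _ j) hB)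
        have hterm : ∀ j, bes (σ - 1) (P (Ψ j (T (H n))) (dop i (H n j)) + pd j G 0 • dop i (H n j))
            =ᵐ[volume] fun z => pd j G (fun l => bes σ (H n l) z)
              * op (dsymb i (-σ)) (H n j) z := by
          intro j
          have hp : ContDiff ℝ 1 fun p => pd j G p - pd j G 0 :=
            (contDiff_pd (n := 1) (by exact_mod_cast hG) j).sub contDiff_const
          obtain ⟨L, hL0, hL⟩ := exists_lipBall hp (B * ‖T (H n)‖)
          have hmem := memLp_comp hp.continuous (sub_self _) hL hL0
            (u := fun l => bes a (T (H n) l)) hu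
          have hmul := hP (Ψ j (T (H n))) (dop i (H n j))
          rw [hΨ] at hmul
          rw [map_add, map_smul, hgrad]
          rw [hgrad] at hmul
          have hcz := cmp_coe (G := fun p => pd j G p - pd j G 0) hmem
          simp only [hTu] at hmul hcz
          filter_upwards [hmul, hcz, Lp.coeFn_add
            (bes (σ - 1) (P (Ψ j (T (H n))) (dop i (H n j))))
            (pd j G 0 • op (dsymb i (-σ)) (H n j)),
            Lp.coeFn_smul (pd j G 0) (op (dsymb i (-σ)) (H n j))] with z a1 a2 a3 a4
          rw [a3, Pi.add_apply, a4, a1, a2, Pi.smul_apply, smul_eq_mul]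
          ring
        filter_upwards [hterm 0, hterm 1, Lp.coeFn_add
          (bes (σ - 1) (P (Ψ 0 (T (H n))) (dop i (H n 0)) + pd 0 G 0 • dop i (H n 0)))
          (bes (σ - 1) (P (Ψ 1 (T (H n))) (dop i (H n 1)) + pd 1 G 0 • dop i (H n 1)))]
          with z a1 a2 a3
        simp only [hg]
        rw [Fin.sum_univ_two, map_add, a3, Pi.add_apply, a1, a2, Fin.sum_univ_two]
        rfl
    rw [hasD_iff]
    have l1 : Tendsto (fun n => bes 1 (bes (σ - 1) (g i (H n)))) atTop
        (𝓝 (bes 1 (bes (σ - 1) (g i h)))) :=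
      ((bes 1).continuous.comp ((bes (σ - 1)).continuous.comp (hgc i))).tendsto h |>.comp hlim
    have l2 : Tendsto (fun n => op (dsymb i (-1)) (bes a (Φ (T (H n))))) atTop
        (𝓝 (op (dsymb i (-1)) (bes a (Φ (T h))))) :=
      ((op (dsymb i (-1))).continuous.comp ((bes a).continuous.comp
        (continuous_of_pi hΦc (bes (σ - a))))).tendsto h |>.comp hlim
    rw [hf] at l2
    refine tendsto_nhds_unique l1 (l2.congr fun n => ?_)
    rw [hf, (hasD_iff i _ _).1 (hn n)]
  refine ⟨fun h => op (fun ξ => (jw (σ - 2 - a) ξ : ℂ)) (Φ (T h)) - ∑ i, dop i (g i h), ?_, ?_, ?_⟩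
  · refine ((op _).continuous.comp (continuous_of_pi hΦc (bes (σ - a)))).sub
      (continuous_finsetSum _ fun i _ => (dop i).continuous.comp (hgc i))
  · intro R
    obtain ⟨C0, hC0⟩ := hΦb R
    choose C1 hC1 using fun j => hΨb j R
    have hdb : ∀ (h : Fin 2 → L2), (∀ j, ‖h j‖ ≤ R) → ∀ j, ‖T h j‖ ≤ R := fun h hh j =>
      (norm_bes_le (by linarith) _).trans (hh j)
    refine ⟨C0 + ∑ _i : Fin 2, ∑ j, (|K| * C1 j * R + |pd j G 0| * R), fun h hh => ?_⟩
    refine (norm_sub_le _ _).trans (add_le_add ?_ ?_)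
    · have := norm_op_le hm (C := 1) (fun ξ => by
        rw [Complex.norm_real, Real.norm_of_nonneg (jw_pos _ _).le]
        exact jw_le_one (by linarith) ξ) (Φ (T h))
      rw [one_mul] at this
      exact this.trans (hC0 _ (hdb h hh))
    · refine (norm_sum_le _ _).trans (Finset.sum_le_sum fun i _ => ?_)
      refine (norm_dop_le _ _).trans ((norm_sum_le _ _).trans (Finset.sum_le_sum fun j _ => ?_))
      have hdj : ‖dop i (h j)‖ ≤ R := (norm_dop_le _ _).trans (hh j)
      have hR : 0 ≤ R := (norm_nonneg _).trans (hh j)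
      refine (norm_add_le _ _).trans (add_le_add ((hK _ _).trans ?_) ?_)
      · have h1 := hC1 j _ (hdb h hh)
        have h2 := norm_nonneg (Ψ j (T h))
        exact mul_le_mul (mul_le_mul (le_abs_self K) h1 h2 (abs_nonneg K)) hdj (norm_nonneg _)
          (mul_nonneg (abs_nonneg K) (h2.trans h1))
      · rw [norm_smul, Real.norm_eq_abs]
        exact mul_le_mul_of_nonneg_left hdj (abs_nonneg _)
  · intro h
    rw [← hf]
    have hD' := fun i => hD i h
    simp only [← hf] at hD'
    apply l2Hat_inj
    have hσ0 : 0 ≤ σ := by linarith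
    simp only [Fin.sum_univ_two]
    filter_upwards [l2Hat_bes hσ0 (op (fun ξ => (jw (σ - 2 - a) ξ : ℂ)) (Φ (T h))
      - (dop 0 (g 0 h) + dop 1 (g 1 h))), l2Hat_sub (op (fun ξ => (jw (σ - 2 - a) ξ : ℂ)) (Φ (T h)))
      (dop 0 (g 0 h) + dop 1 (g 1 h)), l2Hat_add (dop 0 (g 0 h)) (dop 1 (g 1 h)),
      l2Hat_op (isSymb_dsymb 0 le_rfl) (g 0 h), l2Hat_op (isSymb_dsymb 1 le_rfl) (g 1 h),
      l2Hat_op hm (Φ (T h)), l2Hat_bes (by linarith : 0 ≤ a) (Φ (T h)), hD' 0, hD' 1,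
      l2Hat_bes (by linarith : 0 ≤ σ - 1) (g 0 h), l2Hat_bes (by linarith : 0 ≤ σ - 1) (g 1 h)]
      with ξ b1 b2 b3 b4 b5 b6 b7 b8 b9 c1 c2
    rw [b1, b2, b3, dop, dop, b4, b5, b6, dsymb, dsymb]
    rw [c1, b7] at b8
    rw [c2, b7] at b9
    rw [b7]
    set x := l2Hat (Φ (T h)) ξ
    have e1 : (jw (-σ) ξ : ℂ) * (jw (-1) ξ : ℂ) = (jw (-2) ξ : ℂ) * (jw (-(σ - 1)) ξ : ℂ) := by
      rw [← Complex.ofReal_mul, ← Complex.ofReal_mul, ← jw_add, ← jw_add]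
      congr 2
      ring
    have e2 : (jw (-σ) ξ : ℂ) * (jw (σ - 2 - a) ξ : ℂ) = (jw (-2) ξ : ℂ) * (jw (-a) ξ : ℂ) := by
      rw [← Complex.ofReal_mul, ← Complex.ofReal_mul, ← jw_add, ← jw_add]
      congr 2
      ring
    have e3 : (jw (-2) ξ : ℂ) * (1 + (ξ 0 : ℂ) ^ 2 + (ξ 1 : ℂ) ^ 2) = 1 := by
      have := jw_mul_neg 2 ξ
      rw [jw_two, EuclideanSpace.norm_sq_eq, Fin.sum_univ_two] at this
      simp only [Real.norm_eq_abs, sq_abs] at this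
      rw [← add_assoc] at this
      exact_mod_cast this
    linear_combination x * e2 - Complex.I * ((ξ 0 : ℂ) * l2Hat (g 0 h) ξ + (ξ 1 : ℂ) *
      l2Hat (g 1 h) ξ) * e1 - (jw (-2) ξ : ℂ) * Complex.I * ((ξ 0 : ℂ) * b8 + (ξ 1 : ℂ) * b9)
      - (jw (-2) ξ : ℂ) * (jw (-a) ξ : ℂ) * x * ((ξ 0 : ℂ) ^ 2 + (ξ 1 : ℂ) ^ 2) * Complex.I_sq
      + (jw (-a) ξ : ℂ) * x * e3

/-- Each step of the induction gains at most one order and costs one derivative of `G`. The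
intermediate order is `max (σ - 1) (3 / 2)`, because `σ - 1` alone equals 1 at `σ = 2` and the
algebra property requires more than 1. -/
theorem hasComp {k : ℕ} (hk : 2 ≤ k) {σ : ℝ} (hσ : 1 < σ) (hσk : σ < k)
    {G : (Fin 2 → ℝ) → ℝ} (hG : ContDiff ℝ k G) (h0 : G 0 = 0) : HasComp σ G := by
  induction k, hk using Nat.le_induction generalizing σ G with
  | base => exact hasComp_base hσ (by exact_mod_cast hσk) (by exact_mod_cast hG) h0
  | succ k hk ih =>
    have hk2 : (2 : ℝ) ≤ k := by exact_mod_cast hk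
    have hGk : ContDiff ℝ k G := hG.of_le (by exact_mod_cast k.le_succ)
    push_cast at hσk
    rcases lt_or_ge σ k with h | h
    · exact ih hσ h hGk h0
    · have ha : 1 < max (σ - 1) (3 / 2) := lt_max_of_lt_right (by norm_num)
      have hak : max (σ - 1) (3 / 2) < k := max_lt (by linarith) (by linarith)
      refine hasComp_step (a := max (σ - 1) (3 / 2)) (by linarith) ha
        (max_le (by linarith) (by linarith)) (le_max_left _ _)
        (hGk.of_le (by exact_mod_cast hk)) h0 (ih ha hak hGk h0) fun j => ?_
      exact ih ha hak ((contDiff_pd hG j).sub contDiff_const) (sub_self _)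

/-! ### The force as a map on `X^s` -/

/-- The `L²` class of `∂F/∂w_{x_i}`. -/
def stressL {s : ℝ} (hs : 1 ≤ s) (F : ℝ → ℝ) (i : Fin 2) (w : XSpace s) : L2 :=
  cmp (stressFun F i) (gradOf (w.yco hs))

/-- The constant depends only on the `L^∞` bounds of the gradients, so the difference can be
measured in `H¹`, through `XSpace.yco`, instead of `X^s`. -/
theorem exists_stressL_lip {s : ℝ} (hs : 1 ≤ s) {F : ℝ → ℝ} (hF : ContDiff ℝ 2 F) (i : Fin 2)
    (M : ℝ) : ∃ L : ℝ, 0 ≤ L ∧ ∀ v w : XSpace s, ‖v‖ ≤ M → ‖w‖ ≤ M →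
      ‖stressL hs F i v - stressL hs F i w‖ ≤ L * ‖v.yco hs - w.yco hs‖ := by
  have hG : ContDiff ℝ 1 (stressFun F i) := contDiff_stressFun (n := 1) (by exact_mod_cast hF) i
  obtain ⟨L, hL0, hL⟩ := exists_lipBall hG M
  refine ⟨L * 2, by positivity, fun v w hv hw => ?_⟩
  have hb : ∀ u : XSpace s, ‖u‖ ≤ M → BddAE (gradOf (u.yco hs)) M := fun u hu j => by
    filter_upwards [u.ae_abs_dop_le hs j] with z hz
    exact hz.trans hu
  refine (norm_cmp_sub_le hG.continuous (stressFun_zero F i) hL hL0 (hb v hv) (hb w hw)).trans ?_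
  have h1 : ∀ j, ‖gradOf (v.yco hs) j - gradOf (w.yco hs) j‖ ≤ ‖v.yco hs - w.yco hs‖ := fun j => by
    rw [gradOf, gradOf, ← map_sub]
    exact norm_dop_le _ _
  rw [mul_assoc]
  refine mul_le_mul_of_nonneg_left ?_ hL0
  linarith [h1 0, h1 1]

theorem continuous_stressL {s : ℝ} (hs : 1 ≤ s) {F : ℝ → ℝ} (hF : ContDiff ℝ 2 F) (i : Fin 2) :
    Continuous (stressL hs F i) := by
  rw [continuous_iff_continuousAt]
  intro w
  obtain ⟨L, hL0, hL⟩ := exists_stressL_lip hs hF i (‖w‖ + 1)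
  rw [ContinuousAt, tendsto_iff_norm_sub_tendsto_zero]
  have h1 : Tendsto (fun v : XSpace s => L * ‖v.yco hs - w.yco hs‖) (𝓝 w) (𝓝 0) := by
    have hc : Continuous fun v : XSpace s => L * ‖v.yco hs - w.yco hs‖ := by fun_prop
    have := hc.tendsto w
    simpa using this
  refine squeeze_zero' (Eventually.of_forall fun v => norm_nonneg _) ?_ h1
  filter_upwards [Metric.closedBall_mem_nhds w one_pos] with v hv
  rw [mem_closedBall_iff_norm] at hv
  refine hL v w ?_ (by linarith)
  have := norm_add_le w (v - w)
  rw [add_sub_cancel] at this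
  linarith

theorem exists_stressL_bound {s : ℝ} (hs : 1 ≤ s) {F : ℝ → ℝ} (hF : ContDiff ℝ 2 F) (i : Fin 2)
    (M : ℝ) : ∃ K : ℝ, ∀ w : XSpace s, ‖w‖ ≤ M → ‖stressL hs F i w‖ ≤ K := by
  obtain ⟨L, hL0, hL⟩ := exists_stressL_lip hs hF i (max M 0)
  refine ⟨‖stressL hs F i (0 : XSpace s)‖ + L * (‖XSpace.yco hs‖ * max M 0), fun w hw => ?_⟩
  have h1 := hL w 0 (hw.trans (le_max_left _ _)) (by simp)
  rw [map_zero, sub_zero] at h1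
  have h2 := norm_add_le (stressL hs F i (0 : XSpace s)) (stressL hs F i w - stressL hs F i 0)
  rw [add_sub_cancel] at h2
  have h3 : ‖w.yco hs‖ ≤ ‖XSpace.yco hs‖ * max M 0 :=
    ((XSpace.yco hs).le_opNorm w).trans
      (mul_le_mul_of_nonneg_left (hw.trans (le_max_left _ _)) (norm_nonneg _))
  have h4 := mul_le_mul_of_nonneg_left h3 hL0
  linarith

/-- `G` represents the force of the equation through the Bessel potential of order `ρ`. -/
structure IsForceMap {s : ℝ} (hs : 1 ≤ s) (β : Plane → ℝ) (F : ℝ → ℝ) (ρ : ℝ)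
    (G : XSpace s → L2) : Prop where
  continuous : Continuous G
  bdd : ∀ M, ∃ K, ∀ w, ‖w‖ ≤ M → ‖G w‖ ≤ K
  eq : ∀ w, bes ρ (G w) = ∑ i, op (fun ξ => dsymb i 0 ξ * kernelHat β ξ) (stressL hs F i w)

/-- Counts derivatives: the decay of `β̂` pays for the extra weight of order `a` as long as `a + b +
1 ≤ r`. -/
theorem bes_op_dsymb {β : Plane → ℝ} {r : ℝ} (hβ : IsKernel β r) (i : Fin 2) {a b : ℝ} (ha : 0 ≤ a)
    (hab : a + b + 1 ≤ r) (u : L2) :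
    bes a (op (fun ξ => dsymb i (a + b) ξ * kernelHat β ξ) u)
      = op (fun ξ => dsymb i b ξ * kernelHat β ξ) u := by
  refine op_op (isSymb_jw (by linarith)) (hβ.isSymb_dsymb_mul i hab)
    (hβ.isSymb_dsymb_mul i (by linarith)) (fun ξ => ?_) u
  have : jw b ξ = jw (-a) ξ * jw (a + b) ξ := by rw [← jw_add]; congr 1; ring
  rw [dsymb, dsymb, this]
  push_cast
  ring

theorem op_comm {m n : Plane → ℂ} (hm : IsSymb m) (hn : IsSymb n) (u : L2) :
    op m (op n u) = op n (op m u) := by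
  rw [op_op hm hn (hm.mul hn) fun _ => rfl, op_op hn hm (hm.mul hn) fun _ => mul_comm _ _]

/-- The gradient is in `H^{s-1}` with `s - 1 > 1`. The stress stays there by `hasComp`, since it is
a function of class `C^{⌊s⌋}` of the gradient and `⌊s⌋ > s - 1`. The symbol `i ξ_i β̂` then gains
one order because `r ≥ 2`. -/
theorem exists_isForceMap_of_lt {s r : ℝ} (hs : 1 ≤ s) (hs2 : 2 < s) (hr : 2 ≤ r) {β : Plane → ℝ}
    (hβ : IsKernel β r) {F : ℝ → ℝ} (hF : ContDiff ℝ ((⌊s⌋₊ + 1 : ℕ) : WithTop ℕ∞) F) :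
    ∃ G : XSpace s → L2, IsForceMap hs β F s G := by
  have hk : 2 ≤ ⌊s⌋₊ := Nat.le_floor (by exact_mod_cast hs2.le)
  have hs1 : s - 1 < ⌊s⌋₊ := by linarith [Nat.lt_floor_add_one s]
  have hc := fun i => hasComp hk (by linarith : 1 < s - 1) hs1 (contDiff_stressFun hF i)
    (stressFun_zero F i)
  choose Φ hΦc hΦb hΦ using hc
  have h0 : 0 ≤ s := by linarith
  have e1 : (1 : ℝ) = 1 + 0 := by ring
  have hm := fun i => hβ.isSymb_dsymb_mul i (a := 1 + 0) (by linarith)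
  refine ⟨fun w => ∑ i, op (fun ξ => dsymb i (1 + 0) ξ * kernelHat β ξ)
    (Φ i fun j => dop j (w.lco h0)), ?_, ?_, ?_⟩
  · refine continuous_finsetSum _ fun i _ => (op _).continuous.comp ((hΦc i).comp ?_)
    exact continuous_pi fun j => (dop j).continuous.comp (XSpace.lco h0).continuous
  · intro M
    choose C hC using fun i => hΦb i (‖XSpace.lco (s := s) h0‖ * M)
    refine ⟨∑ i, ‖op fun ξ => dsymb i (1 + 0) ξ * kernelHat β ξ‖ * C i, fun w hw => ?_⟩
    refine (norm_sum_le _ _).trans (Finset.sum_le_sum fun i _ => ?_)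
    refine (ContinuousLinearMap.le_opNorm _ _).trans (mul_le_mul_of_nonneg_left ?_ (norm_nonneg _))
    refine hC i _ fun j => (norm_dop_le _ _).trans ?_
    exact ((XSpace.lco h0).le_opNorm w).trans (mul_le_mul_of_nonneg_left hw (norm_nonneg _))
  · intro w
    rw [map_sum]
    refine Finset.sum_congr rfl fun i _ => ?_
    have hg : (fun j => bes (s - 1) (dop j (w.lco h0))) = gradOf (w.yco hs) := by
      ext1 j
      rw [gradOf, XSpace.yco, ContinuousLinearMap.comp_apply, dop, bes,
        op_comm (isSymb_jw (by linarith)) (isSymb_dsymb j le_rfl)]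
    have hsplit : ∀ u, bes s u = bes 1 (bes (s - 1) u) := fun u => by
      rw [bes_bes zero_le_one (by linarith)]
      congr 2
      ring
    rw [hsplit, bes, bes, op_comm (isSymb_jw (a := -(s - 1)) (by linarith)) (hm i), ← bes, ← bes, hΦ,
      hg, bes_op_dsymb hβ i zero_le_one (by linarith), stressL]

/-- The stress is used only as an element of `L²`; the symbol `i ξ_i β̂` alone gains the order `r -
1 > 2`. -/
theorem exists_isForceMap_of_le {s r : ℝ} (hs : 1 ≤ s) (hr : 3 < r) {β : Plane → ℝ}
    (hβ : IsKernel β r) {F : ℝ → ℝ} (hF : ContDiff ℝ 2 F) :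
    ∃ G : XSpace s → L2, IsForceMap hs β F (r - 1) G := by
  refine ⟨fun w => ∑ i, op (fun ξ => dsymb i (r - 1 + 0) ξ * kernelHat β ξ) (stressL hs F i w),
    ?_, ?_, ?_⟩
  · exact continuous_finsetSum _ fun i _ => (op _).continuous.comp (continuous_stressL hs hF i)
  · intro M
    choose K hK using fun i => exists_stressL_bound hs hF i M
    refine ⟨∑ i, ‖op fun ξ => dsymb i (r - 1 + 0) ξ * kernelHat β ξ‖ * K i, fun w hw => ?_⟩
    refine (norm_sum_le _ _).trans (Finset.sum_le_sum fun i _ => ?_)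
    exact (ContinuousLinearMap.le_opNorm _ _).trans
      (mul_le_mul_of_nonneg_left (hK i w hw) (norm_nonneg _))
  · intro w
    rw [map_sum]
    refine Finset.sum_congr rfl fun i _ => ?_
    rw [bes_op_dsymb hβ i (by linarith) (by linarith)]

theorem contDiff_two {s : ℝ} (hs : 1 ≤ s) {F : ℝ → ℝ}
    (hF : ContDiff ℝ ((⌊s⌋₊ + 1 : ℕ) : WithTop ℕ∞) F) : ContDiff ℝ 2 F := by
  have h1 : 1 ≤ ⌊s⌋₊ := Nat.le_floor (by exact_mod_cast hs)
  refine hF.of_le ?_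
  exact_mod_cast (by omega : 2 ≤ ⌊s⌋₊ + 1)

theorem exists_isForceMap {s r : ℝ} (hs : 1 ≤ s) (hsr : (2 < s ∧ 2 ≤ r) ∨ (1 ≤ s ∧ 3 < r))
    {β : Plane → ℝ} (hβ : IsKernel β r) {F : ℝ → ℝ}
    (hF : ContDiff ℝ ((⌊s⌋₊ + 1 : ℕ) : WithTop ℕ∞) F) :
    ∃ ρ : ℝ, 2 < ρ ∧ s ≤ ρ ∧ ∃ G : XSpace s → L2, IsForceMap hs β F ρ G := by
  rcases lt_or_ge 2 s with h | h
  · exact ⟨s, h, le_rfl, exists_isForceMap_of_lt hs h (by rcases hsr with h | h <;> linarith) hβ hF⟩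
  · have hr : 3 < r := by rcases hsr with h' | h' <;> linarith
    exact ⟨r - 1, by linarith, by linarith, exists_isForceMap_of_le hs hr hβ (contDiff_two hs hF)⟩

/-- The force map is Lipschitz on bounded sets in the energy norm. -/
theorem IsForceMap.exists_lip {s r ρ : ℝ} {hs : 1 ≤ s} {β : Plane → ℝ} {F : ℝ → ℝ}
    {G : XSpace s → L2} (hG : IsForceMap hs β F ρ G) (hρ : 1 ≤ ρ) (hr : 2 ≤ r)
    (hβ : IsKernel β r) (hF : ContDiff ℝ 2 F) (M : ℝ) :
    ∃ L : ℝ, 0 ≤ L ∧ ∀ v w : XSpace s, ‖v‖ ≤ M → ‖w‖ ≤ M →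
      ‖bes (ρ - 1) (G v - G w)‖ ≤ L * ‖v.yco hs - w.yco hs‖ := by
  choose L hL0 hL using fun i => exists_stressL_lip hs hF i M
  refine ⟨∑ i, ‖op fun ξ => dsymb i (1 + 0) ξ * kernelHat β ξ‖ * L i,
    Finset.sum_nonneg fun i _ => mul_nonneg (norm_nonneg _) (hL0 i), fun v w hv hw => ?_⟩
  -- The left-hand side is `(1 - Δ)^{1/2}` of the force, so the estimate concerns the `H¹` norm of
  -- the force. The remaining symbol `i ξ_i (1 + |ξ|²)^{1/2} β̂` is bounded because `r ≥ 2`.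
  have e : ∀ u, bes (ρ - 1) (G u)
      = ∑ i, op (fun ξ => dsymb i (1 + 0) ξ * kernelHat β ξ) (stressL hs F i u) := fun u => by
    apply bes_inj zero_le_one
    rw [bes_bes zero_le_one (by linarith), show 1 + (ρ - 1) = ρ by ring, hG.eq, map_sum]
    refine Finset.sum_congr rfl fun i _ => ?_
    rw [bes_op_dsymb hβ i zero_le_one (by linarith)]
  rw [map_sub, e, e, ← Finset.sum_sub_distrib, Finset.sum_mul]
  refine (norm_sum_le _ _).trans (Finset.sum_le_sum fun i _ => ?_)
  rw [← map_sub, mul_assoc]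
  exact (ContinuousLinearMap.le_opNorm _ _).trans
    (mul_le_mul_of_nonneg_left (hL i v w hv hw) (norm_nonneg _))

/-- Bessel potentials of balls are closed. -/
theorem exists_of_tendsto_bes {a : ℝ} (ha : 0 ≤ a) {h : ℕ → L2} {y : L2} {M : ℝ}
    (hM : ∀ n, ‖h n‖ ≤ M) (hy : Tendsto (fun n => bes a (h n)) atTop (𝓝 y)) :
    ∃ l, bes a l = y ∧ ‖l‖ ≤ M := by
  have hM0 : 0 ≤ M := (norm_nonneg _).trans (hM 0)
  set c := ENNReal.ofReal (2 * Real.pi) ^ 2 with hc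
  -- Each frequency truncation of `(1 - Δ)^{a/2} y` is a limit of truncations of `h n`, hence
  -- bounded by `M`; Fatou's lemma then removes the truncation.
  have hcut : ∀ lam : ℝ, ‖op (csymb lam a) y‖ ≤ M := by
    intro lam
    have hl : Tendsto (fun n => ‖op (csymb lam a) (bes a (h n))‖) atTop
        (𝓝 ‖op (csymb lam a) y‖) :=
      ((op (csymb lam a)).continuous.norm.tendsto y).comp hy
    refine le_of_tendsto' hl fun n => ?_
    rw [bes, op_comm (isSymb_csymb lam a) (isSymb_jw (by linarith)), ← bes, bes_csymb ha, sub_self]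
    exact (norm_csymb_zero_le _ _).trans (hM n)
  have hsq : sobolevNorm a y ^ 2 ≤ c * ENNReal.ofReal M ^ 2 := by
    rw [sobolevNorm_sq]
    have hind : ∀ ξ, liminf (fun n : ℕ => {ξ : Plane | jw 1 ξ ≤ n}.indicator
        (fun ξ => ENNReal.ofReal (jw (2 * a) ξ) * ‖l2Hat y ξ‖ₑ ^ 2) ξ) atTop
        = ENNReal.ofReal (jw (2 * a) ξ) * ‖l2Hat y ξ‖ₑ ^ 2 := fun ξ => by
      refine Tendsto.liminf_eq (tendsto_const_nhds.congr' ?_)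
      filter_upwards [tendsto_natCast_atTop_atTop.eventually_ge_atTop (jw 1 ξ)] with n hn
      rw [Set.indicator_of_mem (show ξ ∈ {ξ : Plane | jw 1 ξ ≤ n} from hn)]
    rw [lintegral_congr fun ξ => (hind ξ).symm]
    have hm : ∀ n : ℕ, MeasurableSet {ξ : Plane | jw 1 ξ ≤ n} := fun n =>
      measurableSet_le (jw_measurable 1) measurable_const
    refine (lintegral_liminf_le' fun n => ?_).trans ?_
    · exact (((jw_measurable _).ennreal_ofReal.aemeasurable).mul
        ((l2Hat_aesm y).enorm.pow_const 2)).indicator (hm n)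
    · refine (liminf_le_liminf (v := fun _ => c * ENNReal.ofReal M ^ 2)
        (Eventually.of_forall fun n => ?_)).trans_eq (liminf_const _)
      calc _ = ∫⁻ ξ, ‖l2Hat (op (csymb n a) y) ξ‖ₑ ^ 2 := by
            refine lintegral_congr_ae ?_
            filter_upwards [l2Hat_op (isSymb_csymb n a) y] with ξ e
            rw [e, csymb]
            by_cases hξ : jw 1 ξ ≤ n
            · rw [Set.indicator_of_mem (show ξ ∈ {ξ : Plane | jw 1 ξ ≤ n} from hξ), if_pos hξ,
                enorm_mul, mul_pow, ← ofReal_norm ((jw a ξ : ℝ) : ℂ), Complex.norm_real,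
                Real.norm_of_nonneg (jw_pos _ _).le, ← ENNReal.ofReal_pow (jw_pos _ _).le,
                sq (jw a ξ), ← jw_add, two_mul]
            · rw [Set.indicator_of_notMem (show ξ ∉ {ξ : Plane | jw 1 ξ ≤ n} from hξ), if_neg hξ]
              simp
        _ = c * ‖op (csymb n a) y‖ₑ ^ 2 := lintegral_l2Hat_sq _
        _ ≤ _ := by
            gcongr
            rw [← ofReal_norm]
            exact ENNReal.ofReal_le_ofReal (hcut n)
  obtain ⟨l, hl⟩ := exists_bes_eq ha (u := y) (by
    by_contra h2
    rw [not_lt, top_le_iff] at h2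
    rw [h2] at hsq
    have : c * ENNReal.ofReal M ^ 2 < ⊤ := by finiteness
    rw [ENNReal.top_pow two_ne_zero, top_le_iff] at hsq
    exact this.ne hsq)
  refine ⟨l, hl, ?_⟩
  rw [← hl, sobolevNorm_bes ha, mul_pow] at hsq
  have hc0 : c ≠ 0 := by
    rw [hc]
    simpa using Real.pi_pos
  rw [← hc, ENNReal.mul_le_mul_iff_right hc0 (by finiteness)] at hsq
  have h3 : ‖l‖ₑ ≤ ENNReal.ofReal M := (ENNReal.pow_le_pow_left_iff two_ne_zero).1 hsq
  rw [← ofReal_norm] at h3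
  exact (ENNReal.ofReal_le_ofReal_iff hM0).1 h3

/-! ### Second order equations with a Lipschitz condition in a weaker norm -/

section Abstract

variable {H : Type*} [NormedAddCommGroup H] [NormedSpace ℝ H]

/-- The second primitive `∫_a^t (t - v) n(v) dv`. -/
def prim2 (a : ℝ) (n : ℝ → H) (t : ℝ) : H := ∫ v in a..t, (t - v) • n v

theorem prim2_congr {a t : ℝ} {m n : ℝ → H} (hat : a ≤ t) (h : ∀ v ∈ Set.Icc a t, m v = n v) :
    prim2 a m t = prim2 a n t := by
  refine intervalIntegral.integral_congr fun v hv => ?_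
  rw [Set.uIcc_of_le hat] at hv
  simp only [h v hv]

theorem prim2_eq {a t : ℝ} {n : ℝ → H} (hn : IntervalIntegrable n volume a t) :
    prim2 a n t = t • (∫ v in a..t, n v) - ∫ v in a..t, v • n v := by
  have h2 : IntervalIntegrable (fun v => v • n v) volume a t :=
    hn.continuousOn_smul continuousOn_id
  rw [prim2, ← intervalIntegral.integral_smul]
  simp only [sub_smul]
  exact intervalIntegral.integral_sub (hn.smul t) h2

theorem norm_prim2_le {n : ℝ → H} {a t τ K : ℝ} (hat : a ≤ t) (ht : t ≤ a + τ) (hK : 0 ≤ K)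
    (h : ∀ v ∈ Set.Icc a (a + τ), ‖n v‖ ≤ K) : ‖prim2 a n t‖ ≤ τ * K * τ := by
  have hτ : 0 ≤ τ := by linarith
  refine (intervalIntegral.norm_integral_le_of_norm_le_const (C := τ * K) fun v hv => ?_).trans ?_
  · rw [Set.uIoc_of_le hat] at hv
    rw [norm_smul, Real.norm_of_nonneg (by linarith [hv.2])]
    exact mul_le_mul (by linarith [hv.1]) (h v ⟨hv.1.le, hv.2.trans ht⟩) (norm_nonneg _) hτ
  · rw [abs_of_nonneg (by linarith)]
    exact mul_le_mul_of_nonneg_left (by linarith) (by positivity)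

/-- Restarting the motion at `b`: position and velocity reached at `b`, plus the second primitive
taken from `b`. This glues solutions in `exists_continuation`. -/
theorem prim2_add {a b t : ℝ} {n : ℝ → H}
    (h1 : IntervalIntegrable n volume a b) (h2 : IntervalIntegrable n volume b t) :
    prim2 a n t = prim2 a n b + (t - b) • (∫ v in a..b, n v) + prim2 b n t := by
  have i1 : IntervalIntegrable (fun v => v • n v) volume a b := h1.continuousOn_smul continuousOn_id
  have i2 : IntervalIntegrable (fun v => v • n v) volume b t := h2.continuousOn_smul continuousOn_id
  rw [prim2_eq (h1.trans h2), prim2_eq h1, prim2_eq h2,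
    ← intervalIntegral.integral_add_adjacent_intervals h1 h2,
    ← intervalIntegral.integral_add_adjacent_intervals i1 i2]
  module

theorem intervalIntegrable_of_bound {E : Type*} [NormedAddCommGroup E] {T₀ : ℝ} (hT0 : 0 < T₀)
    {p : ℝ → E}
    (hp : ContinuousOn p (Set.Ico 0 T₀)) {K : ℝ} (hK : ∀ᶠ t in 𝓝[<] T₀, ‖p t‖ ≤ K) :
    IntervalIntegrable p volume 0 T₀ := by
  obtain ⟨l, hl, hlK⟩ := mem_nhdsLT_iff_exists_Ioo_subset.1 hK
  have hl : l < T₀ := hl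
  set c := max 0 ((l + T₀) / 2) with hc
  have hc0 : 0 ≤ c := le_max_left _ _
  have hcT : c < T₀ := max_lt hT0 (by linarith)
  have hlc : l < c := lt_max_of_lt_right (by linarith)
  have i1 : IntervalIntegrable p volume 0 c := by
    refine ContinuousOn.intervalIntegrable (hp.mono ?_)
    rw [Set.uIcc_of_le hc0]
    exact fun x hx => ⟨hx.1, hx.2.trans_lt hcT⟩
  refine i1.trans ?_
  rw [intervalIntegrable_iff_integrableOn_Ico_of_le hcT.le]
  have hm : AEStronglyMeasurable p (volume.restrict (Set.Ico c T₀)) :=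
    (hp.mono fun x hx => ⟨hc0.trans hx.1, hx.2⟩).aestronglyMeasurable measurableSet_Ico
  refine IntegrableOn.of_bound (by simp) hm K ?_
  rw [ae_restrict_iff' measurableSet_Ico]
  exact Eventually.of_forall fun t ht => hlK ⟨hlc.trans_le ht.1, ht.2⟩

variable [CompleteSpace H]

theorem hasDerivAt_prim2 {n : ℝ → H} (hn : Continuous n) (a t : ℝ) :
    HasDerivAt (prim2 a n) (∫ v in a..t, n v) t := by
  have e : prim2 a n = fun t => t • (∫ v in a..t, n v) - ∫ v in a..t, v • n v :=
    funext fun t => prim2_eq (hn.intervalIntegrable a t)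
  rw [e]
  have h1 := hn.integral_hasStrictDerivAt a t |>.hasDerivAt
  have h2 := (continuous_id.smul hn).integral_hasStrictDerivAt a t |>.hasDerivAt
  have h3 := ((hasDerivAt_id t).smul h1).sub h2
  refine h3.congr_deriv ?_
  simp

/-- Local solvability of `h'' = N(t, h)` if `N` is bounded on bounded sets and Lipschitz there in
the weaker norm `‖S ·‖`. -/
theorem exists_local_solution (S : H →L[ℝ] H) (hinj : Function.Injective S)
    (hS : ∀ (h : ℕ → H) (y : H) (M : ℝ), (∀ n, ‖h n‖ ≤ M) →
      Tendsto (fun n => S (h n)) atTop (𝓝 y) → ∃ l, S l = y ∧ ‖l‖ ≤ M)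
    {N : ℝ → H → H} (hN : Continuous fun p : ℝ × H => N p.1 p.2) {a : ℝ}
    (hb : ∀ M, ∃ K, ∀ t ∈ Set.Icc a (a + 1), ∀ h, ‖h‖ ≤ M → ‖N t h‖ ≤ K)
    (hL : ∀ M, ∃ L : ℝ, 0 ≤ L ∧ ∀ t ∈ Set.Icc a (a + 1), ∀ h k, ‖h‖ ≤ M → ‖k‖ ≤ M →
      ‖S (N t h - N t k)‖ ≤ L * ‖S (h - k)‖) (c d : H) :
    ∃ τ : ℝ, 0 < τ ∧ ∃ h : ℝ → H, Continuous h ∧ ∀ t ∈ Set.Icc a (a + τ),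
      h t = c + (t - a) • d + prim2 a (fun v => N v (h v)) t := by
  set M : ℝ := ‖c‖ + ‖d‖ + 1 with hM
  have hM0 : 0 ≤ M := by positivity
  obtain ⟨K', hK'⟩ := hb M
  set K := max K' 0 with hKdef
  have hK0 : 0 ≤ K := le_max_right _ _
  obtain ⟨L, hL0, hLip⟩ := hL M
  -- This makes `τ`, `τ * K` and `τ * L` at most `1 / 2`. The first two keep the ball of radius `M`
  -- invariant and the velocities below `‖d‖ + 1`; the last gives a contraction with factor `1 / 2`
  -- in the norm `‖S ·‖`.
  set τ : ℝ := 1 / (2 * (K + L + 1)) with hτ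
  have hτ0 : 0 < τ := by positivity
  have hτe : τ * (2 * (K + L + 1)) = 1 := by rw [hτ]; field_simp
  have hτ1 : τ ≤ 1 / 2 := by nlinarith [mul_nonneg hτ0.le hK0, mul_nonneg hτ0.le hL0]
  have hτK : τ * K ≤ 1 / 2 := by nlinarith [mul_nonneg hτ0.le hL0]
  have hτL : τ * L ≤ 1 / 2 := by nlinarith [mul_nonneg hτ0.le hK0]
  set J := Set.Icc a (a + τ) with hJ
  have hJsub : J ⊆ Set.Icc a (a + 1) := Set.Icc_subset_Icc_right (by linarith)
  have hK : ∀ t ∈ J, ∀ h, ‖h‖ ≤ M → ‖N t h‖ ≤ K := fun t ht h hh =>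
    (hK' t (hJsub ht) h hh).trans (le_max_left _ _)
  set A : (ℝ → H) → ℝ → H := fun h t => c + (t - a) • d + prim2 a (fun v => N v (h v)) t with hA
  have hNc : ∀ h : ℝ → H, Continuous h → Continuous fun v => N v (h v) := fun h hh =>
    hN.comp (continuous_id.prodMk hh)
  have hAd : ∀ h : ℝ → H, Continuous h → ∀ t,
      HasDerivAt (A h) (d + ∫ v in a..t, N v (h v)) t := fun h hh t => by
    have h1 : HasDerivAt (fun t : ℝ => c + (t - a) • d) d t := by
      have := (((hasDerivAt_id t).sub_const a).smul_const d).const_add c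
      simpa using this
    exact h1.add (hasDerivAt_prim2 (hNc h hh) a t)
  have hAc : ∀ h : ℝ → H, Continuous h → Continuous (A h) := fun h hh =>
    continuous_iff_continuousAt.2 fun t => (hAd h hh t).continuousAt
  have hAM : ∀ h : ℝ → H, (∀ t ∈ J, ‖h t‖ ≤ M) → ∀ t ∈ J, ‖A h t‖ ≤ M := by
    intro h hh t ht
    have h1 := norm_prim2_le ht.1 ht.2 hK0 fun v hv => hK v hv _ (hh v hv)
    have h2 : ‖(t - a) • d‖ ≤ ‖d‖ := by
      rw [norm_smul, Real.norm_of_nonneg (by linarith [ht.1])]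
      exact mul_le_of_le_one_left (norm_nonneg _) (by linarith [ht.2])
    have h3 : τ * K * τ ≤ 1 := by nlinarith
    calc ‖A h t‖ ≤ ‖c‖ + ‖(t - a) • d‖ + ‖prim2 a (fun v => N v (h v)) t‖ := norm_add₃_le
      _ ≤ M := by linarith
  have hAlip : ∀ h : ℝ → H, Continuous h → (∀ t ∈ J, ‖h t‖ ≤ M) → ∀ t ∈ J, ∀ t' ∈ J,
      ‖A h t - A h t'‖ ≤ (‖d‖ + 1) * ‖t - t'‖ := by
    intro h hc hh t ht t' ht'
    refine (convex_Icc a (a + τ)).norm_image_sub_le_of_norm_hasDerivWithin_le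
      (fun x _ => (hAd h hc x).hasDerivWithinAt) (fun x hx => ?_) ht' ht
    refine (norm_add_le _ _).trans (add_le_add le_rfl ?_)
    refine (intervalIntegral.norm_integral_le_of_norm_le_const (C := K) fun v hv => ?_).trans ?_
    · rw [Set.uIoc_of_le hx.1] at hv
      have hvJ : v ∈ J := ⟨hv.1.le, hv.2.trans hx.2⟩
      exact hK v hvJ _ (hh v hvJ)
    · rw [abs_of_nonneg (by linarith [hx.1])]
      nlinarith [hx.2]
  have hAcontr : ∀ (h k : ℝ → H) (ε : ℝ), Continuous h → Continuous k → (∀ t ∈ J, ‖h t‖ ≤ M) →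
      (∀ t ∈ J, ‖k t‖ ≤ M) → 0 ≤ ε → (∀ t ∈ J, ‖S (h t - k t)‖ ≤ ε) →
      ∀ t ∈ J, ‖S (A h t - A k t)‖ ≤ ε / 2 := by
    intro h k ε hh hk hhM hkM hε hd t ht
    have e : S (A h t - A k t) = prim2 a (fun v => S (N v (h v) - N v (k v))) t := by
      have i1 : ∀ h : ℝ → H, Continuous h →
          IntervalIntegrable (fun v => (t - v) • N v (h v)) volume a t := fun h hh =>
        ((continuous_const.sub continuous_id).smul (hNc h hh)).intervalIntegrable a t
      have e1 : A h t - A k t = ∫ v in a..t, ((t - v) • N v (h v) - (t - v) • N v (k v)) := by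
        rw [intervalIntegral.integral_sub (i1 h hh) (i1 k hk)]
        simp only [hA, prim2]
        abel
      rw [e1, ← ContinuousLinearMap.intervalIntegral_comp_comm _ ((i1 h hh).sub (i1 k hk)), prim2]
      refine intervalIntegral.integral_congr fun v _ => ?_
      simp only [← smul_sub, map_smul]
    rw [e]
    refine (norm_prim2_le ht.1 ht.2 (mul_nonneg hL0 hε) fun v hv => ?_).trans ?_
    · exact (hLip v (hJsub hv) _ _ (hhM v hv) (hkM v hv)).trans
        (mul_le_mul_of_nonneg_left (hd v hv) hL0)
    · have : τ * (L * ε) * τ = (τ * L) * τ * ε := by ring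
      rw [this]
      have h1 : (τ * L) * τ ≤ 1 / 2 := by nlinarith [mul_nonneg hτ0.le hL0]
      nlinarith
  set u : ℕ → ℝ → H := fun n => A^[n] fun _ => c with hu
  have hus : ∀ n, u (n + 1) = A (u n) := fun n => Function.iterate_succ_apply' A n _
  have huc : ∀ n, Continuous (u n) := fun n => by
    induction n with
    | zero => exact continuous_const
    | succ n ih =>
      rw [hus]
      exact hAc _ ih
  have huM : ∀ n, ∀ t ∈ J, ‖u n t‖ ≤ M := fun n => by
    induction n with
    | zero =>
      intro t _
      change ‖c‖ ≤ M
      linarith [norm_nonneg d]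
    | succ n ih =>
      rw [hus]
      exact hAM _ ih
  have hulip : ∀ n, ∀ t ∈ J, ∀ t' ∈ J, ‖u n t - u n t'‖ ≤ (‖d‖ + 1) * ‖t - t'‖ := fun n => by
    cases n with
    | zero =>
      intro t _ t' _
      change ‖c - c‖ ≤ _
      rw [sub_self, norm_zero]
      positivity
    | succ n =>
      rw [hus]
      exact hAlip _ (huc n) (huM n)
  set D : ℝ := ‖S‖ * (M + M) with hD
  have hD0 : 0 ≤ D := by positivity
  have hgeo : ∀ n, ∀ t ∈ J, ‖S (u n t - u (n + 1) t)‖ ≤ D * (1 / 2) ^ n := fun n => by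
    induction n with
    | zero =>
      intro t ht
      rw [pow_zero, mul_one]
      refine (S.le_opNorm _).trans (mul_le_mul_of_nonneg_left ?_ (norm_nonneg _))
      exact (norm_sub_le _ _).trans (add_le_add (huM _ t ht) (huM _ t ht))
    | succ n ih =>
      intro t ht
      have := hAcontr (u n) (u (n + 1)) _ (huc _) (huc _) (huM _) (huM _) (by positivity) ih t ht
      rw [hus n, hus (n + 1)]
      refine this.trans_eq ?_
      rw [pow_succ]
      ring
  have hdist : ∀ t ∈ J, ∀ n, dist (S (u n t)) (S (u (n + 1) t)) ≤ D * (1 / 2) ^ n := fun t ht n => by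
    rw [dist_eq_norm, ← map_sub]
    exact hgeo n t ht
  have hlim : ∀ t : J, ∃ l, Tendsto (fun n => S (u n t)) atTop (𝓝 (S l)) ∧ ‖l‖ ≤ M := fun t => by
    obtain ⟨y, hy⟩ := cauchySeq_tendsto_of_complete
      (cauchySeq_of_le_geometric (1 / 2) D (by norm_num) (hdist t t.2))
    obtain ⟨l, hl, hlM⟩ := hS _ y M (fun n => huM n t t.2) hy
    exact ⟨l, hl ▸ hy, hlM⟩
  choose h hh hhM using hlim
  -- Convergence in `‖S ·‖` does not by itself give strong continuity of the limit. The iterates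
  -- share a strong Lipschitz bound in time, and it survives because balls are closed in the weak
  -- norm.
  have hhlip : ∀ t t' : J, ‖h t - h t'‖ ≤ (‖d‖ + 1) * ‖(t : ℝ) - t'‖ := fun t t' => by
    have h1 : Tendsto (fun n => S (u n t - u n t')) atTop (𝓝 (S (h t) - S (h t'))) := by
      simpa only [map_sub] using (hh t).sub (hh t')
    obtain ⟨l, hl, hlM⟩ := hS _ _ _ (fun n => hulip n t t.2 t' t'.2) h1
    rw [← map_sub] at hl
    rwa [hinj hl] at hlM
  have hhc : Continuous h := by
    have : LipschitzWith (Real.toNNReal (‖d‖ + 1)) h := LipschitzWith.of_dist_le_mul fun t t' => by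
      rw [dist_eq_norm, Real.coe_toNNReal _ (by positivity)]
      exact hhlip t t'
    exact this.continuous
  have hle : a ≤ a + τ := by linarith
  set g : ℝ → H := Set.IccExtend hle h with hg
  have hgc : Continuous g := hhc.Icc_extend'
  have hgJ : ∀ t (ht : t ∈ J), g t = h ⟨t, ht⟩ := fun t ht => Set.IccExtend_of_mem hle h ht
  have hgM : ∀ t ∈ J, ‖g t‖ ≤ M := fun t ht => by
    rw [hgJ t ht]
    exact hhM _
  refine ⟨τ, hτ0, g, hgc, fun t ht => hinj ?_⟩
  have herr : ∀ n, ∀ t ∈ J, ‖S (u n t - g t)‖ ≤ D * (1 / 2) ^ n / (1 - 1 / 2) := fun n t ht => by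
    have := dist_le_of_le_geometric_of_tendsto (1 / 2) D (by norm_num) (hdist t ht)
      (hh ⟨t, ht⟩) n
    rwa [dist_eq_norm, ← map_sub, ← hgJ t ht] at this
  have hz : Tendsto (fun n : ℕ => D * (1 / 2 : ℝ) ^ n / (1 - 1 / 2) / 2) atTop (𝓝 0) := by
    have := (((tendsto_pow_atTop_nhds_zero_of_lt_one (r := (1 / 2 : ℝ)) (by norm_num)
      (by norm_num)).const_mul D).div_const (1 - 1 / 2)).div_const 2
    simpa using this
  have l1 : Tendsto (fun n => S (u (n + 1) t)) atTop (𝓝 (S (A g t))) := by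
    rw [tendsto_iff_norm_sub_tendsto_zero]
    refine squeeze_zero (fun n => norm_nonneg _) (fun n => ?_) hz
    rw [← map_sub, hus]
    exact hAcontr (u n) g _ (huc n) hgc (huM n) hgM
      (by have : (0 : ℝ) < 1 - 1 / 2 := by norm_num
          positivity) (herr n) t ht
  have l2 : Tendsto (fun n => S (u (n + 1) t)) atTop (𝓝 (S (g t))) := by
    rw [hgJ t ht]
    exact (tendsto_add_atTop_iff_nat 1).2 (hh ⟨t, ht⟩)
  exact tendsto_nhds_unique l2 l1

/-- Solutions of `p = N(t, h)`, `h'' = p` on `[0, T₀)` with integrable `p` can be continued. -/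
theorem exists_continuation (S : H →L[ℝ] H) (hinj : Function.Injective S)
    (hS : ∀ (h : ℕ → H) (y : H) (M : ℝ), (∀ n, ‖h n‖ ≤ M) →
      Tendsto (fun n => S (h n)) atTop (𝓝 y) → ∃ l, S l = y ∧ ‖l‖ ≤ M)
    {N : ℝ → H → H} (hN : Continuous fun p : ℝ × H => N p.1 p.2) {T₀ : ℝ}
    (hb : ∀ M, ∃ K, ∀ t ∈ Set.Icc T₀ (T₀ + 1), ∀ h, ‖h‖ ≤ M → ‖N t h‖ ≤ K)
    (hL : ∀ M, ∃ L : ℝ, 0 ≤ L ∧ ∀ t ∈ Set.Icc T₀ (T₀ + 1), ∀ h k, ‖h‖ ≤ M → ‖k‖ ≤ M →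
      ‖S (N t h - N t k)‖ ≤ L * ‖S (h - k)‖) (hT0 : 0 < T₀) {p : ℝ → H}
    (hp : IntervalIntegrable p volume 0 T₀)
    (hpN : ∀ t ∈ Set.Ico 0 T₀, p t = N t (prim2 0 p t)) :
    ∃ τ : ℝ, 0 < τ ∧ ∃ m : ℝ → H, Continuous m ∧
      (∀ t ∈ Set.Ico 0 T₀, prim2 0 m t = prim2 0 p t) ∧
      ∀ t ∈ Set.Icc 0 (T₀ + τ), m t = N t (prim2 0 m t) := by
  obtain ⟨τ, hτ, g, hgc, hg⟩ := exists_local_solution S hinj hS hN hb hL (prim2 0 p T₀)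
    (∫ v in (0 : ℝ)..T₀, p v)
  set n : ℝ → H := fun t => if t < T₀ then p t else N t (g t) with hn
  have hn1 : ∀ t, t < T₀ → n t = p t := fun t ht => if_pos ht
  have hn2 : ∀ t, T₀ ≤ t → n t = N t (g t) := fun t ht => if_neg (not_lt.2 ht)
  have hNg : Continuous fun t => N t (g t) := hN.comp (continuous_id.prodMk hgc)
  have hne : ∀ᵐ v : ℝ, v ≠ T₀ := by simp [ae_iff, measure_singleton]
  have i1 : IntervalIntegrable n volume 0 T₀ := by
    refine hp.congr_ae ?_
    rw [Set.uIoc_of_le hT0.le, EventuallyEq, ae_restrict_iff' measurableSet_Ioc]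
    filter_upwards [hne] with t ht hI
    exact (hn1 t (lt_of_le_of_ne hI.2 ht)).symm
  have e1 : ∀ t, t ≤ T₀ → 0 ≤ t → prim2 0 n t = prim2 0 p t ∧
      ∫ v in (0 : ℝ)..t, n v = ∫ v in (0 : ℝ)..t, p v := fun t ht h0 => by
    constructor
    · refine intervalIntegral.integral_congr_ae ?_
      filter_upwards [hne] with v hv hI
      rw [Set.uIoc_of_le h0] at hI
      rw [hn1 v (lt_of_le_of_ne (hI.2.trans ht) hv)]
    · refine intervalIntegral.integral_congr_ae ?_
      filter_upwards [hne] with v hv hI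
      rw [Set.uIoc_of_le h0] at hI
      rw [hn1 v (lt_of_le_of_ne (hI.2.trans ht) hv)]
  have i2 : ∀ t, T₀ ≤ t → IntervalIntegrable n volume T₀ t := fun t ht => by
    refine (hNg.intervalIntegrable T₀ t).congr fun v hv => ?_
    rw [Set.uIoc_of_le ht] at hv
    exact (hn2 v hv.1.le).symm
  have e2 : ∀ t ∈ Set.Icc T₀ (T₀ + τ), prim2 0 n t = g t := fun t ht => by
    rw [prim2_add i1 (i2 t ht.1), (e1 T₀ le_rfl hT0.le).1, (e1 T₀ le_rfl hT0.le).2, hg t ht]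
    congr 1
    exact prim2_congr ht.1 fun v hv => hn2 v hv.1
  have hfix : ∀ t ∈ Set.Icc 0 (T₀ + τ), n t = N t (prim2 0 n t) := fun t ht => by
    rcases lt_or_ge t T₀ with htT | htT
    · rw [(e1 t htT.le ht.1).1, hn1 t htT, ← hpN t ⟨ht.1, htT⟩]
    · rw [e2 t ⟨htT, ht.2⟩, hn2 t htT]
  have hle : (0 : ℝ) ≤ T₀ + τ := by linarith
  have i3 : IntervalIntegrable n volume 0 (T₀ + τ) := i1.trans (i2 _ (by linarith))
  -- Continuity of `n` at `T₀` is not known beforehand. Its second primitive is continuous, as `n`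
  -- is integrable, and the relation `n = N(t, prim2 0 n t)` transfers the continuity to `n`.
  have hpc : ContinuousOn (prim2 0 n) (Set.Icc 0 (T₀ + τ)) := by
    have i3' : IntervalIntegrable (fun v => v • n v) volume 0 (T₀ + τ) :=
      i3.continuousOn_smul continuousOn_id
    have c1 := intervalIntegral.continuousOn_primitive_interval' i3 Set.left_mem_uIcc
    have c2 := intervalIntegral.continuousOn_primitive_interval' i3' Set.left_mem_uIcc
    rw [Set.uIcc_of_le hle] at c1 c2
    refine ((continuousOn_id.smul c1).sub c2).congr fun t ht => ?_
    refine prim2_eq (i3.mono_set ?_)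
    rw [Set.uIcc_of_le ht.1, Set.uIcc_of_le hle]
    exact Set.Icc_subset_Icc_right ht.2
  have hnc : ContinuousOn n (Set.Icc 0 (T₀ + τ)) :=
    (hN.comp_continuousOn (continuousOn_id.prodMk hpc)).congr hfix
  set m : ℝ → H := Set.IccExtend hle ((Set.Icc 0 (T₀ + τ)).domRestrict n) with hm
  have hmc : Continuous m := (continuousOn_iff_continuous_domRestrict.1 hnc).Icc_extend'
  have hme : ∀ t ∈ Set.Icc 0 (T₀ + τ), m t = n t := fun t ht => Set.IccExtend_of_mem hle _ ht
  have hmp : ∀ t ∈ Set.Icc 0 (T₀ + τ), prim2 0 m t = prim2 0 n t := fun t ht =>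
    prim2_congr ht.1 fun v hv => hme v ⟨hv.1, hv.2.trans ht.2⟩
  refine ⟨τ, hτ, m, hmc, fun t ht => ?_, fun t ht => ?_⟩
  · rw [hmp t ⟨ht.1, by linarith [ht.2]⟩, (e1 t ht.2.le ht.1).1]
  · rw [hme t ht, hmp t ht]
    exact hfix t ht

end Abstract

/-! ### Solutions -/

theorem timeInterval_subset {T : EReal} {b : ℝ} (hb : (b : EReal) < T) :
    Set.Icc 0 b ⊆ timeInterval T := fun _ ht =>
  ⟨ht.1, (EReal.coe_le_coe_iff.2 ht.2).trans_lt hb⟩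

theorem zero_mem_timeInterval {T : EReal} (hT : 0 < T) : (0 : ℝ) ∈ timeInterval T :=
  ⟨le_rfl, by exact_mod_cast hT⟩

theorem convex_timeInterval (T : EReal) : Convex ℝ (timeInterval T) := by
  refine Set.OrdConnected.convex ⟨fun x hx y hy z hz => ?_⟩
  exact ⟨hx.1.trans hz.1, (EReal.coe_le_coe_iff.2 hz.2).trans_lt hy.2⟩

theorem exists_mem_timeInterval {T : EReal} {t : ℝ} (ht : t ∈ timeInterval T) :
    ∃ b, t < b ∧ b ∈ timeInterval T := by
  obtain ⟨b, hb1, hb2⟩ := EReal.lt_iff_exists_real_btwn.1 ht.2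
  have : t < b := EReal.coe_lt_coe_iff.1 hb1
  exact ⟨b, this, ht.1.trans this.le, hb2⟩

theorem uniqueDiffOn_timeInterval {T : EReal} (hT : 0 < T) : UniqueDiffOn ℝ (timeInterval T) := by
  obtain ⟨b, hb, hbT⟩ := exists_mem_timeInterval (zero_mem_timeInterval hT)
  refine uniqueDiffOn_convex (convex_timeInterval T) ⟨b / 2, ?_⟩
  rw [mem_interior]
  exact ⟨Set.Ioo 0 b, fun x hx => timeInterval_subset hbT.2 ⟨hx.1.le, hx.2.le⟩, isOpen_Ioo,
    by constructor <;> linarith⟩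

section Derivatives

variable {s : ℝ} {β : Plane → ℝ} {F : ℝ → ℝ} {φ ψ : XSpace s} {T : EReal} {w : ℝ → XSpace s}

/-- The time derivative of a curve on `[0, T)`. -/
def tderiv (T : EReal) (w : ℝ → XSpace s) : ℝ → XSpace s := derivWithin w (timeInterval T)

theorem IsSolution.contDiffOn_tderiv (h : IsSolution β F φ ψ T w) :
    ContDiffOn ℝ 1 (tderiv T w) (timeInterval T) :=
  h.contDiffOn.derivWithin (uniqueDiffOn_timeInterval h.pos) (by norm_num)

theorem IsSolution.hasDerivWithinAt (h : IsSolution β F φ ψ T w) {t : ℝ}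
    (ht : t ∈ timeInterval T) : HasDerivWithinAt w (tderiv T w t) (timeInterval T) t :=
  ((h.contDiffOn.differentiableOn (by norm_num)) t ht).hasDerivWithinAt

theorem IsSolution.hasDerivWithinAt_tderiv (h : IsSolution β F φ ψ T w) {t : ℝ}
    (ht : t ∈ timeInterval T) :
    HasDerivWithinAt (tderiv T w) (tderiv T (tderiv T w) t) (timeInterval T) t :=
  ((h.contDiffOn_tderiv.differentiableOn (by norm_num)) t ht).hasDerivWithinAt

theorem IsSolution.continuousOn_tderiv2 (h : IsSolution β F φ ψ T w) :
    ContinuousOn (tderiv T (tderiv T w)) (timeInterval T) :=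
  h.contDiffOn_tderiv.continuousOn_derivWithin (uniqueDiffOn_timeInterval h.pos) le_rfl

theorem IsSolution.continuousOn (h : IsSolution β F φ ψ T w) : ContinuousOn w (timeInterval T) :=
  h.contDiffOn.continuousOn

/-- Identities between continuous functions on `[0, T)` hold at `0` as well. -/
theorem eqOn_timeInterval {X : Type*} [TopologicalSpace X] [T2Space X] {f g : ℝ → X}
    (hf : ContinuousOn f (timeInterval T)) (hg : ContinuousOn g (timeInterval T))
    (h : ∀ t ∈ timeInterval T, 0 < t → f t = g t) : Set.EqOn f g (timeInterval T) := by
  intro t ht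
  rcases ht.1.eq_or_lt with h0 | h0
  · subst h0
    obtain ⟨b, hb, hbT⟩ := exists_mem_timeInterval ht
    have hsub : Set.Ioc 0 b ⊆ timeInterval T := fun x hx =>
      timeInterval_subset hbT.2 ⟨hx.1.le, hx.2⟩
    have hne : (𝓝[Set.Ioc 0 b] (0 : ℝ)).NeBot := by
      rw [nhdsWithin_Ioc_eq_nhdsGT hb]
      infer_instance
    have l1 : Tendsto f (𝓝[Set.Ioc 0 b] 0) (𝓝 (f 0)) := (hf 0 ht).mono_left (nhdsWithin_mono _ hsub)
    have l2 : Tendsto g (𝓝[Set.Ioc 0 b] 0) (𝓝 (g 0)) := (hg 0 ht).mono_left (nhdsWithin_mono _ hsub)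
    refine tendsto_nhds_unique l1 (l2.congr' ?_)
    filter_upwards [self_mem_nhdsWithin] with x hx
    exact (h x (hsub hx) hx.1).symm
  · exact h t ht h0

/-- The equation in terms of the coordinates of `X^s`. -/
theorem eqForce_iff_toL2 {r : ℝ} (hs : 1 ≤ s) (hβ : IsKernel β r) (hr : 2 ≤ r)
    (hF : ContDiff ℝ 2 F) (v : XSpace s) (a : L2) : EqForce β F v a ↔
      a = ∑ i, op (fun ξ => dsymb i 0 ξ * kernelHat β ξ) (stressL hs F i v) :=
  eqForce_iff hβ (by linarith) (fun i => stress_ae hs hF v i) a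

/-- The distributional equation, posed only for `t > 0`, becomes an identity of continuous
`X^s`-valued curves and so extends to `t = 0`. -/
theorem IsSolution.tderiv2_eq {r ρ : ℝ} {hs : 1 ≤ s} (h : IsSolution β F φ ψ T w)
    (hβ : IsKernel β r) (hr : 2 ≤ r) (hF : ContDiff ℝ 2 F) {G : XSpace s → L2}
    (hG : IsForceMap hs β F ρ G) (hρ : 2 < ρ) (hsρ : s ≤ ρ) :
    Set.EqOn (tderiv T (tderiv T w)) (fun t => potX hρ hsρ (G (w t))) (timeInterval T) := by
  refine eqOn_timeInterval h.continuousOn_tderiv2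
    ((potX hρ hsρ).continuous.comp_continuousOn (hG.continuous.comp_continuousOn h.continuousOn))
    fun t ht h0 => ?_
  apply XSpace.toL2_injective
  rw [toL2_potX, hG.eq]
  exact (eqForce_iff_toL2 hs hβ hr hF _ _).1 (h.eqn t ht h0)

theorem eqOn_of_hasDerivWithinAt {E : Type*} [NormedAddCommGroup E] [NormedSpace ℝ E] {f : ℝ → E}
    {b : ℝ} (h0 : f 0 = 0) (hf : ∀ t ∈ Set.Icc 0 b, HasDerivWithinAt f 0 (Set.Icc 0 b) t) :
    ∀ t ∈ Set.Icc 0 b, f t = 0 := by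
  intro t ht
  rw [← h0]
  refine constant_of_has_deriv_right_zero (fun x hx => (hf x hx).continuousWithinAt) (fun x hx => ?_)
    t ht
  exact (hf x ⟨hx.1, hx.2.le⟩).mono_of_mem_nhdsWithin (Icc_mem_nhdsGE_of_mem hx)

/-- Duhamel's formula. -/
theorem IsSolution.eq_prim2 {r ρ : ℝ} {hs : 1 ≤ s} (h : IsSolution β F φ ψ T w)
    (hβ : IsKernel β r) (hr : 2 ≤ r) (hF : ContDiff ℝ 2 F) {G : XSpace s → L2}
    (hG : IsForceMap hs β F ρ G) (hρ : 2 < ρ) (hsρ : s ≤ ρ) {b : ℝ} (hb : b ∈ timeInterval T) :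
    w b = φ + b • ψ + potX hρ hsρ (prim2 0 (fun t => G (w t)) b) := by
  have hsub := timeInterval_subset hb.2
  have hc : ContinuousOn (fun t => G (w t)) (Set.Icc 0 b) :=
    hG.continuous.comp_continuousOn (h.continuousOn.mono hsub)
  -- Extending the force continuously to all times gives two-sided derivatives of its primitives;
  -- only values on `[0, b]` matter.
  set n : ℝ → L2 := Set.IccExtend hb.1 ((Set.Icc 0 b).domRestrict fun t => G (w t)) with hn
  have hnc : Continuous n := (continuousOn_iff_continuous_domRestrict.1 hc).Icc_extend'
  have hne : ∀ t ∈ Set.Icc 0 b, n t = G (w t) := fun t ht => Set.IccExtend_of_mem hb.1 _ ht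
  rw [← prim2_congr hb.1 hne]
  have h1 : ∀ t ∈ Set.Icc 0 b, tderiv T w t - ψ - potX hρ hsρ (∫ v in (0 : ℝ)..t, n v) = 0 := by
    refine eqOn_of_hasDerivWithinAt ?_ fun t ht => ?_
    · rw [intervalIntegral.integral_same, map_zero, sub_zero, tderiv, h.init_deriv, sub_self]
    · have d1 := (h.hasDerivWithinAt_tderiv (hsub ht)).mono hsub
      have d2 := (potX hρ hsρ).hasFDerivAt.comp_hasDerivAt t
        ((hnc.integral_hasStrictDerivAt 0 t).hasDerivAt)
      refine ((d1.sub_const ψ).sub d2.hasDerivWithinAt).congr_deriv ?_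
      rw [h.tderiv2_eq hβ hr hF hG hρ hsρ (hsub ht), hne t ht, sub_self]
  have h2 : ∀ t ∈ Set.Icc 0 b, w t - (φ + t • ψ) - potX hρ hsρ (prim2 0 n t) = 0 := by
    refine eqOn_of_hasDerivWithinAt ?_ fun t ht => ?_
    · rw [prim2, intervalIntegral.integral_same, map_zero, sub_zero, h.init, zero_smul, add_zero,
        sub_self]
    · have d1 := (h.hasDerivWithinAt (hsub ht)).mono hsub
      have d2 := (potX hρ hsρ).hasFDerivAt.comp_hasDerivAt t (hasDerivAt_prim2 hnc 0 t)
      have d3 : HasDerivAt (fun t : ℝ => φ + t • ψ) ψ t := by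
        have := ((hasDerivAt_id t).smul_const ψ).const_add φ
        simpa using this
      exact ((d1.sub d3.hasDerivWithinAt).sub d2.hasDerivWithinAt).congr_deriv (h1 t ht)
  have := h2 b ⟨hb.1, le_rfl⟩
  rw [sub_sub, sub_eq_zero] at this
  exact this

/-- Duhamel's formula defines solutions. -/
theorem isSolution_of_prim2 {r ρ : ℝ} {hs : 1 ≤ s} (hβ : IsKernel β r) (hr : 2 ≤ r)
    (hF : ContDiff ℝ 2 F) {G : XSpace s → L2} (hG : IsForceMap hs β F ρ G) (hρ : 2 < ρ)
    (hsρ : s ≤ ρ) (hT : 0 < T) {m : ℝ → L2} (hm : Continuous m)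
    (h : ∀ t ∈ timeInterval T, m t = G (φ + t • ψ + potX hρ hsρ (prim2 0 m t))) :
    IsSolution β F φ ψ T fun t => φ + t • ψ + potX hρ hsρ (prim2 0 m t) := by
  set W : ℝ → XSpace s := fun t => φ + t • ψ + potX hρ hsρ (prim2 0 m t) with hW
  set W1 : ℝ → XSpace s := fun t => ψ + potX hρ hsρ (∫ v in (0 : ℝ)..t, m v) with hW1
  set W2 : ℝ → XSpace s := fun t => potX hρ hsρ (m t) with hW2
  have d0 : ∀ t, HasDerivAt W (W1 t) t := fun t => by
    have d3 : HasDerivAt (fun t : ℝ => φ + t • ψ) ψ t := by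
      have := ((hasDerivAt_id t).smul_const ψ).const_add φ
      simpa using this
    exact d3.add ((potX hρ hsρ).hasFDerivAt.comp_hasDerivAt t (hasDerivAt_prim2 hm 0 t))
  have d1 : ∀ t, HasDerivAt W1 (W2 t) t := fun t =>
    ((potX hρ hsρ).hasFDerivAt.comp_hasDerivAt t
      ((hm.integral_hasStrictDerivAt 0 t).hasDerivAt)).const_add ψ
  have c2 : Continuous W2 := (potX hρ hsρ).continuous.comp hm
  have e1 : deriv W1 = W2 := funext fun t => (d1 t).deriv
  have e0 : deriv W = W1 := funext fun t => (d0 t).deriv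
  have hC1 : ContDiff ℝ 1 W1 :=
    contDiff_one_iff_deriv.2 ⟨fun t => (d1 t).differentiableAt, e1 ▸ c2⟩
  have hC2 : ContDiff ℝ 2 W := by
    have : ContDiff ℝ (1 + 1) W := contDiff_succ_iff_deriv.2
      ⟨fun t => (d0 t).differentiableAt, by simp, e0 ▸ hC1⟩
    rwa [one_add_one_eq_two] at this
  have hu := uniqueDiffOn_timeInterval hT
  have t1 : ∀ t ∈ timeInterval T, derivWithin W (timeInterval T) t = W1 t := fun t ht =>
    (d0 t).hasDerivWithinAt.derivWithin (hu t ht)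
  have t2 : ∀ t ∈ timeInterval T,
      derivWithin (derivWithin W (timeInterval T)) (timeInterval T) t = W2 t := fun t ht => by
    rw [derivWithin_congr t1 (t1 t ht)]
    exact (d1 t).hasDerivWithinAt.derivWithin (hu t ht)
  have h0 := zero_mem_timeInterval hT
  refine ⟨hT, hC2.contDiffOn, ?_, ?_, fun t ht _ => ?_⟩
  · change φ + (0 : ℝ) • ψ + potX hρ hsρ (∫ v in (0 : ℝ)..0, (0 - v) • m v) = φ
    rw [intervalIntegral.integral_same, map_zero, add_zero, zero_smul, add_zero]
  · rw [t1 0 h0]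
    change ψ + potX hρ hsρ (∫ v in (0 : ℝ)..0, m v) = ψ
    rw [intervalIntegral.integral_same, map_zero, add_zero]
  · rw [t2 t ht, eqForce_iff_toL2 hs hβ hr hF, toL2_potX, h t ht, hG.eq]

/-- A solution that is bounded in `X^s` up to the time `T₀` can be continued. -/
theorem IsSolution.exists_extension {r ρ : ℝ} {hs : 1 ≤ s} {T₀ : ℝ}
    (h : IsSolution β F φ ψ (T₀ : EReal) w)
    (hβ : IsKernel β r) (hr : 2 ≤ r) (hF : ContDiff ℝ 2 F) {G : XSpace s → L2}
    (hG : IsForceMap hs β F ρ G) (hρ : 2 < ρ) (hsρ : s ≤ ρ) {M : ℝ}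
    (hM : ∀ᶠ t in 𝓝[<] T₀, ‖w t‖ ≤ M) :
    ∃ (T' : EReal) (w' : ℝ → XSpace s), (T₀ : EReal) < T' ∧ IsSolution β F φ ψ T' w' ∧
      Set.EqOn w' w (timeInterval T₀) := by
  have hT0 : 0 < T₀ := by exact_mod_cast h.pos
  have hD : ∀ T₁ : ℝ, timeInterval (T₁ : EReal) = Set.Ico 0 T₁ := fun T₁ => by
    ext t
    simp only [timeInterval, EReal.coe_lt_coe_iff]
    rfl
  have hGw : ContinuousOn (fun t => G (w t)) (Set.Ico 0 T₀) := by
    rw [← hD]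
    exact hG.continuous.comp_continuousOn h.continuousOn
  obtain ⟨K, hK⟩ := hG.bdd M
  -- A bound for `w` alone suffices: it bounds the force, and position and velocity at `T₀` are
  -- obtained by integrating the force.
  have hint : IntervalIntegrable (fun t => G (w t)) volume 0 T₀ :=
    intervalIntegrable_of_bound hT0 hGw (by filter_upwards [hM] with t ht using hK _ ht)
  set P := potX hρ hsρ with hP
  have hNc : Continuous fun p : ℝ × L2 => G (φ + p.1 • ψ + P p.2) :=
    hG.continuous.comp ((continuous_const.add (continuous_fst.smul continuous_const)).add
      (P.continuous.comp continuous_snd))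
  have hbX : ∀ M : ℝ, ∀ t ∈ Set.Icc T₀ (T₀ + 1), ∀ u, ‖u‖ ≤ M →
      ‖φ + t • ψ + P u‖ ≤ ‖φ‖ + (T₀ + 1) * ‖ψ‖ + ‖P‖ * M := fun M t ht u hu => by
    refine norm_add₃_le.trans (add_le_add (add_le_add le_rfl ?_) ?_)
    · rw [norm_smul, Real.norm_of_nonneg (hT0.le.trans ht.1)]
      exact mul_le_mul_of_nonneg_right ht.2 (norm_nonneg _)
    · exact (P.le_opNorm u).trans (mul_le_mul_of_nonneg_left hu (norm_nonneg _))
  have hρ1 : 0 ≤ ρ - 1 := by linarith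
  have hrep : ∀ t ∈ Set.Ico 0 T₀, w t = φ + t • ψ + P (prim2 0 (fun t => G (w t)) t) :=
    fun t ht => h.eq_prim2 hβ hr hF hG hρ hsρ (by rwa [hD])
  have hb : ∀ M, ∃ K, ∀ t ∈ Set.Icc T₀ (T₀ + 1), ∀ u, ‖u‖ ≤ M → ‖G (φ + t • ψ + P u)‖ ≤ K :=
    fun M => by
      obtain ⟨K, hK⟩ := hG.bdd (‖φ‖ + (T₀ + 1) * ‖ψ‖ + ‖P‖ * M)
      exact ⟨K, fun t ht u hu => hK _ (hbX M t ht u hu)⟩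
  have hL : ∀ M, ∃ L : ℝ, 0 ≤ L ∧ ∀ t ∈ Set.Icc T₀ (T₀ + 1), ∀ u v, ‖u‖ ≤ M → ‖v‖ ≤ M →
      ‖bes (ρ - 1) (G (φ + t • ψ + P u) - G (φ + t • ψ + P v))‖ ≤ L * ‖bes (ρ - 1) (u - v)‖ :=
    fun M => by
      obtain ⟨L, hL0, hL⟩ := hG.exists_lip (by linarith) hr hβ hF
        (‖φ‖ + (T₀ + 1) * ‖ψ‖ + ‖P‖ * M)
      refine ⟨L, hL0, fun t ht u v hu hv => ?_⟩
      refine (hL _ _ (hbX M t ht u hu) (hbX M t ht v hv)).trans_eq ?_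
      -- The `H¹` coordinate of `P u` is `bes (ρ - 1) u`, which is why `bes (ρ - 1)` serves as the
      -- weak norm in the abstract continuation result.
      rw [← map_sub (XSpace.yco hs), add_sub_add_left_eq_sub, ← map_sub P, hP, yco_potX]
  obtain ⟨τ, hτ, m, hmc, hm1, hm2⟩ := exists_continuation (bes (ρ - 1))
    (fun u v huv => bes_inj hρ1 huv) (fun u y M huM hy => exists_of_tendsto_bes hρ1 huM hy)
    (N := fun t u => G (φ + t • ψ + P u)) hNc hb hL hT0 hint
    (fun t ht => congrArg G (hrep t ht))
  refine ⟨((T₀ + τ : ℝ) : EReal), fun t => φ + t • ψ + P (prim2 0 m t),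
    EReal.coe_lt_coe_iff.2 (by linarith), ?_, fun t ht => ?_⟩
  · refine isSolution_of_prim2 hβ hr hF hG hρ hsρ (by exact_mod_cast (by linarith : 0 < T₀ + τ)) hmc
      fun t ht => ?_
    rw [hD] at ht
    exact hm2 t ⟨ht.1, ht.2.le⟩
  · rw [hD] at ht
    simp only
    rw [hm1 t ht, ← hrep t ht]

end Derivatives

/-! ### The potential energy -/

theorem inner_eq_integral (u v : L2) : inner ℝ u v = ∫ z, u z * v z := by
  rw [L2.inner_def]
  refine integral_congr_ae (Eventually.of_forall fun z => ?_)
  simp [mul_comm]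

theorem integrable_mul (u v : L2) : Integrable (fun z => u z * v z) volume := by
  refine (L2.integrable_inner (𝕜 := ℝ) u v).congr (Eventually.of_forall fun z => ?_)
  simp [mul_comm]

theorem integral_sq (u : L2) : ∫ z, u z ^ 2 = ‖u‖ ^ 2 := by
  rw [← real_inner_self_eq_norm_sq, inner_eq_integral]
  simp only [sq]

/-- A quadratic Taylor estimate on balls. -/
theorem exists_taylor {E : Type*} [NormedAddCommGroup E] [NormedSpace ℝ E] [ProperSpace E]
    {Φ : E → ℝ} (hΦ : ContDiff ℝ 2 Φ) (M : ℝ) :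
    ∃ L : ℝ, 0 ≤ L ∧ ∀ p q : E, ‖p‖ ≤ M → ‖q‖ ≤ M →
      |Φ q - Φ p - fderiv ℝ Φ p (q - p)| ≤ L * ‖q - p‖ ^ 2 := by
  have h1 : ContDiff ℝ 1 (fderiv ℝ Φ) := hΦ.fderiv_right (by norm_num)
  obtain ⟨C, hC⟩ := (isCompact_closedBall (0 : E) M).exists_bound_of_continuousOn
    (h1.continuous_fderiv (by simp)).continuousOn
  refine ⟨max C 0, le_max_right _ _, fun p q hp hq => ?_⟩
  have hpM : p ∈ Metric.closedBall (0 : E) M := by simpa using hp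
  have hqM : q ∈ Metric.closedBall (0 : E) M := by simpa using hq
  have hlip : ∀ x ∈ Metric.closedBall (0 : E) M,
      ‖fderiv ℝ Φ x - fderiv ℝ Φ p‖ ≤ max C 0 * ‖x - p‖ := fun x hx =>
    (convex_closedBall (0 : E) M).norm_image_sub_le_of_norm_fderiv_le (𝕜 := ℝ)
      (fun y _ => (h1.differentiable (by simp)).differentiableAt)
      (fun y hy => (hC y hy).trans (le_max_left _ _)) hpM hx
  have hseg : segment ℝ p q ⊆ Metric.closedBall (0 : E) M :=
    (convex_closedBall (0 : E) M).segment_subset hpM hqM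
  have := (convex_segment p q).norm_image_sub_le_of_norm_fderiv_le' (𝕜 := ℝ) (f := Φ)
    (φ := fderiv ℝ Φ p) (C := max C 0 * ‖q - p‖)
    (fun y _ => (hΦ.differentiable (by simp)).differentiableAt)
    (fun y hy => (hlip y (hseg hy)).trans (mul_le_mul_of_nonneg_left
      (norm_sub_le_of_mem_segment hy) (le_max_right _ _)))
    (left_mem_segment ℝ p q) (right_mem_segment ℝ p q)
  rw [Real.norm_eq_abs] at this
  refine this.trans_eq ?_
  ring

/-- The stored energy density as a function of the gradient. -/
def energyFun (F : ℝ → ℝ) (p : Fin 2 → ℝ) : ℝ := F (p 0 ^ 2 + p 1 ^ 2)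

theorem contDiff_energyFun {F : ℝ → ℝ} (hF : ContDiff ℝ 2 F) : ContDiff ℝ 2 (energyFun F) :=
  hF.comp (by fun_prop : ContDiff ℝ 2 fun p : Fin 2 → ℝ => p 0 ^ 2 + p 1 ^ 2)

theorem fderiv_energyFun {F : ℝ → ℝ} (hF : ContDiff ℝ 2 F) (p v : Fin 2 → ℝ) :
    fderiv ℝ (energyFun F) p v = stressFun F 0 p * v 0 + stressFun F 1 p * v 1 := by
  have h1 : HasFDerivAt (fun p : Fin 2 → ℝ => p 0 ^ 2 + p 1 ^ 2)
      ((2 * p 0) • ContinuousLinearMap.proj (R := ℝ) (φ := fun _ : Fin 2 => ℝ) 0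
        + (2 * p 1) • ContinuousLinearMap.proj (R := ℝ) (φ := fun _ : Fin 2 => ℝ) 1) p := by
    have h : ∀ i : Fin 2, HasFDerivAt (fun p : Fin 2 → ℝ => p i ^ 2)
        ((2 * p i) • ContinuousLinearMap.proj (R := ℝ) (φ := fun _ : Fin 2 => ℝ) i) p := fun i => by
      have := (ContinuousLinearMap.proj (R := ℝ) (φ := fun _ : Fin 2 => ℝ) i).hasFDerivAt
        (x := p) |>.pow 2
      simpa using this
    exact (h 0).add (h 1)
  have h2 : HasDerivAt F (deriv F (p 0 ^ 2 + p 1 ^ 2)) (p 0 ^ 2 + p 1 ^ 2) :=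
    (hF.differentiable (by norm_num)).differentiableAt.hasDerivAt
  have h3 := (h2.comp_hasFDerivAt p h1).fderiv
  change fderiv ℝ (F ∘ fun p : Fin 2 → ℝ => p 0 ^ 2 + p 1 ^ 2) p v = _
  rw [h3]
  simp [stressFun]
  ring

section Potential

variable {s : ℝ} (hs : 1 ≤ s) {F : ℝ → ℝ}

theorem ae_norm_grad_le (v : XSpace s) : ∀ᵐ z, ‖(fun j => dop j (v.yco hs) z)‖ ≤ ‖v‖ :=
  BddAE.ae_norm_le (u := fun j => dop j (v.yco hs)) fun j => v.ae_abs_dop_le hs j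

theorem energy_ae (F : ℝ → ℝ) (v : XSpace s) :
    (fun z => F (gradSq v z)) =ᵐ[volume] fun z => energyFun F fun j => dop j (v.yco hs) z := by
  filter_upwards [v.dop_yco hs 0, v.dop_yco hs 1] with z h0 h1
  rw [energyFun, h0, h1, gradSq]

theorem stressL_ae (hF : ContDiff ℝ 2 F) (v : XSpace s) (i : Fin 2) :
    stressL hs F i v =ᵐ[volume] fun z => stressFun F i fun j => dop j (v.yco hs) z := by
  filter_upwards [stress_ae hs hF v i, v.dop_yco hs 0, v.dop_yco hs 1] with z h h0 h1
  rw [stressL, h, stressFun, h0, h1, stress, gradSq]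
  fin_cases i
  · simp [h0]
  · simp [h1]

theorem norm_sq_le (p : Fin 2 → ℝ) : ‖p‖ ^ 2 ≤ p 0 ^ 2 + p 1 ^ 2 := by
  have h : ‖p‖ ≤ √(p 0 ^ 2 + p 1 ^ 2) := by
    rw [pi_norm_le_iff_of_nonneg (Real.sqrt_nonneg _)]
    intro i
    refine Real.le_sqrt_of_sq_le ?_
    rw [Real.norm_eq_abs, sq_abs]
    fin_cases i
    · simp [sq_nonneg]
    · simp [sq_nonneg]
  calc ‖p‖ ^ 2 ≤ √(p 0 ^ 2 + p 1 ^ 2) ^ 2 := pow_le_pow_left₀ (norm_nonneg _) h 2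
    _ = _ := Real.sq_sqrt (by positivity)

theorem integrable_sq (u : L2) : Integrable (fun z => u z ^ 2) volume := by
  simpa only [sq] using integrable_mul u u

/-- Since `F 0 = 0` and the stress vanishes at zero gradient, Taylor's formula at the origin bounds
the density by a multiple of `|∇v|²`, where the constant depends on the `L^∞` norm of the gradient.
-/
theorem integrable_energy (hF : ContDiff ℝ 2 F) (hF0 : F 0 = 0) (v : XSpace s) :
    Integrable (fun z => energyFun F fun j => dop j (v.yco hs) z) volume := by
  obtain ⟨L, hL0, hL⟩ := exists_taylor (contDiff_energyFun hF) ‖v‖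
  refine (((integrable_sq (dop 0 (v.yco hs))).add
    (integrable_sq (dop 1 (v.yco hs)))).const_mul L).mono'
    (aesm_comp (contDiff_energyFun hF).continuous fun j => dop j (v.yco hs)) ?_
  filter_upwards [ae_norm_grad_le hs v] with z hz
  have h := hL 0 _ (by simp) hz
  have e0 : energyFun F 0 = 0 := by simp [energyFun, hF0]
  rw [fderiv_energyFun hF, stressFun_zero, stressFun_zero, e0, sub_zero, sub_zero, zero_mul,
    zero_mul, add_zero, sub_zero] at h
  exact h.trans (mul_le_mul_of_nonneg_left (norm_sq_le _) hL0)

/-- The potential energy `∫ F(|∇w|²)`. -/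
def potential (F : ℝ → ℝ) (v : XSpace s) : ℝ := ∫ z, F (gradSq v z)

/-- The derivative of the potential energy. -/
def potentialDeriv (F : ℝ → ℝ) (v : XSpace s) : XSpace s →L[ℝ] ℝ :=
  ∑ i, (innerSL ℝ (stressL hs F i v)).comp ((dop i).comp (XSpace.yco hs))

theorem potentialDeriv_apply (F : ℝ → ℝ) (v x : XSpace s) :
    potentialDeriv hs F v x = ∑ i, inner ℝ (stressL hs F i v) (dop i (x.yco hs)) := by
  rw [potentialDeriv, sum_apply]
  rfl

/-- The `L^∞` part of the norm of `X^s` keeps the pointwise Taylor constant uniform, and the `L²`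
norm of the gradient difference integrates the quadratic remainder. -/
theorem exists_potential_taylor (hF : ContDiff ℝ 2 F) (hF0 : F 0 = 0) (M : ℝ) :
    ∃ L : ℝ, 0 ≤ L ∧ ∀ v x : XSpace s, ‖v‖ ≤ M → ‖x‖ ≤ M →
      |potential F x - potential F v - potentialDeriv hs F v (x - v)| ≤ L * ‖x - v‖ ^ 2 := by
  obtain ⟨L, hL0, hL⟩ := exists_taylor (contDiff_energyFun hF) M
  refine ⟨L * (2 * ‖XSpace.yco (s := s) hs‖ ^ 2), by positivity, fun v x hv hx => ?_⟩
  set d : Fin 2 → L2 := fun i => dop i ((x - v).yco hs) with hd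
  have iE := fun u : XSpace s => integrable_energy hs hF hF0 u
  have iS := fun i => integrable_mul (stressL hs F i v) (d i)
  have hsq := (integrable_sq (d 0)).add (integrable_sq (d 1))
  have e : potential F x - potential F v - potentialDeriv hs F v (x - v)
      = ∫ z, ((energyFun F fun j => dop j (x.yco hs) z) - (energyFun F fun j => dop j (v.yco hs) z)
        - (stressL hs F 0 v z * d 0 z + stressL hs F 1 v z * d 1 z)) := by
    have i1 : Integrable (fun z => (energyFun F fun j => dop j (x.yco hs) z)
        - (energyFun F fun j => dop j (v.yco hs) z)) volume := (iE x).sub (iE v)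
    have i2 : Integrable (fun z => stressL hs F 0 v z * d 0 z + stressL hs F 1 v z * d 1 z)
        volume := (iS 0).add (iS 1)
    rw [integral_sub i1 i2, integral_sub (iE x) (iE v),
      integral_add (iS 0) (iS 1), potentialDeriv_apply, Fin.sum_univ_two, inner_eq_integral,
      inner_eq_integral, potential, potential, integral_congr_ae (energy_ae hs F x),
      integral_congr_ae (energy_ae hs F v)]
  rw [e]
  have hpt : ∀ᵐ z, ‖(energyFun F fun j => dop j (x.yco hs) z)
      - (energyFun F fun j => dop j (v.yco hs) z)
      - (stressL hs F 0 v z * d 0 z + stressL hs F 1 v z * d 1 z)‖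
      ≤ L * (d 0 z ^ 2 + d 1 z ^ 2) := by
    have hdd : ∀ i, d i = dop i (x.yco hs) - dop i (v.yco hs) := fun i => by
      rw [hd]
      simp only [map_sub]
    filter_upwards [ae_norm_grad_le hs v, ae_norm_grad_le hs x, stressL_ae hs hF v 0,
      stressL_ae hs hF v 1, Lp.coeFn_sub (dop 0 (x.yco hs)) (dop 0 (v.yco hs)),
      Lp.coeFn_sub (dop 1 (x.yco hs)) (dop 1 (v.yco hs))] with z a b s0 s1 d0 d1
    have h := hL _ _ (a.trans hv) (b.trans hx)
    rw [fderiv_energyFun hF] at h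
    rw [s0, s1, hdd, hdd, d0, d1]
    refine h.trans (mul_le_mul_of_nonneg_left ?_ hL0)
    exact norm_sq_le _
  refine (norm_integral_le_of_norm_le (hsq.const_mul L) hpt).trans ?_
  have hi : ∀ i, ∫ z, d i z ^ 2 ≤ ‖XSpace.yco (s := s) hs‖ ^ 2 * ‖x - v‖ ^ 2 := fun i => by
    rw [integral_sq, ← mul_pow]
    exact pow_le_pow_left₀ (norm_nonneg _) ((norm_dop_le _ _).trans ((XSpace.yco hs).le_opNorm _)) 2
  have h2 : ∫ z, (d 0 z ^ 2 + d 1 z ^ 2) ≤ 2 * ‖XSpace.yco (s := s) hs‖ ^ 2 * ‖x - v‖ ^ 2 := by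
    rw [integral_add (integrable_sq (d 0)) (integrable_sq (d 1))]
    linarith [hi 0, hi 1]
  calc ∫ z, L * (d 0 z ^ 2 + d 1 z ^ 2) = L * ∫ z, (d 0 z ^ 2 + d 1 z ^ 2) := integral_const_mul _ _
    _ ≤ L * (2 * ‖XSpace.yco (s := s) hs‖ ^ 2 * ‖x - v‖ ^ 2) := mul_le_mul_of_nonneg_left h2 hL0
    _ = _ := by ring

theorem hasFDerivAt_potential (hF : ContDiff ℝ 2 F) (hF0 : F 0 = 0) (v : XSpace s) :
    HasFDerivAt (potential F) (potentialDeriv hs F v) v := by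
  obtain ⟨L, hL0, hL⟩ := exists_potential_taylor hs hF hF0 (‖v‖ + 1)
  refine HasFDerivAt.of_isLittleO ?_
  have h1 : (fun x : XSpace s => potential F x - potential F v - potentialDeriv hs F v (x - v))
      =O[𝓝 v] fun x => ‖x - v‖ ^ 2 := by
    refine Asymptotics.IsBigO.of_bound L ?_
    filter_upwards [Metric.closedBall_mem_nhds v one_pos] with x hx
    rw [mem_closedBall_iff_norm] at hx
    have hx' : ‖x‖ ≤ ‖v‖ + 1 := by
      have := norm_add_le v (x - v)
      rw [add_sub_cancel] at this
      linarith
    rw [Real.norm_eq_abs, Real.norm_of_nonneg (by positivity)]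
    exact hL v x (by linarith) hx'
  refine h1.trans_isLittleO ?_
  have h2 := (Asymptotics.isLittleO_pow_id (𝕜 := ℝ) (n := 2) one_lt_two).comp_tendsto
    (show Tendsto (fun x : XSpace s => ‖x - v‖) (𝓝 v) (𝓝 0) from
      tendsto_iff_norm_sub_tendsto_zero.1 tendsto_id)
  exact h2.norm_right.congr_right (fun x => by simp) |>.of_norm_right

/-- The virial bound. -/
theorem le_virial (hF : ContDiff ℝ 2 F) (hF0 : F 0 = 0) {ν : ℝ}
    (hblow : ∀ u : ℝ, 0 ≤ u → u * deriv F u ≤ (1 + 2 * ν) * F u) (v : XSpace s) :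
    ∑ i, inner ℝ (dop i (v.yco hs)) (stressL hs F i v) ≤ 2 * (1 + 2 * ν) * potential F v := by
  rw [Fin.sum_univ_two, inner_eq_integral, inner_eq_integral,
    ← integral_add (integrable_mul _ _) (integrable_mul _ _), potential,
    integral_congr_ae (energy_ae hs F v), ← integral_const_mul]
  refine integral_mono_ae ((integrable_mul _ _).add (integrable_mul _ _))
    ((integrable_energy hs hF hF0 v).const_mul _) ?_
  filter_upwards [stressL_ae hs hF v 0, stressL_ae hs hF v 1] with z s0 s1
  simp only [s0, s1, stressFun, energyFun]
  -- The integrand on the left is `2 |∇v|² F'(|∇v|²)`, to which the hypothesis on `F` applies with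
  -- `u = |∇v|²`.
  have := hblow (dop 0 (v.yco hs) z ^ 2 + dop 1 (v.yco hs) z ^ 2) (by positivity)
  nlinarith

end Potential

/-! ### The concavity argument -/

theorem monotoneOn_Ici_of_hasDerivAt {f f' : ℝ → ℝ} (hf : ∀ t, 0 ≤ t → HasDerivAt f (f' t) t)
    (h : ∀ t, 0 ≤ t → 0 ≤ f' t) : MonotoneOn f (Set.Ici 0) := by
  refine monotoneOn_of_deriv_nonneg (convex_Ici 0)
    (fun t ht => (hf t ht).continuousAt.continuousWithinAt)
    (fun t ht => (hf t (interior_subset ht)).differentiableAt.differentiableWithinAt)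
    fun t ht => ?_
  rw [(hf t (interior_subset ht)).deriv]
  exact h t (interior_subset ht)

/-- Levine's concavity lemma. -/
theorem not_forall_concavity {ν : ℝ} (hν : 0 < ν) {f f' f'' : ℝ → ℝ}
    (hf : ∀ t, 0 ≤ t → HasDerivAt f (f' t) t) (hf' : ∀ t, 0 ≤ t → HasDerivAt f' (f'' t) t)
    (hpos : ∀ t, 0 ≤ t → 0 < f t) (h0 : 0 < f' 0) :
    ¬ ∀ t, 0 ≤ t → (1 + ν) * f' t ^ 2 ≤ f t * f'' t := by
  intro h
  -- Up to the factor `-ν`, this function is the derivative of `f^{-ν}`; its monotonicity is the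
  -- concavity of `f^{-ν}`.
  have hm := monotoneOn_Ici_of_hasDerivAt (f := fun t => f' t * f t ^ (-(1 + ν)))
    (f' := fun t => f'' t * f t ^ (-(1 + ν)) + f' t * (f' t * (-(1 + ν)) * f t ^ (-(1 + ν) - 1)))
    (fun t ht => (hf' t ht).mul ((hf t ht).rpow_const (Or.inl (hpos t ht).ne'))) fun t ht => by
      have hp := hpos t ht
      have e : f t ^ (-(1 + ν)) = f t * f t ^ (-(1 + ν) - 1) := by
        rw [Real.rpow_sub_one hp.ne']
        field_simp
      rw [e]
      have := mul_nonneg (Real.rpow_nonneg hp.le (-(1 + ν) - 1)) (sub_nonneg.2 (h t ht))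
      linarith
  set c := f' 0 * f 0 ^ (-(1 + ν)) with hc
  have hc0 : 0 < c := mul_pos h0 (Real.rpow_pos_of_pos (hpos 0 le_rfl) _)
  -- Thus `f^{-ν}` decreases at least at the rate `ν c` and would be nonpositive at time `f(0)^{-ν}
  -- / (ν c)`.
  have hm2 := monotoneOn_Ici_of_hasDerivAt (f := fun t => -(f t ^ (-ν)) - ν * c * t)
    (f' := fun t => -(f' t * (-ν) * f t ^ (-ν - 1)) - ν * c * 1)
    (fun t ht => (((hf t ht).rpow_const (Or.inl (hpos t ht).ne')).neg).sub
      ((hasDerivAt_id t).const_mul (ν * c))) fun t ht => by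
      have h1 : c ≤ f' t * f t ^ (-(1 + ν)) := hm Set.self_mem_Ici ht ht
      have e : -ν - 1 = -(1 + ν) := by ring
      rw [e]
      have := mul_le_mul_of_nonneg_left h1 hν.le
      linarith
  have hJ := Real.rpow_pos_of_pos (hpos 0 le_rfl) (-ν)
  have hνc : 0 < ν * c := mul_pos hν hc0
  have ht : 0 ≤ f 0 ^ (-ν) / (ν * c) := by positivity
  have h2 := hm2 Set.self_mem_Ici ht ht
  simp only [mul_zero, sub_zero] at h2
  rw [mul_div_cancel₀ _ hνc.ne'] at h2
  have := Real.rpow_pos_of_pos (hpos _ ht) (-ν)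
  linarith

/-- A trajectory in a Hilbert space whose virial is controlled by a conserved negative energy cannot
exist for all times. -/
theorem false_of_virial {H : Type*} [NormedAddCommGroup H] [InnerProductSpace ℝ H] {ν e : ℝ}
    (hν : 0 < ν) (he : e < 0) {z z' q : ℝ → H} {P : ℝ → ℝ}
    (hz : ∀ t, 0 ≤ t → HasDerivAt z (z' t) t) (hz' : ∀ t, 0 ≤ t → HasDerivAt z' (q t) t)
    (hE : ∀ t, 0 ≤ t → 1 / 2 * ‖z' t‖ ^ 2 + P t = e)
    (hq : ∀ t, 0 ≤ t → -(2 * (1 + 2 * ν) * P t) ≤ inner ℝ (z t) (q t)) : False := by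
  -- With this `b` the energy identity becomes `-2 P = ‖z'‖² + b`, so the virial and kinetic terms
  -- add up to a multiple of one quantity. The shift `τ` is chosen to make `f'(0) > 0`.
  set b := -2 * e with hb
  have hb0 : 0 < b := by linarith
  set τ := |inner ℝ (z 0) (z' 0)| / b + 1 with hτ
  have hτ0 : 0 < τ := by positivity
  refine not_forall_concavity hν (f := fun t => ‖z t‖ ^ 2 + b * (t + τ) ^ 2)
    (f' := fun t => 2 * inner ℝ (z t) (z' t) + 2 * b * (t + τ))
    (f'' := fun t => 2 * (inner ℝ (z t) (q t) + inner ℝ (z' t) (z' t)) + 2 * b) ?_ ?_ ?_ ?_ ?_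
  · intro t ht
    have h2 : HasDerivAt (fun t => b * (t + τ) ^ 2) (b * (2 * (t + τ))) t := by
      simpa using ((((hasDerivAt_id t).add_const τ).pow 2).const_mul b)
    refine ((hz t ht).norm_sq.add h2).congr_deriv ?_
    ring
  · intro t ht
    have h2 : HasDerivAt (fun t => 2 * b * (t + τ)) (2 * b) t := by
      simpa using ((hasDerivAt_id t).add_const τ).const_mul (2 * b)
    exact (((hz t ht).inner ℝ (hz' t ht)).const_mul 2).add h2
  · intro t ht
    positivity
  · have h1 := neg_abs_le (inner ℝ (z 0) (z' 0))
    have h2 : b * τ = |inner ℝ (z 0) (z' 0)| + b := by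
      rw [hτ]
      field_simp
    simp only [zero_add]
    nlinarith
  · intro t ht
    rw [real_inner_self_eq_norm_sq]
    have h1 : 2 * (1 + ν) * (‖z' t‖ ^ 2 + b) ≤ inner ℝ (z t) (q t) + ‖z' t‖ ^ 2 + b := by
      have e1 := hE t ht
      have : P t = -(1 / 2) * (‖z' t‖ ^ 2 + b) := by rw [hb]; linarith
      have h2 := hq t ht
      rw [this] at h2
      linarith
    -- Cauchy–Schwarz in `H × ℝ` for the vectors `(z, √b (t + τ))` and `(z', √b)`; the left-hand
    -- side is `(f' / 2)²`.
    have h3 : (inner ℝ (z t) (z' t) + b * (t + τ)) ^ 2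
        ≤ (‖z t‖ ^ 2 + b * (t + τ) ^ 2) * (‖z' t‖ ^ 2 + b) := by
      have hcs := abs_real_inner_le_norm (z t) (z' t)
      have hu : 0 ≤ t + τ := by positivity
      have h4 : (inner ℝ (z t) (z' t) : ℝ) ≤ ‖z t‖ * ‖z' t‖ := (le_abs_self _).trans hcs
      have h5 : (inner ℝ (z t) (z' t) : ℝ) ^ 2 ≤ (‖z t‖ * ‖z' t‖) ^ 2 := sq_le_sq' (by
        linarith [neg_abs_le (inner ℝ (z t) (z' t) : ℝ)]) h4
      have h6 := mul_le_mul_of_nonneg_left h4 (mul_nonneg hb0.le hu)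
      have h7 := mul_nonneg hb0.le (sq_nonneg (‖z t‖ - (t + τ) * ‖z' t‖))
      nlinarith
    have h8 : 0 ≤ ‖z t‖ ^ 2 + b * (t + τ) ^ 2 := by positivity
    have h9 := mul_le_mul_of_nonneg_left h1 h8
    have h10 := mul_le_mul_of_nonneg_left h3 (by positivity : 0 ≤ 4 * (1 + ν))
    nlinarith

/-! ### The square root of the convolution operator -/

/-- The symbol `β̂^{1/2}`. -/
def bsq (β : Plane → ℝ) (ξ : Plane) : ℂ := (√(kernelHat β ξ).re : ℝ)

/-- The symbol `i ξ_i β̂(ξ)^{1/2}`. -/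
def dsq (β : Plane → ℝ) (i : Fin 2) (ξ : Plane) : ℂ := dsymb i 0 ξ * bsq β ξ

section Root

variable {β : Plane → ℝ} {r : ℝ}

theorem bsq_mul_self (hβ : IsKernel β r) (ξ : Plane) : bsq β ξ * bsq β ξ = kernelHat β ξ := by
  rw [bsq, ← Complex.ofReal_mul, Real.mul_self_sqrt (hβ.nonneg ξ), ← hβ.hat_eq]

theorem measurable_bsq (hβ : IsKernel β r) : Measurable (bsq β) :=
  (Complex.continuous_ofReal.comp
    (Real.continuous_sqrt.comp (Complex.continuous_re.comp hβ.continuous_hat))).measurable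

/-- The decay of order `r ≥ 2` of `β̂` leaves order 1 for its square root, exactly what is needed
for `i ξ_i β̂^{1/2}` to be bounded and for `z''` to be an `L²` function. -/
theorem exists_norm_bsq_le (hβ : IsKernel β r) (hr : 2 ≤ r) :
    ∃ C : ℝ, 0 ≤ C ∧ ∀ ξ, ‖bsq β ξ‖ ≤ C * jw (-1) ξ := by
  obtain ⟨C, hC, h⟩ := hβ.exists_bound
  refine ⟨√C, Real.sqrt_nonneg _, fun ξ => ?_⟩
  rw [bsq, Complex.norm_real, Real.norm_of_nonneg (Real.sqrt_nonneg _)]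
  have h1 : jw (-r) ξ ≤ jw (-1) ξ ^ 2 := by
    have e : jw (-r) ξ = jw (2 - r) ξ * jw (-1) ξ ^ 2 := by
      rw [sq, ← jw_add, ← jw_add]
      ring_nf
    rw [e]
    exact mul_le_of_le_one_left (sq_nonneg _) (jw_le_one (by linarith) ξ)
  calc √(kernelHat β ξ).re ≤ √(C * jw (-1) ξ ^ 2) :=
        Real.sqrt_le_sqrt ((h ξ).trans (mul_le_mul_of_nonneg_left h1 hC.le))
    _ = √C * jw (-1) ξ := by rw [Real.sqrt_mul hC.le, Real.sqrt_sq (jw_pos _ _).le]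

theorem bsq_symm (hβ : IsKernel β r) (ξ : Plane) : bsq β (-ξ) = conj (bsq β ξ) := by
  rw [bsq, bsq, hβ.hat_neg, Complex.conj_ofReal]

theorem isSymb_bsq (hβ : IsKernel β r) (hr : 2 ≤ r) : IsSymb (bsq β) := by
  obtain ⟨C, hC, h⟩ := exists_norm_bsq_le hβ hr
  exact ⟨measurable_bsq hβ, ⟨C, fun ξ => (h ξ).trans
    (mul_le_of_le_one_right hC (jw_le_one (by norm_num) ξ))⟩, bsq_symm hβ⟩

theorem isSymb_dsq (hβ : IsKernel β r) (hr : 2 ≤ r) (i : Fin 2) : IsSymb (dsq β i) := by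
  obtain ⟨C, hC, h⟩ := exists_norm_bsq_le hβ hr
  refine ⟨(dsymb_measurable i 0).mul (measurable_bsq hβ), ⟨C, fun ξ => ?_⟩, fun ξ => ?_⟩
  · rw [dsq, norm_mul]
    calc _ ≤ jw (0 + 1) ξ * (C * jw (-1) ξ) :=
          mul_le_mul (norm_dsymb_le i 0 ξ) (h ξ) (norm_nonneg _) (jw_pos _ _).le
      _ = C * jw (0 + 1 + -1) ξ := by rw [jw_add (0 + 1)]; ring
      _ ≤ C := mul_le_of_le_one_right hC (jw_le_one (by norm_num) ξ)
  · rw [dsq, dsq, dsymb_symm, bsq_symm hβ, map_mul]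

theorem conj_dsq (i : Fin 2) (ξ : Plane) : conj (dsq β i ξ) = -dsq β i ξ := by
  simp [dsq, dsymb, bsq]

/-- Integration by parts: the symbol is purely imaginary, so the operator is skew-adjoint. -/
theorem inner_op_dsq (hβ : IsKernel β r) (hr : 2 ≤ r) (i : Fin 2) (u v : L2) :
    inner ℝ u (op (dsq β i) v) = -inner ℝ (op (dsq β i) u) v := by
  have hd := isSymb_dsq hβ hr i
  have e : op (fun ξ => conj (dsq β i ξ)) v = -op (dsq β i) v := by
    apply l2Hat_inj
    filter_upwards [l2Hat_op hd.conj v, l2Hat_op hd v, l2Hat_smul (-1) (op (dsq β i) v)]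
      with ξ a b c
    rw [neg_one_smul] at c
    rw [a, c, b, conj_dsq]
    push_cast
    ring
  rw [inner_eq_integral (op (dsq β i) u), integral_op_mul hd, ← inner_eq_integral, e,
    inner_neg_right, neg_neg]

/-- Where `β̂` vanishes, the convention for the domain of `R` makes both transforms zero, so
multiplying by `β̂^{1/2}` inverts `R` there too. -/
theorem op_bsq_of_hasR (hβ : IsKernel β r) (hr : 2 ≤ r) {u v : L2} (h : HasR β u v) :
    op (bsq β) v = u := by
  apply l2Hat_inj
  filter_upwards [l2Hat_op (isSymb_bsq hβ hr) v, h] with ξ a b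
  rw [a]
  rcases (hβ.nonneg ξ).eq_or_lt with h0 | h0
  · have : kernelHat β ξ = 0 := by rw [hβ.hat_eq, ← h0, Complex.ofReal_zero]
    rw [(b.2 this).1, (b.2 this).2, mul_zero]
  · rw [b.1 h0, ← mul_assoc, bsq, ← Complex.ofReal_mul, Real.sqrt_eq_rpow, ← Real.rpow_add h0]
    norm_num

theorem op_bsq_op_dsq (hβ : IsKernel β r) (hr : 2 ≤ r) (i : Fin 2) (u : L2) :
    op (bsq β) (op (dsq β i) u) = op (fun ξ => dsymb i 0 ξ * kernelHat β ξ) u :=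
  op_op (isSymb_bsq hβ hr) (isSymb_dsq hβ hr i) (hβ.isSymb_dsymb_mul i (by linarith))
    (fun ξ => by rw [← bsq_mul_self hβ ξ, dsq]; ring) u

/-- If `β̂^{1/2} ẑ` is the transform of `u`, then `i ξ_i β̂^{1/2} ẑ` is that of `∂_i u`. -/
theorem op_dsq_eq_dop (hβ : IsKernel β r) (hr : 2 ≤ r) (i : Fin 2) {z y : L2}
    (h : op (bsq β) z = bes 1 y) : op (dsq β i) z = dop i y := by
  apply l2Hat_inj
  filter_upwards [l2Hat_op (isSymb_dsq hβ hr i) z, l2Hat_op (isSymb_bsq hβ hr) z,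
    l2Hat_bes zero_le_one y, l2Hat_op (isSymb_dsymb i le_rfl) y] with ξ a b c d
  rw [dop, a, d, dsq, mul_assoc, ← b, h, c, dsymb, dsymb, jw_zero]
  push_cast
  ring

end Root

/-! ### Global solutions -/

theorem timeInterval_top : timeInterval ⊤ = Set.Ici 0 := by
  ext t
  simp [timeInterval]

section Global

variable {s r : ℝ} {β : Plane → ℝ} {F : ℝ → ℝ} {φ ψ : XSpace s} {w : ℝ → XSpace s}

/-- There is no global solution of negative energy. -/
theorem not_isSolution_top (hs : 1 ≤ s) (hr : 2 ≤ r) (hβ : IsKernel β r) (hF : ContDiff ℝ 2 F)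
    (hF0 : F 0 = 0) {Rφ Rψ : L2} (hRφ : HasR β φ.toL2 Rφ) (hRψ : HasR β ψ.toL2 Rψ)
    {ν : ℝ} (hν : 0 < ν) (hblow : ∀ u : ℝ, 0 ≤ u → u * deriv F u ≤ (1 + 2 * ν) * F u)
    (hE : 1 / 2 * ‖Rψ‖ ^ 2 + ∫ z : Plane, F (gradSq φ z) < 0) : ¬ IsSolution β F φ ψ ⊤ w := by
  intro h
  set w1 := tderiv ⊤ w with hw1
  set w2 := tderiv ⊤ w1 with hw2
  have hmem : ∀ t : ℝ, 0 ≤ t → t ∈ timeInterval ⊤ := fun t ht => by rwa [timeInterval_top]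
  have hsub : ∀ b : ℝ, Set.Icc 0 b ⊆ timeInterval ⊤ := fun b => timeInterval_subset (EReal.coe_lt_top b)
  -- The values of `w` at negative times are arbitrary; freezing time at `0` gives a continuous
  -- curve on the whole line.
  have hwc : Continuous fun t : ℝ => w (max t 0) :=
    h.continuousOn.comp_continuous (by fun_prop) fun t => hmem _ (le_max_right _ _)
  set q : ℝ → L2 := fun t => ∑ i, op (dsq β i) (stressL hs F i (w (max t 0))) with hq
  have hqc : Continuous q := continuous_finsetSum _ fun i _ =>
    (op (dsq β i)).continuous.comp ((continuous_stressL hs hF i).comp hwc)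
  have hqe : ∀ t, 0 ≤ t → q t = ∑ i, op (dsq β i) (stressL hs F i (w t)) := fun t ht => by
    rw [hq]
    simp only [max_eq_left ht]
  -- `z` and `z'` stand for `R w` and `R w_t` but are defined by integrating `q`, so membership of
  -- `w(t)` in the domain of `R` need not be known.
  set z' : ℝ → L2 := fun t => Rψ + ∫ v in (0 : ℝ)..t, q v with hz'
  set z : ℝ → L2 := fun t => Rφ + t • Rψ + prim2 0 q t with hz
  have dz' : ∀ t, HasDerivAt z' (q t) t := fun t =>
    ((hqc.integral_hasStrictDerivAt 0 t).hasDerivAt).const_add Rψ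
  have dz : ∀ t, HasDerivAt z (z' t) t := fun t => by
    have d3 : HasDerivAt (fun t : ℝ => Rφ + t • Rψ) Rψ t := by
      have := ((hasDerivAt_id t).smul_const Rψ).const_add Rφ
      simpa using this
    exact d3.add (hasDerivAt_prim2 hqc 0 t)
  -- `Y` is the inclusion into `L²` as a continuous map, so that derivatives of `X^s`-valued curves
  -- pass to `L²`.
  set Y : XSpace s →L[ℝ] L2 := (bes 1).comp (XSpace.yco hs) with hY
  have hYe : ∀ v : XSpace s, Y v = v.toL2 := fun v => XSpace.bes_yco hs v
  have e2 : Set.EqOn (fun t => Y (w2 t)) (fun t => op (bsq β) (q t)) (timeInterval ⊤) := by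
    refine eqOn_timeInterval (Y.continuous.comp_continuousOn h.continuousOn_tderiv2)
      ((op (bsq β)).continuous.comp hqc).continuousOn fun t ht h0 => ?_
    rw [hYe, hqe t h0.le, map_sum]
    simp only [op_bsq_op_dsq hβ hr]
    exact (eqForce_iff_toL2 hs hβ hr hF _ _).1 (h.eqn t ht h0)
  -- `w` and the multiplier `β̂^{1/2}` applied to `z` have equal second derivatives and equal data
  -- at `0`; two integrations identify first the velocities, then the positions.
  have e1 : ∀ t, 0 ≤ t → Y (w1 t) = op (bsq β) (z' t) := fun t ht => by
    refine sub_eq_zero.1 (eqOn_of_hasDerivWithinAt (f := fun t => Y (w1 t) - op (bsq β) (z' t))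
      (b := t) ?_ (fun x hx => ?_) t ⟨ht, le_rfl⟩)
    · simp only [hz', intervalIntegral.integral_same, add_zero]
      rw [hYe, op_bsq_of_hasR hβ hr hRψ, hw1, tderiv, h.init_deriv, sub_self]
    · have d1 := Y.hasFDerivAt.comp_hasDerivWithinAt x
        ((h.hasDerivWithinAt_tderiv (hsub t hx)).mono (hsub t))
      have d2 := (op (bsq β)).hasFDerivAt.comp_hasDerivAt x (dz' x)
      exact (d1.sub d2.hasDerivWithinAt).congr_deriv (sub_eq_zero.2 (e2 (hsub t hx)))
  have e0 : ∀ t, 0 ≤ t → Y (w t) = op (bsq β) (z t) := fun t ht => by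
    refine sub_eq_zero.1 (eqOn_of_hasDerivWithinAt (f := fun t => Y (w t) - op (bsq β) (z t))
      (b := t) ?_ (fun x hx => ?_) t ⟨ht, le_rfl⟩)
    · simp only [hz, prim2, intervalIntegral.integral_same, add_zero, zero_smul]
      rw [hYe, op_bsq_of_hasR hβ hr hRφ, h.init, sub_self]
    · have d1 := Y.hasFDerivAt.comp_hasDerivWithinAt x
        ((h.hasDerivWithinAt (hsub t hx)).mono (hsub t))
      have d2 := (op (bsq β)).hasFDerivAt.comp_hasDerivAt x (dz x)
      exact (d1.sub d2.hasDerivWithinAt).congr_deriv (sub_eq_zero.2 (e1 x hx.1))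
  -- Integration by parts turns `i ξ_i β̂^{1/2} û` into the transform of `∂_i v`. The pair `(z',
  -- w_t)` gives conservation of energy, the pair `(z, w)` the virial identity.
  have hin : ∀ (t : ℝ) (u : L2) (v : XSpace s), 0 ≤ t → Y v = op (bsq β) u →
      inner ℝ u (q t) = -∑ i, inner ℝ (dop i (v.yco hs)) (stressL hs F i (w t)) :=
    fun t u v ht huv => by
      rw [hqe t ht, inner_sum, ← Finset.sum_neg_distrib]
      refine Finset.sum_congr rfl fun i _ => ?_
      rw [inner_op_dsq hβ hr, op_dsq_eq_dop hβ hr i (y := v.yco hs) huv.symm]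
  have hP : ∀ t, 0 ≤ t → 1 / 2 * ‖z' t‖ ^ 2 + potential F (w t)
      = 1 / 2 * ‖Rψ‖ ^ 2 + ∫ z : Plane, F (gradSq φ z) := fun t ht => by
    refine sub_eq_zero.1 (eqOn_of_hasDerivWithinAt
      (f := fun t => 1 / 2 * ‖z' t‖ ^ 2 + potential F (w t)
        - (1 / 2 * ‖Rψ‖ ^ 2 + ∫ z : Plane, F (gradSq φ z))) (b := t) ?_ (fun x hx => ?_) t ⟨ht, le_rfl⟩)
    · simp only [hz', intervalIntegral.integral_same, add_zero, h.init, potential, sub_self]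
    · have d1 := (((dz' x).norm_sq).const_mul (1 / 2)).hasDerivWithinAt (s := Set.Icc 0 t)
      have d2 := (hasFDerivAt_potential hs hF hF0 (w x)).comp_hasDerivWithinAt x
        ((h.hasDerivWithinAt (hsub t hx)).mono (hsub t))
      refine ((d1.add d2).sub_const _).congr_deriv ?_
      -- The power `⟨z', q⟩` cancels the rate of change of the potential energy.
      rw [potentialDeriv_apply, hin x _ (w1 x) hx.1 (e1 x hx.1)]
      simp only [real_inner_comm]
      ring
  exact false_of_virial hν hE (fun t _ => dz t) (fun t _ => dz' t) hP fun t ht => by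
    rw [hin t _ (w t) ht (e0 t ht)]
    exact neg_le_neg (le_virial hs hF hF0 hblow (w t))

end Global

end

end AntiPlane

/-! ### Conclusion -/

theorem theorem5p2 (s r : ℝ) (hsr : (2 < s ∧ 2 ≤ r) ∨ (1 ≤ s ∧ 3 < r))
    (β : Plane → ℝ) (hβ : IsKernel β r)
    (F : ℝ → ℝ) (hF : ContDiff ℝ ((⌊s⌋₊ + 1 : ℕ) : WithTop ℕ∞) F) (hF0 : F 0 = 0)
    (φ ψ : XSpace s) (T : EReal) (w : ℝ → XSpace s)
    (hw : IsMaximalSolution β F φ ψ T w)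
    (Rφ Rψ : L2) (hRφ : HasR β φ.toL2 Rφ) (hRψ : HasR β ψ.toL2 Rψ)
    (hFφ : Integrable (fun z : Plane => F (gradSq φ z)) volume)
    (ν : ℝ) (hν : 0 < ν)
    (hblow : ∀ u : ℝ, 0 ≤ u → u * deriv F u ≤ (1 + 2 * ν) * F u)
    (hE : 1 / 2 * ‖Rψ‖ ^ 2 + ∫ z : Plane, F (gradSq φ z) < 0) :
    BlowsUpInFiniteTime T w := by
  have hs : 1 ≤ s := by rcases hsr with h | h <;> linarith [h.1]
  have hr : 2 ≤ r := by rcases hsr with h | h <;> linarith [h.2]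
  have hF2 := contDiff_two hs hF
  have hsol := hw.isSolution
  induction T with
  | bot => exact absurd hsol.pos (by simp)
  | top => exact absurd hsol (not_isSolution_top hs hr hβ hF2 hF0 hRφ hRψ hν hblow hE)
  | coe T₀ =>
    refine ⟨T₀, rfl, ?_⟩
    -- A finite limit superior gives a finite eventual bound on `‖w t‖` before `T₀`; the solution
    -- then extends, against maximality.
    by_contra hlim
    obtain ⟨c, hc, hc_top⟩ := exists_between (lt_top_iff_ne_top.2 hlim)
    obtain ⟨ρ, hρ, hsρ, G, hG⟩ := exists_isForceMap hs hsr hβ hF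
    have hM : ∀ᶠ t in 𝓝[<] T₀, ‖w t‖ ≤ c.toReal := by
      filter_upwards [eventually_lt_of_limsup_lt hc] with t ht
      have h1 : ‖w t‖ₑ ≤ c := le_self_add.trans ht.le
      rw [← toReal_enorm]
      exact ENNReal.toReal_mono hc_top.ne h1
    obtain ⟨T', w', hT', hw', heq⟩ := hsol.exists_extension hβ hr hF2 hG hρ hsρ hM
    exact hw.maximal T' w' hT' hw' heq
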